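/- Let $U\subseteq\mathbb R^3$ be the domain of local coordinates $x=(x^0,x^1,x^2)$ of a $(2+1)$-dimensional pseudo-Riemannian spacetime, with a smooth triad $e^a_\mu$, $\det(e^a_\mu)\neq0$, such that $g_{\mu\nu}=e^a_\mu e^b_\nu\eta_{ab}$, $\eta=\mathrm{diag}(1,-1,-1)$. Let $\Gamma^\mu_{\nu\alpha}$ be its Christoffel symbols, let a semicolon denote the covariant derivative and a comma the partial derivative, and let $e_{\mu\nu\alpha}=\det(e^a_\mu)\,\epsilon_{\mu\nu\alpha}$, $\epsilon_{012}=1$. Let $s=\pm1$, $\hat\gamma^0=\sigma_3$, $\hat\gamma^1=is\sigma_1$, $\hat\gamma^2=i\sigma_2$ (with the Pauli matrices $\sigma_j$), $\gamma^\mu=e^\mu_a\hat\gamma^a$, $\Gamma_\nu=-\frac14\gamma^\alpha{}_{;\nu}\gamma_\alpha$, where $\gamma^\alpha{}_{;\nu}=\partial_\nu\gamma^\alpha+\Gamma^\alpha_{\nu\beta}\gamma^\beta$. Let $A_\nu$ be a smooth real potential, $F_{\nu\mu}=\partial_\nu A_\mu-\partial_\mu A_\nu$, $\mathcal P_\nu=i(\partial_\nu+\Gamma_\nu)-A_\nu$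 acting on functions $U\to\mathbb C^2$, and $H=\gamma^\nu\mathcal P_\nu-m$ with $m\in\mathbb R$. A symmetry operator of $H$ is an operator $X=X^\nu\mathcal P_\nu+\chi$ with smooth complex $2\times2$ matrix coefficients for which $[X,H]=\Psi H$ holds on smooth functions, with some $\Psi=\Psi^\nu\mathcal P_\nu+\bar\Psi$ with smooth matrix coefficients. (a) For every symmetry operator $X$ there are a smooth matrix function $R$, smooth complex-valued functions $\xi^\mu$ and a smooth complex-valued function $\varphi$ such that $$X=RH+\hat X,\qquad \hat X=\xi^\mu\mathcal P_\mu-\frac s4\,\xi^{\mu;\nu}e_{\mu\nu\alpha}\gamma^\alpha+\varphi ,$$ and $$\xi^{\mu;\sigma}+\xi^{\sigma;\mu}=\tfrac23\,\xi^\alpha{}_{;\alpha}\,g^{\mu\sigma},\qquad m\,\xi^\mu{}_{;\mu}=0,\qquad \varphi_{,\beta}=\tfrac i3\,\xi^\nu{}_{;\nu\beta}+F_{\beta\mu}\xi^\mu .\tag{$*$}$$ So, modulo the trivial operators $RH$, only scalar coefficients of the derivatives occur. (b) Conversely, if smooth $\xi^\mu$ and $\varphi$ satisfy $(*)$, then $RH+\hat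 X$ is a symmetry operator for every smooth matrix function $R$. (c) If $m\neq0$ and smooth $\xi^\mu$, $\varphi$ satisfy $(*)$, then $\xi$ is a Killing field, $\xi_{\nu;\mu}+\xi_{\mu;\nu}=0$, and $[\hat X,H]=0$. -/

import Mathlib

open scoped ContDiff

noncomputable section

namespace DiracSymm

/-- Points of a coordinate domain, `x = (x⁰, x¹, x²)`. -/
abbrev Coord := Fin 3 → ℝ

/-- Values of a two-component spinor. -/
abbrev Spinor := Fin 2 → ℂ

/-- Complex `2 × 2` matrices. -/
abbrev Mat := Matrix (Fin 2) (Fin 2) ℂ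

/-- The partial derivative `∂f/∂x^μ`. -/
def pd {V : Type*} [NormedAddCommGroup V] [NormedSpace ℝ V]
    (μ : Fin 3) (f : Coord → V) (x : Coord) : V :=
  fderiv ℝ f x (Pi.single μ 1)

/-- The entrywise partial derivative of a matrix function. -/
def pdMat (μ : Fin 3) (B : Coord → Mat) (x : Coord) : Mat :=
  Matrix.of fun i j => pd μ (fun y => B y i j) x

/-- A matrix function whose entries are smooth on `U`. -/
def SmoothMat (U : Set Coord) (B : Coord → Mat) : Prop :=
  ∀ i j, ContDiffOn ℝ ∞ (fun x => B x i j) U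

/-- The Minkowski metric `diag(1, -1, -1)`; it is its own inverse. -/
def η : Matrix (Fin 3) (Fin 3) ℝ := Matrix.diagonal ![1, -1, -1]

/-- The Levi-Civita symbol: totally antisymmetric, with `ε 0 1 2 = 1`. -/
def ε (μ ν α : Fin 3) : ℝ :=
  (((ν : ℕ) : ℝ) - ((μ : ℕ) : ℝ)) * (((α : ℕ) : ℝ) - ((μ : ℕ) : ℝ)) *
    (((α : ℕ) : ℝ) - ((ν : ℕ) : ℝ)) / 2

/-- The coordinate domain of a `(2+1)`-dimensional pseudo-Riemannian spacetime: an open set of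
`ℝ³` with a smooth, everywhere linearly independent triad `e^a_μ`, which determines the metric
`g_{μν} = e^a_μ e^b_ν η_{ab}`. -/
structure Spacetime where
  /-- the coordinate domain -/
  U : Set Coord
  isOpen_U : IsOpen U
  /-- `triad a μ x` is `e^a_μ(x)` -/
  triad : Fin 3 → Fin 3 → Coord → ℝ
  smooth_triad : ∀ a μ, ContDiffOn ℝ ∞ (triad a μ) U
  det_triad_ne_zero : ∀ x ∈ U, (Matrix.of fun a μ => triad a μ x).det ≠ 0

namespace Spacetime

variable (M : Spacetime)

/-- The covariant metric `g_{μν}(x)`. -/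
def g (x : Coord) : Matrix (Fin 3) (Fin 3) ℝ :=
  Matrix.of fun μ ν => ∑ a, ∑ b, M.triad a μ x * M.triad b ν x * η a b

/-- The contravariant metric `g^{μν}(x)`. -/
def gInv (x : Coord) : Matrix (Fin 3) (Fin 3) ℝ := (M.g x)⁻¹

/-- The inverse triad `e^μ_a = g^{μν} e^b_ν η_{ab}`. -/
def invTriad (μ a : Fin 3) (x : Coord) : ℝ :=
  ∑ ν, ∑ b, M.gInv x μ ν * M.triad b ν x * η a b

/-- The Christoffel symbols `Γ^μ_{να}`. -/
def christoffel (μ ν α : Fin 3) (x : Coord) : ℝ :=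
  1 / 2 * ∑ β, M.gInv x μ β *
    (pd α (fun y => M.g y β ν) x + pd ν (fun y => M.g y β α) x - pd β (fun y => M.g y ν α) x)

/-- The Levi-Civita tensor `e_{μνα} = det(e^a_μ) ε_{μνα}`. -/
def leviCivita (μ ν α : Fin 3) (x : Coord) : ℝ :=
  (Matrix.of fun a μ' => M.triad a μ' x).det * ε μ ν α

/-- `covDeriv ξ μ ν` is `ξ^μ_{;ν} = ∂_ν ξ^μ + Γ^μ_{να} ξ^α`, for a vector field with complex
components. -/
def covDeriv (ξ : Fin 3 → Coord → ℂ) (μ ν : Fin 3) (x : Coord) : ℂ :=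
  pd ν (ξ μ) x + ∑ α, (M.christoffel μ ν α x : ℂ) * ξ α x

/-- `covDerivUp ξ μ ν` is `ξ^{μ;ν} = g^{νλ} ξ^μ_{;λ}`. -/
def covDerivUp (ξ : Fin 3 → Coord → ℂ) (μ ν : Fin 3) (x : Coord) : ℂ :=
  ∑ l, (M.gInv x ν l : ℂ) * M.covDeriv ξ μ l x

/-- The divergence `ξ^μ_{;μ}`. Its partial derivative `∂_β` is `ξ^μ_{;μβ}`. -/
def divergence (ξ : Fin 3 → Coord → ℂ) (x : Coord) : ℂ := ∑ μ, M.covDeriv ξ μ μ x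

/-- The covector `ξ_μ = g_{μν} ξ^ν`. -/
def lower (ξ : Fin 3 → Coord → ℂ) (μ : Fin 3) (x : Coord) : ℂ :=
  ∑ ν, (M.g x μ ν : ℂ) * ξ ν x

/-- `covDerivLower V μ ν` is `V_{μ;ν} = ∂_ν V_μ - Γ^α_{νμ} V_α`, for a covector field. -/
def covDerivLower (V : Fin 3 → Coord → ℂ) (μ ν : Fin 3) (x : Coord) : ℂ :=
  pd ν (V μ) x - ∑ α, (M.christoffel α ν μ x : ℂ) * V α x

/-- The conformal Killing equation `ξ^{μ;σ} + ξ^{σ;μ} = (2/3) ξ^α_{;α} g^{μσ}`. -/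
def IsConformalKilling (ξ : Fin 3 → Coord → ℂ) : Prop :=
  ∀ x ∈ M.U, ∀ μ σ, M.covDerivUp ξ μ σ x + M.covDerivUp ξ σ μ x =
    2 / 3 * M.divergence ξ x * (M.gInv x μ σ : ℂ)

/-- The Killing equation `ξ_{ν;μ} + ξ_{μ;ν} = 0`. -/
def IsKilling (ξ : Fin 3 → Coord → ℂ) : Prop :=
  ∀ x ∈ M.U, ∀ μ ν,
    M.covDerivLower (M.lower ξ) ν μ x + M.covDerivLower (M.lower ξ) μ ν x = 0

end Spacetime

/-- The electromagnetic tensor `F_{νμ} = ∂_ν A_μ - ∂_μ A_ν`. -/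
def fieldStrength (A : Fin 3 → Coord → ℝ) (ν μ : Fin 3) (x : Coord) : ℝ :=
  pd ν (A μ) x - pd μ (A ν) x

/-- The flat Dirac matrices `σ₃, i s σ₁, i σ₂`. -/
def gammaHat (s : ℝ) : Fin 3 → Mat :=
  ![!![1, 0; 0, -1], (Complex.I * (s : ℂ)) • !![0, 1; 1, 0],
    Complex.I • !![0, -Complex.I; Complex.I, 0]]

namespace Spacetime

variable (M : Spacetime) (s : ℝ)

/-- The Dirac matrices `γ^μ = e^μ_a γ̂^a`. -/
def gamma (μ : Fin 3) (x : Coord) : Mat := ∑ a, (M.invTriad μ a x : ℂ) • gammaHat s a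

/-- The Dirac matrices with lower index, `γ_μ = g_{μν} γ^ν`. -/
def gammaLower (μ : Fin 3) (x : Coord) : Mat := ∑ ν, (M.g x μ ν : ℂ) • M.gamma s ν x

/-- `covDerivGamma α ν` is `γ^α_{;ν} = ∂_ν γ^α + Γ^α_{νβ} γ^β`. -/
def covDerivGamma (α ν : Fin 3) (x : Coord) : Mat :=
  pdMat ν (M.gamma s α) x + ∑ β, (M.christoffel α ν β x : ℂ) • M.gamma s β x

/-- The spinor connection `Γ_ν = -(1/4) γ^α_{;ν} γ_α`. -/
def spinConn (ν : Fin 3) (x : Coord) : Mat :=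
  (-(1 / 4) : ℂ) • ∑ α, M.covDerivGamma s α ν x * M.gammaLower s α x

/-- The generalized momentum operator `P_ν = i(∂_ν + Γ_ν) - A_ν` on spinor functions. -/
def momentum (A : Fin 3 → Coord → ℝ) (ν : Fin 3) (ψ : Coord → Spinor) (x : Coord) : Spinor :=
  Complex.I • (pd ν ψ x + (M.spinConn s ν x).mulVec (ψ x)) - (A ν x : ℂ) • ψ x

end Spacetime

/-- The coefficients of a first-order differential operator `X^ν P_ν + χ` with matrix
coefficients. -/
structure FirstOrderOp where
  /-- the matrix coefficients `X^ν` of the momenta -/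
  vec : Fin 3 → Coord → Mat
  /-- the matrix term `χ` without derivatives -/
  pot : Coord → Mat

/-- All coefficients are smooth on `U`. -/
def FirstOrderOp.Smooth (X : FirstOrderOp) (U : Set Coord) : Prop :=
  (∀ ν, SmoothMat U (X.vec ν)) ∧ SmoothMat U X.pot

namespace Spacetime

variable (M : Spacetime) (s : ℝ) (A : Fin 3 → Coord → ℝ)

/-- The action of `X^ν P_ν + χ` on a spinor function. -/
def act (X : FirstOrderOp) (ψ : Coord → Spinor) (x : Coord) : Spinor :=
  ∑ ν, (X.vec ν x).mulVec (M.momentum s A ν ψ x) + (X.pot x).mulVec (ψ x)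

/-- The Dirac operator `H = γ^ν P_ν - m`. -/
def dirac (m : ℝ) : FirstOrderOp where
  vec := M.gamma s
  pot := fun _ => -((m : ℂ) • (1 : Mat))

/-- `X` is a symmetry operator of the Dirac operator `H`: `[X, H] = Ψ H` on spinor functions
smooth on `U`, for some first-order operator `Ψ` with smooth matrix coefficients. -/
def IsSymmetryOperator (m : ℝ) (X : FirstOrderOp) : Prop :=
  ∃ Ψ : FirstOrderOp, Ψ.Smooth M.U ∧
    ∀ ψ : Coord → Spinor, ContDiffOn ℝ ∞ ψ M.U → ∀ x ∈ M.U,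
      M.act s A X (M.act s A (M.dirac s m) ψ) x - M.act s A (M.dirac s m) (M.act s A X ψ) x =
        M.act s A Ψ (M.act s A (M.dirac s m) ψ) x

/-- `X` commutes with the Dirac operator on spinor functions smooth on `U`. -/
def CommutesWithDirac (m : ℝ) (X : FirstOrderOp) : Prop :=
  ∀ ψ : Coord → Spinor, ContDiffOn ℝ ∞ ψ M.U → ∀ x ∈ M.U,
    M.act s A X (M.act s A (M.dirac s m) ψ) x = M.act s A (M.dirac s m) (M.act s A X ψ) x

/-- `X` and `Y` differ by the trivial operator `R H`, for a matrix function `R`. -/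
def DifferByTrivial (m : ℝ) (R : Coord → Mat) (X Y : FirstOrderOp) : Prop :=
  ∀ ψ : Coord → Spinor, ContDiffOn ℝ ∞ ψ M.U → ∀ x ∈ M.U,
    M.act s A X ψ x = M.act s A Y ψ x + (R x).mulVec (M.act s A (M.dirac s m) ψ x)

/-- The operator `ξ^μ P_μ - (s/4) ξ^{μ;ν} e_{μνα} γ^α + φ`. -/
def normalForm (ξ : Fin 3 → Coord → ℂ) (φ : Coord → ℂ) : FirstOrderOp where
  vec := fun μ x => ξ μ x • (1 : Mat)
  pot := fun x =>
    (-((s : ℂ) / 4)) • (∑ μ, ∑ ν, ∑ α,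
      (M.covDerivUp ξ μ ν x * (M.leviCivita μ ν α x : ℂ)) • M.gamma s α x) + φ x • (1 : Mat)

/-- The system for `ξ` and `φ`: both are smooth on `U`, `ξ` is a conformal Killing field with
`m ξ^μ_{;μ} = 0`, and `φ_{,β} = (i/3) ξ^ν_{;νβ} + F_{βμ} ξ^μ`. -/
structure IsDetermining (m : ℝ) (ξ : Fin 3 → Coord → ℂ) (φ : Coord → ℂ) : Prop where
  smooth_vec : ∀ μ, ContDiffOn ℝ ∞ (ξ μ) M.U
  smooth_fun : ContDiffOn ℝ ∞ φ M.U
  conformalKilling : M.IsConformalKilling ξ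
  mass : ∀ x ∈ M.U, (m : ℂ) * M.divergence ξ x = 0
  potential : ∀ x ∈ M.U, ∀ β, pd β φ x =
    Complex.I / 3 * pd β (M.divergence ξ) x + ∑ μ, (fieldStrength A β μ x : ℂ) * ξ μ x

end Spacetime

end DiracSymm

end

/-! Written as `i X^ν ∂_ν + Z`, with the spin connection and the potential absorbed in `Z`, both
sides of `[X, H] = Ψ H` are second-order operators with matrix coefficients. Such an operator
annihilates all smooth spinors at a point exactly when its zeroth coefficient, its first
coefficients and the symmetrized second coefficients vanish there (`coeff_eq_zero_of_secondOrder`,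
`secondOrder_eq_zero`). The theorem amounts to solving these three families of equations, each of
which becomes algebra over the flat Dirac matrices after passing to the orthonormal frame `E_a =
e^μ_a ∂_μ`.

Second order. The equations are linear in the frame components `X^a`, `Ψ^a` and have constant
coefficients. Their solutions are `X^a = R γ̂^a + ξ^a` (`eq_leftFactor_mul_add`). Since `[R H, H] =
[R, H] H`, subtracting `R H` keeps the symmetry property and leaves an operator with scalar `ξ^μ`.
For such an operator the second-order part forces `Ψ^ν = 0`, so `Ψ` is multiplication by a matrix
`q`.

First order. What remains is `∇ξ` contracted with the Dirac matrices, the commutator of `χ` with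
them, and `q γ̂^b`. A commutator can only compensate the antisymmetric part of `∇ξ` and `q` only its
trace. Hence `ξ` is conformal Killing, `q = -(i/3) ξ^ν_{;ν}`, and `χ` is the rotation term up to a
scalar `φ` (`gammaHat_condition_iff`).

Zeroth order. No curvature has to be computed, because `γ^ν Γ_ν` depends only on the structure
coefficients of the frame (`sum_gammaHat_frameConn`). Their derivative along `ξ` is given by the
Jacobi identity in terms of `[ξ, E_a] = L_a^b E_b` (`dir_structureCoeff`). The first-order equations
can be restated through `L`, and then all structure coefficients cancel (`potential_commutator_eq`).
The survivors are a multiple of `m ξ^ν_{;ν}` and the Dirac matrices weighted by the defect of the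
equation for `φ_{,β}` (`scalarZero_eq`).

The first-order equations are equivalences and the zeroth-order formula is an identity, so the
converse reads them backwards and gives `[X̂, H] = -(i/3) ξ^ν_{;ν} H`. If `m ≠ 0` the divergence
vanishes, which gives the Killing equation and the commutation. -/

noncomputable section
namespace DiracSymm

/-! ### Partial derivatives on a coordinate domain -/

section Calculus

variable {V : Type*} [NormedAddCommGroup V] [NormedSpace ℝ V]

theorem pd_congr {U : Set Coord} (hU : IsOpen U) {f g : Coord → V} (h : ∀ x ∈ U, f x = g x)
    {x : Coord} (hx : x ∈ U) (μ : Fin 3) : pd μ f x = pd μ g x := by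
  have : f =ᶠ[nhds x] g := Filter.eventually_of_mem (hU.mem_nhds hx) h
  simp only [pd, this.fderiv_eq]

theorem differentiableAt_of_smoothOn {U : Set Coord} (hU : IsOpen U) {f : Coord → V}
    (hf : ContDiffOn ℝ ∞ f U) {x : Coord} (hx : x ∈ U) : DifferentiableAt ℝ f x :=
  (hf.contDiffAt (hU.mem_nhds hx)).differentiableAt (by simp)

theorem smoothOn_pd {U : Set Coord} (hU : IsOpen U) {f : Coord → V}
    (hf : ContDiffOn ℝ ∞ f U) (μ : Fin 3) : ContDiffOn ℝ ∞ (pd μ f) U := by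
  have h := hf.fderiv_of_isOpen hU (m := ∞) (by simp)
  exact h.clm_apply contDiffOn_const

theorem pd_comm {U : Set Coord} (hU : IsOpen U) {f : Coord → V}
    (hf : ContDiffOn ℝ ∞ f U) {x : Coord} (hx : x ∈ U) (μ ν : Fin 3) :
    pd μ (pd ν f) x = pd ν (pd μ f) x := by
  have hc := hf.contDiffAt (hU.mem_nhds hx)
  have hs : IsSymmSndFDerivAt ℝ f x := hc.isSymmSndFDerivAt (by
    rw [minSmoothness_of_isRCLikeNormedField]; exact WithTop.coe_le_coe.2 (le_top (a := (2 : ℕ∞))))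
  have hd : DifferentiableAt ℝ (fderiv ℝ f) x :=
    differentiableAt_of_smoothOn hU (hf.fderiv_of_isOpen hU (m := ∞) (by simp)) hx
  have key : ∀ α β : Fin 3, pd α (pd β f) x =
      fderiv ℝ (fderiv ℝ f) x (Pi.single α 1) (Pi.single β 1) := by
    intro α β
    have : pd β f = fun y => (fderiv ℝ f y) (Pi.single β 1) := rfl
    rw [this, pd, fderiv_clm_apply hd (differentiableAt_const _)]
    simp
  rw [key, key]
  exact hs _ _

theorem pd_const (c : V) (μ : Fin 3) (x : Coord) : pd μ (fun _ => c) x = 0 := by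
  simp [pd]

theorem pd_add {f g : Coord → V} {x : Coord} (hf : DifferentiableAt ℝ f x)
    (hg : DifferentiableAt ℝ g x) (μ : Fin 3) :
    pd μ (fun y => f y + g y) x = pd μ f x + pd μ g x := by
  simp [pd, fderiv_fun_add hf hg]

theorem pd_sub {f g : Coord → V} {x : Coord} (hf : DifferentiableAt ℝ f x)
    (hg : DifferentiableAt ℝ g x) (μ : Fin 3) :
    pd μ (fun y => f y - g y) x = pd μ f x - pd μ g x := by
  simp [pd, fderiv_fun_sub hf hg]

theorem pd_neg {f : Coord → V} {x : Coord} (μ : Fin 3) :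
    pd μ (fun y => -f y) x = -pd μ f x := by
  simp [pd]

theorem pd_sum {ι : Type*} {u : Finset ι} {f : ι → Coord → V} {x : Coord}
    (hf : ∀ i ∈ u, DifferentiableAt ℝ (f i) x) (μ : Fin 3) :
    pd μ (fun y => ∑ i ∈ u, f i y) x = ∑ i ∈ u, pd μ (f i) x := by
  simp [pd, fderiv_fun_sum hf]

theorem pd_mul {𝔸 : Type*} [NormedCommRing 𝔸] [NormedAlgebra ℝ 𝔸] {f g : Coord → 𝔸} {x : Coord}
    (hf : DifferentiableAt ℝ f x) (hg : DifferentiableAt ℝ g x) (μ : Fin 3) :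
    pd μ (fun y => f y * g y) x = pd μ f x * g x + f x * pd μ g x := by
  simp [pd, fderiv_fun_mul hf hg]
  ring

theorem pd_const_mul {𝔸 : Type*} [NormedCommRing 𝔸] [NormedAlgebra ℝ 𝔸] {f : Coord → 𝔸}
    {x : Coord} (hf : DifferentiableAt ℝ f x) (c : 𝔸) (μ : Fin 3) :
    pd μ (fun y => c * f y) x = c * pd μ f x := by
  rw [pd_mul (differentiableAt_const c) hf, pd_const]
  simp

theorem pd_ofReal {f : Coord → ℝ} {x : Coord} (hf : DifferentiableAt ℝ f x) (μ : Fin 3) :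
    pd μ (fun y => (f y : ℂ)) x = ((pd μ f x : ℝ) : ℂ) := by
  have h := (Complex.ofRealCLM.hasFDerivAt (x := f x)).comp x hf.hasFDerivAt
  have h2 : HasFDerivAt (fun y => (f y : ℂ)) (Complex.ofRealCLM.comp (fderiv ℝ f x)) x := h
  simp [pd, h2.fderiv]

theorem pd_apply {ι : Type*} [Fintype ι] {f : Coord → ι → V} {x : Coord}
    (hf : DifferentiableAt ℝ f x) (μ : Fin 3) (i : ι) :
    pd μ f x i = pd μ (fun y => f y i) x := by
  have h := hasFDerivAt_pi'.1 hf.hasFDerivAt i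
  rw [pd, pd, h.fderiv]
  rfl

theorem smoothOn_ofReal {U : Set Coord} {f : Coord → ℝ} (hf : ContDiffOn ℝ ∞ f U) :
    ContDiffOn ℝ ∞ (fun y => (f y : ℂ)) U :=
  Complex.ofRealCLM.contDiff.comp_contDiffOn hf

end Calculus

/-! ### Smooth matrix functions and the product rule on spinors -/

section MatrixCalculus

variable {U : Set Coord}

theorem SmoothMat.add {B C : Coord → Mat} (hB : SmoothMat U B) (hC : SmoothMat U C) :
    SmoothMat U (fun x => B x + C x) := fun i j => (hB i j).add (hC i j)

theorem SmoothMat.sub {B C : Coord → Mat} (hB : SmoothMat U B) (hC : SmoothMat U C) :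
    SmoothMat U (fun x => B x - C x) := fun i j => (hB i j).sub (hC i j)

theorem SmoothMat.neg {B : Coord → Mat} (hB : SmoothMat U B) :
    SmoothMat U (fun x => -B x) := fun i j => (hB i j).neg

theorem SmoothMat.const (c : Mat) : SmoothMat U (fun _ => c) := fun _ _ => contDiffOn_const

theorem SmoothMat.smul {f : Coord → ℂ} {B : Coord → Mat} (hf : ContDiffOn ℝ ∞ f U)
    (hB : SmoothMat U B) : SmoothMat U (fun x => f x • B x) := fun i j => hf.mul (hB i j)

theorem SmoothMat.mul {B C : Coord → Mat} (hB : SmoothMat U B) (hC : SmoothMat U C) :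
    SmoothMat U (fun x => B x * C x) := fun i j => by
  simp only [Matrix.mul_apply]
  exact ContDiffOn.sum fun k _ => (hB i k).mul (hC k j)

theorem SmoothMat.sum {ι : Type*} {u : Finset ι} {B : ι → Coord → Mat}
    (hB : ∀ a ∈ u, SmoothMat U (B a)) : SmoothMat U (fun x => ∑ a ∈ u, B a x) := fun i j => by
  simp only [Matrix.sum_apply]
  exact ContDiffOn.sum fun a ha => hB a ha i j

theorem smoothMat_pdMat (hU : IsOpen U) {B : Coord → Mat} (hB : SmoothMat U B) (μ : Fin 3) :
    SmoothMat U (pdMat μ B) := fun i j => smoothOn_pd hU (hB i j) μ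

theorem SmoothMat.mulVec {B : Coord → Mat} {ψ : Coord → Spinor} (hB : SmoothMat U B)
    (hψ : ContDiffOn ℝ ∞ ψ U) : ContDiffOn ℝ ∞ (fun x => (B x).mulVec (ψ x)) U := by
  refine contDiffOn_pi.2 fun i => ?_
  simp only [Matrix.mulVec, dotProduct]
  exact ContDiffOn.sum fun k _ => (hB i k).mul (contDiffOn_pi.1 hψ k)

theorem pdMat_congr (hU : IsOpen U) {B C : Coord → Mat} (h : ∀ x ∈ U, B x = C x)
    {x : Coord} (hx : x ∈ U) (μ : Fin 3) : pdMat μ B x = pdMat μ C x := by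
  ext i j
  exact pd_congr hU (fun y hy => by rw [h y hy]) hx μ

theorem pdMat_add (hU : IsOpen U) {B C : Coord → Mat} (hB : SmoothMat U B) (hC : SmoothMat U C)
    {x : Coord} (hx : x ∈ U) (μ : Fin 3) :
    pdMat μ (fun y => B y + C y) x = pdMat μ B x + pdMat μ C x := by
  ext i j
  exact pd_add (differentiableAt_of_smoothOn hU (hB i j) hx)
    (differentiableAt_of_smoothOn hU (hC i j) hx) μ

theorem pdMat_smul_const (hU : IsOpen U) {f : Coord → ℂ} (hf : ContDiffOn ℝ ∞ f U) (G : Mat)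
    {x : Coord} (hx : x ∈ U) (μ : Fin 3) :
    pdMat μ (fun y => f y • G) x = pd μ f x • G := by
  ext i j
  have := pd_mul (differentiableAt_of_smoothOn hU hf hx) (differentiableAt_const (G i j)) μ
  simpa [pdMat, pd_const] using this

theorem pdMat_sum_smul_const {ι : Type*} (u : Finset ι) (hU : IsOpen U) {f : ι → Coord → ℂ}
    (hf : ∀ a, ContDiffOn ℝ ∞ (f a) U) (G : ι → Mat) {x : Coord} (hx : x ∈ U) (μ : Fin 3) :
    pdMat μ (fun y => ∑ a ∈ u, f a y • G a) x = ∑ a ∈ u, pd μ (f a) x • G a := by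
  ext i j
  simp only [pdMat, Matrix.of_apply, Matrix.sum_apply, Matrix.smul_apply, smul_eq_mul]
  rw [pd_sum (fun a _ => (differentiableAt_of_smoothOn hU (hf a) hx).mul_const _)]
  refine Finset.sum_congr rfl fun a _ => ?_
  rw [pd_mul (differentiableAt_of_smoothOn hU (hf a) hx) (differentiableAt_const _), pd_const]
  simp

theorem pd_mulVec (hU : IsOpen U) {B : Coord → Mat} {ψ : Coord → Spinor} (hB : SmoothMat U B)
    (hψ : ContDiffOn ℝ ∞ ψ U) {x : Coord} (hx : x ∈ U) (μ : Fin 3) :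
    pd μ (fun y => (B y).mulVec (ψ y)) x =
      (pdMat μ B x).mulVec (ψ x) + (B x).mulVec (pd μ ψ x) := by
  ext i
  rw [pd_apply (differentiableAt_of_smoothOn hU (hB.mulVec hψ) hx)]
  simp only [Matrix.mulVec, dotProduct, Pi.add_apply]
  have hd : ∀ k, DifferentiableAt ℝ (fun y => ψ y k) x := fun k =>
    differentiableAt_of_smoothOn hU (contDiffOn_pi.1 hψ k) hx
  have hb : ∀ k, DifferentiableAt ℝ (fun y => B y i k) x := fun k =>
    differentiableAt_of_smoothOn hU (hB i k) hx
  rw [pd_sum (f := fun k y => B y i k * ψ y k) (fun k _ => (hb k).mul (hd k)),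
    ← Finset.sum_add_distrib]
  refine Finset.sum_congr rfl fun k _ => ?_
  rw [pd_mul (hb k) (hd k), pd_apply (differentiableAt_of_smoothOn hU hψ hx)]
  rfl

theorem pd_smul_const {f : Coord → ℂ} {x : Coord} (hf : DifferentiableAt ℝ f x) (v : Spinor)
    (μ : Fin 3) : pd μ (fun y => f y • v) x = pd μ f x • v := by
  have h : HasFDerivAt (fun y => f y • v) ((fderiv ℝ f x).smulRight v) x :=
    hf.hasFDerivAt.smul_const v
  simp [pd, h.fderiv]

end MatrixCalculus

/-! ### Clifford algebra of the flat Dirac matrices -/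

section CliffordAlgebra

/-- The diagonal entries of the Minkowski metric, as complex numbers. -/
def sgn (a : Fin 3) : ℂ := (η a a : ℂ)

theorem sgn_zero : sgn 0 = 1 := by simp [sgn, η]
theorem sgn_one : sgn 1 = -1 := by simp [sgn, η]
theorem sgn_two : sgn 2 = -1 := by simp [sgn, η]

theorem gammaHat_zero (s : ℝ) : gammaHat s 0 = !![1, 0; 0, -1] := rfl
theorem gammaHat_one (s : ℝ) :
    gammaHat s 1 = !![0, Complex.I * s; Complex.I * s, 0] := by
  simp [gammaHat]
theorem gammaHat_two (s : ℝ) : gammaHat s 2 = !![0, 1; -1, 0] := by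
  simp [gammaHat]

theorem mat_ext {B C : Mat} (h00 : B 0 0 = C 0 0) (h01 : B 0 1 = C 0 1) (h10 : B 1 0 = C 1 0)
    (h11 : B 1 1 = C 1 1) : B = C := by
  ext i j
  fin_cases i <;> fin_cases j <;> assumption

/-- The spinor connection in a frame, from the connection coefficients `w a b`. -/
def frameConn (s : ℝ) (w : Fin 3 → Fin 3 → ℂ) : Mat :=
  (-(1 / 4) : ℂ) • ∑ a, ∑ b, (w a b * sgn b) • (gammaHat s a * gammaHat s b)

variable {s : ℝ}

theorem sq_sign (hs : s = 1 ∨ s = -1) : (s : ℂ) ^ 2 = 1 := by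
  rcases hs with rfl | rfl <;> norm_num

/-- From `[γ̂^a γ̂^b, γ̂^d] = 2 (γ̂^a η^{bd} - η^{ad} γ̂^b)`: antisymmetry of `w` makes the two
resulting sums equal. This is the infinitesimal form of the spin double cover and expresses that the
Dirac matrices are covariantly constant. -/
theorem frameConn_commutator (hs : s = 1 ∨ s = -1) {w : Fin 3 → Fin 3 → ℂ}
    (hw : ∀ a b, w a b * sgn b + w b a * sgn a = 0) (d : Fin 3) :
    frameConn s w * gammaHat s d - gammaHat s d * frameConn s w = -∑ a, w a d • gammaHat s a := by
  have h2 := sq_sign hs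
  have hI := Complex.I_sq
  have e00 := hw 0 0
  have e11 := hw 1 1
  have e22 := hw 2 2
  have e01 := hw 0 1
  have e02 := hw 0 2
  have e12 := hw 1 2
  simp only [sgn_zero, sgn_one, sgn_two] at e00 e11 e22 e01 e02 e12
  -- With respect to the signature `(1, -1, -1)`, antisymmetry leaves the three independent entries
  -- `w 0 1`, `w 0 2`, `w 1 2`.
  have f00 : w 0 0 = 0 := by linear_combination e00 / 2
  have f11 : w 1 1 = 0 := by linear_combination -e11 / 2
  have f22 : w 2 2 = 0 := by linear_combination -e22 / 2
  have f10 : w 1 0 = w 0 1 := by linear_combination e01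
  have f20 : w 2 0 = w 0 2 := by linear_combination e02
  have f21 : w 2 1 = -w 1 2 := by linear_combination -e12
  fin_cases d <;>
  · simp only [frameConn, Fin.sum_univ_three, sgn_zero, sgn_one, sgn_two, f00, f11, f22, f10, f20,
      f21, gammaHat_zero, gammaHat_one, gammaHat_two, Fin.zero_eta, Fin.mk_one, Fin.reduceFinMk]
    apply mat_ext <;> simp <;> ring_nf <;>
      simp only [h2, hI] <;> ring

/-- Products of distinct Dirac matrices are traceless and antisymmetry removes the squares.
Consequently the spin connection does not enter the trace that defines `φ`. -/
theorem trace_frameConn {w : Fin 3 → Fin 3 → ℂ}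
    (hw : ∀ a b, w a b * sgn b + w b a * sgn a = 0) : (frameConn s w).trace = 0 := by
  have e00 := hw 0 0
  have e11 := hw 1 1
  have e22 := hw 2 2
  simp only [sgn_zero, sgn_one, sgn_two] at e00 e11 e22
  have f00 : w 0 0 = 0 := by linear_combination e00 / 2
  have f11 : w 1 1 = 0 := by linear_combination -e11 / 2
  have f22 : w 2 2 = 0 := by linear_combination -e22 / 2
  simp only [frameConn, Fin.sum_univ_three, sgn_zero, sgn_one, sgn_two, f00, f11, f22,
      gammaHat_zero, gammaHat_one, gammaHat_two]
  simp [Matrix.trace, Fin.sum_univ_two]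
  ring

/-- The term without derivatives of the massless free Dirac operator, divided by `i`, from the
structure coefficients `[E_a, E_b] = C_{ab}^c E_c` of the frame. -/
def structureTerm (s : ℝ) (C : Fin 3 → Fin 3 → Fin 3 → ℂ) : Mat :=
  (1 / 2 : ℂ) • ∑ a, (∑ b, C b a b) • gammaHat s a +
    (Complex.I * s / 8 * ∑ a, ∑ b, ∑ c, (ε a b c : ℂ) * C a b c * sgn c) • (1 : Mat)

/-- A product of three Dirac matrices has only a vector part and a totally antisymmetric part, the
latter scalar because `γ̂⁰ γ̂¹ γ̂² = -i s` in dimension `2+1`. The vector part sees a trace of `w`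
and the scalar part its total antisymmetrization; by `hC` (no torsion) both are expressed by `C`. -/
theorem sum_gammaHat_frameConn (hs : s = 1 ∨ s = -1) {w C : Fin 3 → Fin 3 → Fin 3 → ℂ}
    (hw : ∀ d a b, w d a b * sgn b + w d b a * sgn a = 0)
    (hC : ∀ a b c, C a b c = w a b c - w b a c) :
    ∑ d, gammaHat s d * frameConn s (w d) = structureTerm s C := by
  have h2 := sq_sign hs
  have h3 : (s : ℂ) ^ 3 = s := by rw [pow_succ, h2, one_mul]
  have hI := Complex.I_sq
  have h3I : (Complex.I : ℂ) ^ 3 = -Complex.I := by rw [pow_succ, hI]; ring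
  have f00 : ∀ d, w d 0 0 = 0 := fun d => by
    have := hw d 0 0
    rw [sgn_zero] at this
    linear_combination this / 2
  have f11 : ∀ d, w d 1 1 = 0 := fun d => by
    have := hw d 1 1
    rw [sgn_one] at this
    linear_combination -this / 2
  have f22 : ∀ d, w d 2 2 = 0 := fun d => by
    have := hw d 2 2
    rw [sgn_two] at this
    linear_combination -this / 2
  have f10 : ∀ d, w d 1 0 = w d 0 1 := fun d => by
    have := hw d 0 1
    rw [sgn_zero, sgn_one] at this
    linear_combination this
  have f20 : ∀ d, w d 2 0 = w d 0 2 := fun d => by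
    have := hw d 0 2
    rw [sgn_zero, sgn_two] at this
    linear_combination this
  have f21 : ∀ d, w d 2 1 = -w d 1 2 := fun d => by
    have := hw d 1 2
    rw [sgn_one, sgn_two] at this
    linear_combination -this
  simp only [frameConn, structureTerm, hC, Fin.sum_univ_three, sgn_zero, sgn_one, sgn_two, f00,
    f11, f22, f10, f20, f21, gammaHat_zero, gammaHat_one, gammaHat_two]
  apply mat_ext <;> simp [ε] <;> ring_nf <;>
      simp only [h2, hI, h3, h3I] <;> ring

/-- The traceless part of a potential with the commutators prescribed by `L`. -/
def rotationTerm (s : ℝ) (L : Fin 3 → Fin 3 → ℂ) : Mat :=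
  (-(s / 4) : ℂ) • ∑ c, ∑ a, ∑ d, ((ε c a d : ℂ) * sgn a * L a c) • gammaHat s d

/-- The matrix `β + β₀ γ̂⁰ + β₁ γ̂¹ + β₂ γ̂²`. -/
def cliff (s : ℝ) (β β₀ β₁ β₂ : ℂ) : Mat :=
  !![β + β₀, Complex.I * s * β₁ + β₂; Complex.I * s * β₁ - β₂, β - β₀]

theorem I_mul_sign_mul_self (hs : s = 1 ∨ s = -1) :
    (Complex.I * s) * (Complex.I * s) = (-1 : ℂ) := by
  linear_combination (s : ℂ) ^ 2 * Complex.I_sq - sq_sign hs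

theorem exists_cliff (hs : s = 1 ∨ s = -1) (B : Mat) :
    ∃ β β₀ β₁ β₂, B = cliff s β β₀ β₁ β₂ := by
  have h := I_mul_sign_mul_self hs
  -- `-(I * s)` is the inverse of `I * s`, the off-diagonal entry of `γ̂¹`.
  refine ⟨(B 0 0 + B 1 1) / 2, (B 0 0 - B 1 1) / 2, -(Complex.I * s) * (B 0 1 + B 1 0) / 2,
    (B 0 1 - B 1 0) / 2, ?_⟩
  apply mat_ext <;> simp [cliff]
  · ring
  · linear_combination (B 0 1 + B 1 0) / 2 * h
  · linear_combination (B 0 1 + B 1 0) / 2 * h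
  · ring

theorem cliff_eq_zero_iff (hs : s = 1 ∨ s = -1) {β β₀ β₁ β₂ : ℂ} :
    cliff s β β₀ β₁ β₂ = 0 ↔ β = 0 ∧ β₀ = 0 ∧ β₁ = 0 ∧ β₂ = 0 := by
  have h := I_mul_sign_mul_self hs
  constructor
  · intro h0
    have e := fun i j => congrFun (congrFun h0 i) j
    have e00 := e 0 0
    have e01 := e 0 1
    have e10 := e 1 0
    have e11 := e 1 1
    simp only [cliff, Matrix.of_apply, Matrix.cons_val', Matrix.cons_val_zero, Matrix.cons_val_one,
      Matrix.cons_val_fin_one, Matrix.zero_apply] at e00 e01 e10 e11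
    refine ⟨?_, ?_, ?_, ?_⟩
    · linear_combination (e00 + e11) / 2
    · linear_combination (e00 - e11) / 2
    · linear_combination -(Complex.I * s) / 2 * (e01 + e10) + β₁ * h
    · linear_combination (e01 - e10) / 2
  · rintro ⟨rfl, rfl, rfl, rfl⟩
    apply mat_ext <;> simp [cliff]

/-- A product of two distinct Dirac matrices is `± i s` times the third one, so the expression stays
in the span of `1` and the `γ̂^a`. The four coordinates for each `b` turn the matrix equations into
scalar ones. -/
theorem cliff_condition (hs : s = 1 ∨ s = -1) (L : Fin 3 → Fin 3 → ℂ)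
    (β β₀ β₁ β₂ q q₀ q₁ q₂ : ℂ) (b : Fin 3) :
    ∑ a, L a b • gammaHat s a +
        Complex.I • (cliff s β β₀ β₁ β₂ * gammaHat s b - gammaHat s b * cliff s β β₀ β₁ β₂) -
        Complex.I • (cliff s q q₀ q₁ q₂ * gammaHat s b) =
      ![cliff s (-Complex.I * q₀) (L 0 0 - Complex.I * q) (L 1 0 - 2 * s * β₂ + s * q₂)
          (L 2 0 + 2 * s * β₁ - s * q₁),
        cliff s (Complex.I * q₁) (L 0 1 - 2 * s * β₂ + s * q₂) (L 1 1 - Complex.I * q)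
          (L 2 1 - 2 * s * β₀ + s * q₀),
        cliff s (Complex.I * q₂) (L 0 2 + 2 * s * β₁ - s * q₁) (L 1 2 + 2 * s * β₀ - s * q₀)
          (L 2 2 - Complex.I * q)] b := by
  have h2 := sq_sign hs
  have hI := Complex.I_sq
  have h3I : (Complex.I : ℂ) ^ 3 = -Complex.I := by rw [pow_succ, hI]; ring
  fin_cases b <;>
  · simp only [cliff, Fin.sum_univ_three, gammaHat_zero, gammaHat_one, gammaHat_two,
      Fin.zero_eta, Fin.mk_one, Fin.reduceFinMk]
    apply mat_ext <;> simp <;> ring_nf <;> simp only [h2, hI, h3I] <;> ring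

theorem rotationTerm_eq_cliff (s : ℝ) (L : Fin 3 → Fin 3 → ℂ) :
    rotationTerm s L = cliff s 0 (-(s / 4) * (L 1 2 - L 2 1)) (-(s / 4) * (L 2 0 + L 0 2))
      (s / 4 * (L 0 1 + L 1 0)) := by
  simp only [rotationTerm, cliff, Fin.sum_univ_three, gammaHat_zero, gammaHat_one, gammaHat_two,
    sgn_zero, sgn_one, sgn_two]
  apply mat_ext <;> simp [ε] <;> (try left) <;> ring

end CliffordAlgebra

/-! ### Linear algebra of the first-order and second-order equations -/

section CliffordAlgebra

variable {s : ℝ}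

/-- The coordinates along `1` make `Q` scalar. Then `Q` meets only the trace of `L`, and the
commutator with `B` only its antisymmetric part, so the symmetric trace-free part of `L` must vanish
and the traceless part of `B` is determined. The trace of `B` drops out of the commutator and stays
free. The lemma serves twice: with `L = ∇ξ` and `B = χ`, and with minus the Lie coefficients and the
whole derivative-free part as `B`. -/
theorem gammaHat_condition_iff (hs : s = 1 ∨ s = -1) (L : Fin 3 → Fin 3 → ℂ) (B Q : Mat) :
    (∀ b, ∑ a, L a b • gammaHat s a + Complex.I • (B * gammaHat s b - gammaHat s b * B) -
        Complex.I • (Q * gammaHat s b) = 0) ↔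
      (∀ a c, L a c * sgn a + L c a * sgn c = 2 / 3 * (∑ b, L b b) * (η a c : ℂ)) ∧
      Q = (-(Complex.I / 3) * ∑ b, L b b) • (1 : Mat) ∧
      B = (B.trace / 2) • (1 : Mat) + rotationTerm s L := by
  have h2 := sq_sign hs
  have hI := Complex.I_sq
  obtain ⟨β, β₀, β₁, β₂, rfl⟩ := exists_cliff hs B
  obtain ⟨q, q₀, q₁, q₂, rfl⟩ := exists_cliff hs Q
  have hQ : ∀ c : ℂ, cliff s q q₀ q₁ q₂ = c • (1 : Mat) ↔
      q - c = 0 ∧ q₀ = 0 ∧ q₁ = 0 ∧ q₂ = 0 := by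
    intro c
    rw [← cliff_eq_zero_iff hs, ← sub_eq_zero]
    have : cliff s q q₀ q₁ q₂ - c • (1 : Mat) = cliff s (q - c) q₀ q₁ q₂ := by
      apply mat_ext <;> simp [cliff] <;> ring
    rw [this]
  have hB : cliff s β β₀ β₁ β₂ =
      ((cliff s β β₀ β₁ β₂).trace / 2) • (1 : Mat) + rotationTerm s L ↔
      β₀ + s / 4 * (L 1 2 - L 2 1) = 0 ∧ β₁ + s / 4 * (L 2 0 + L 0 2) = 0 ∧
        β₂ - s / 4 * (L 0 1 + L 1 0) = 0 := by
    rw [rotationTerm_eq_cliff, ← sub_eq_zero]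
    have : cliff s β β₀ β₁ β₂ - (((cliff s β β₀ β₁ β₂).trace / 2) • (1 : Mat) +
        cliff s 0 (-(s / 4) * (L 1 2 - L 2 1)) (-(s / 4) * (L 2 0 + L 0 2))
          (s / 4 * (L 0 1 + L 1 0))) = cliff s 0 (β₀ + s / 4 * (L 1 2 - L 2 1))
        (β₁ + s / 4 * (L 2 0 + L 0 2)) (β₂ - s / 4 * (L 0 1 + L 1 0)) := by
      apply mat_ext <;> simp [cliff, Matrix.trace, Fin.sum_univ_two] <;> ring
    rw [this, cliff_eq_zero_iff hs]
    simp
  have hη : ∀ a c, (η a c : ℂ) = if a = c then sgn a else 0 := by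
    intro a c
    by_cases h : a = c
    · subst h; simp [sgn]
    · simp [η, h]
  rw [hQ, hB]
  simp only [cliff_condition hs, hη]
  simp only [Fin.forall_fin_succ, Fin.isValue, Matrix.cons_val_zero, cliff_eq_zero_iff hs,
    Fin.sum_univ_three, Fin.succ_zero_eq_one, Fin.succ_one_eq_two, Matrix.cons_val_one,
    Matrix.cons_val, IsEmpty.forall_iff, and_true, sgn_zero, sgn_one, sgn_two]
  norm_num
  have n02 : ¬(0 : Fin 3) = 2 := by decide
  have n20 : ¬(2 : Fin 3) = 0 := by decide
  have n12 : ¬(1 : Fin 3) = 2 := by decide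
  have n21 : ¬(2 : Fin 3) = 1 := by decide
  simp only [if_neg n02, if_neg n20, if_neg n12, if_neg n21]
  constructor
  · rintro ⟨⟨rfl, h00, h10, h20⟩, ⟨rfl, h01, h11, h21⟩, ⟨rfl, h02, h12, h22⟩⟩
    refine ⟨⟨⟨?_, ?_, ?_⟩, ⟨?_, ?_, ?_⟩, ?_, ?_, ?_⟩, ⟨?_, rfl, rfl, rfl⟩, ?_, ?_, ?_⟩
    · linear_combination 4 / 3 * h00 - 2 / 3 * h11 - 2 / 3 * h22
    · linear_combination h01 - h10
    · linear_combination h02 - h20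
    · linear_combination h01 - h10
    · linear_combination 2 / 3 * h00 - 4 / 3 * h11 + 2 / 3 * h22
    · linear_combination -h12 - h21
    · linear_combination h02 - h20
    · linear_combination -h12 - h21
    · linear_combination 2 / 3 * h00 + 2 / 3 * h11 - 4 / 3 * h22
    · linear_combination Complex.I / 3 * (h00 + h11 + h22) + q * hI
    · linear_combination s / 4 * h12 - s / 4 * h21 - β₀ * h2
    · linear_combination s / 4 * h20 + s / 4 * h02 - β₁ * h2
    · linear_combination -(s / 4) * h01 - s / 4 * h10 - β₂ * h2
  · rintro ⟨⟨⟨c00, c01, c02⟩, ⟨-, c11, c12⟩, -, -, c22⟩, ⟨hq, rfl, rfl, rfl⟩, h0, h1, h3⟩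
    refine ⟨⟨rfl, ?_, ?_, ?_⟩, ⟨rfl, ?_, ?_, ?_⟩, rfl, ?_, ?_, ?_⟩
    · linear_combination c00 / 2 - Complex.I * hq + (L 0 0 + L 1 1 + L 2 2) / 3 * hI
    · linear_combination -(2 * s) * h3 - c01 / 2 - (L 0 1 + L 1 0) / 2 * h2
    · linear_combination (2 * s) * h1 - c02 / 2 - (L 0 2 + L 2 0) / 2 * h2
    · linear_combination -(2 * s) * h3 + c01 / 2 - (L 0 1 + L 1 0) / 2 * h2
    · linear_combination -c11 / 2 - Complex.I * hq + (L 0 0 + L 1 1 + L 2 2) / 3 * hI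
    · linear_combination -(2 * s) * h0 - c12 / 2 + (L 1 2 - L 2 1) / 2 * h2
    · linear_combination (2 * s) * h1 + c02 / 2 - (L 0 2 + L 2 0) / 2 * h2
    · linear_combination (2 * s) * h0 - c12 / 2 - (L 1 2 - L 2 1) / 2 * h2
    · linear_combination -c22 / 2 - Complex.I * hq + (L 0 0 + L 1 1 + L 2 2) / 3 * hI

/-- The matrix `R` with `X^a = R γ̂^a + ξ^a`. -/
def leftFactor (s : ℝ) (X : Fin 3 → Mat) : Mat :=
  !![-(Complex.I * s) * X 1 0 1, -X 0 0 1; X 0 1 0, -(Complex.I * s) * X 1 1 0]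

/-- The equations with `a = b` express `Y` by `X`. Those with `a ≠ b` then say that the non-scalar
coordinates of the `X a` form a multiple of the identity plus an antisymmetric array for `η`. This
is a four-parameter family, the one swept out by `R γ̂^a` for arbitrary `R`. The matrix `R` is read
off the off-diagonal entries of `X 0` and `X 1`, to which `ξ^a` does not contribute; it is therefore
linear in `X`, hence smooth with it. -/
theorem eq_leftFactor_mul_add (hs : s = 1 ∨ s = -1) {X Y : Fin 3 → Mat}
    (h : ∀ a b, X a * gammaHat s b + X b * gammaHat s a - gammaHat s b * X a - gammaHat s a * X b =
      Y a * gammaHat s b + Y b * gammaHat s a) (a : Fin 3) :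
    X a = leftFactor s X * gammaHat s a +
      (X a 0 0 - (leftFactor s X * gammaHat s a) 0 0) • (1 : Mat) := by
  have h2 := sq_sign hs
  have ht := I_mul_sign_mul_self hs
  choose x x₀ x₁ x₂ hX using fun a => exists_cliff hs (X a)
  choose y y₀ y₁ y₂ hY using fun a => exists_cliff hs (Y a)
  -- Multiplied by `i`, the hypothesis is the sum over both orders of `(a, b)` of the expression in
  -- `cliff_condition` with `L = 0`.
  have key : ∀ a b, (∑ d, (0 : Fin 3 → Fin 3 → ℂ) d b • gammaHat s d +
        Complex.I • (X a * gammaHat s b - gammaHat s b * X a) -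
        Complex.I • (Y a * gammaHat s b)) + (∑ d, (0 : Fin 3 → Fin 3 → ℂ) d a • gammaHat s d +
        Complex.I • (X b * gammaHat s a - gammaHat s a * X b) -
        Complex.I • (Y b * gammaHat s a)) = 0 := by
    intro a b
    have h0 := sub_eq_zero.2 (h a b)
    calc _ = Complex.I • (X a * gammaHat s b + X b * gammaHat s a - gammaHat s b * X a -
          gammaHat s a * X b - (Y a * gammaHat s b + Y b * gammaHat s a)) := by
          simp only [Pi.zero_apply, zero_smul, Finset.sum_const_zero]
          module
      _ = 0 := by rw [h0, smul_zero]
  have hadd : ∀ a b c d a' b' c' d' : ℂ, cliff s a b c d + cliff s a' b' c' d' =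
      cliff s (a + a') (b + b') (c + c') (d + d') := by
    intros
    apply mat_ext <;> simp [cliff] <;> ring
  simp only [hX, hY, cliff_condition hs] at key
  have k00 := key 0 0
  have k11 := key 1 1
  have k22 := key 2 2
  have k01 := key 0 1
  have k02 := key 0 2
  have k12 := key 1 2
  simp only [Matrix.cons_val_zero, Matrix.cons_val_one, Matrix.cons_val, hadd, cliff_eq_zero_iff hs,
    Pi.zero_apply] at k00 k11 k22 k01 k02 k12
  obtain ⟨a1, -, a2, a3⟩ := k00
  obtain ⟨b1, b2, -, b3⟩ := k11
  obtain ⟨c1, c2, c3, -⟩ := k22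
  obtain ⟨d1, -, -, d4⟩ := k01
  obtain ⟨f1, -, f3, -⟩ := k02
  obtain ⟨g1, -, -, -⟩ := k12
  have hI := Complex.I_sq
  have y10 : y₁ 0 = 2 * x₁ 0 := by
    linear_combination -(s / 2) * a3 - (y₁ 0 - 2 * x₁ 0) * h2
  have y20 : y₂ 0 = 2 * x₂ 0 := by
    linear_combination (s / 2) * a2 - (y₂ 0 - 2 * x₂ 0) * h2
  have y21 : y₂ 1 = 2 * x₂ 1 := by
    linear_combination (s / 2) * b2 - (y₂ 1 - 2 * x₂ 1) * h2
  have y01 : y₀ 1 = 2 * x₀ 1 := by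
    linear_combination (s / 2) * b3 - (y₀ 1 - 2 * x₀ 1) * h2
  have y12 : y₁ 2 = 2 * x₁ 2 := by
    linear_combination -(s / 2) * c2 - (y₁ 2 - 2 * x₁ 2) * h2
  have y02 : y₀ 2 = 2 * x₀ 2 := by
    linear_combination -(s / 2) * c3 - (y₀ 2 - 2 * x₀ 2) * h2
  have e01 : x₁ 0 = x₀ 1 := by
    linear_combination -(Complex.I / 2) * d1 + (y₁ 0 - y₀ 1) / 2 * hI - y10 / 2 + y01 / 2
  have e02 : x₂ 0 = x₀ 2 := by
    linear_combination -(Complex.I / 2) * f1 + (y₂ 0 - y₀ 2) / 2 * hI - y20 / 2 + y02 / 2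
  have e12 : x₂ 1 = -x₁ 2 := by
    linear_combination -(Complex.I / 2) * g1 + (y₂ 1 + y₁ 2) / 2 * hI - y21 / 2 - y12 / 2
  have y00 : y₀ 0 = 0 := by
    linear_combination -(-Complex.I / 2) * a1 + y₀ 0 * hI
  have y11 : y₁ 1 = 0 := by
    linear_combination (-Complex.I / 2) * b1 + y₁ 1 * hI
  have y22 : y₂ 2 = 0 := by
    linear_combination (-Complex.I / 2) * c1 + y₂ 2 * hI
  have e11 : x₀ 0 = x₁ 1 := by
    linear_combination -(s / 2) * d4 - (x₀ 0 - x₁ 1) * h2 + s ^ 2 / 2 * (y00 - y11)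
  have e22 : x₀ 0 = x₂ 2 := by
    linear_combination (s / 2) * f3 - (x₀ 0 - x₂ 2) * h2 + s ^ 2 / 2 * (y00 - y22)
  have hR : leftFactor s X = !![x₀ 0 + Complex.I * s * x₁ 2, -(Complex.I * s * x₀ 1 + x₀ 2);
      Complex.I * s * x₀ 1 - x₀ 2, x₀ 0 - Complex.I * s * x₁ 2] := by
    simp only [leftFactor, hX, cliff]
    apply mat_ext <;> simp
    · linear_combination -x₁ 1 * ht - e11 - Complex.I * s * e12
    · linear_combination -Complex.I * s * e01 - e02
    · linear_combination Complex.I * s * e01 - e02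
    · linear_combination -x₁ 1 * ht - e11 + Complex.I * s * e12
  rw [hR, hX]
  fin_cases a
  · simp only [gammaHat_zero, cliff, Fin.zero_eta]
    apply mat_ext <;> simp
    · linear_combination Complex.I * s * e01 + e02
    · linear_combination Complex.I * s * e01 - e02
    · ring
  · simp only [gammaHat_one, cliff, Fin.mk_one]
    apply mat_ext <;> simp
    · linear_combination -Complex.I * s * e11 + e12 - x₁ 2 * ht
    · linear_combination -Complex.I * s * e11 - e12 + x₁ 2 * ht
    · linear_combination -2 * x₀ 1 * ht
  · simp only [gammaHat_two, cliff, Fin.reduceFinMk]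
    apply mat_ext <;> simp
    · ring
    · linear_combination -e22
    · linear_combination -e22

end CliffordAlgebra

/-! ### Algebra of the zeroth-order equation -/

section CliffordAlgebra

variable {s : ℝ}

/-- Here `C'` is the variation of the structure coefficients under `L`, as in the Jacobi identity.
By `hL` the variation is a rotation together with a rescaling. The commutator with the rotation term
undoes the rotation of `structureTerm s C` and the multiple of the identity undoes the rescaling, so
every `C` cancels. Of the derivatives of `L` only the gradient of the trace remains. All these
cancellations are checked on the four matrix entries. -/
theorem potential_commutator_eq (hs : s = 1 ∨ s = -1) {C C' dL : Fin 3 → Fin 3 → Fin 3 → ℂ}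
    {L : Fin 3 → Fin 3 → ℂ} {a a' db : Fin 3 → ℂ} {m b : ℂ}
    (hC : ∀ i j k, C i j k = -C j i k)
    (hL : ∀ i j, L i j * sgn i + L j i * sgn j = 2 / 3 * (∑ k, L k k) * (η i j : ℂ))
    (hdL : ∀ l i j, dL l i j * sgn i + dL l j i * sgn j = 2 / 3 * (∑ k, dL l k k) * (η i j : ℂ))
    (hC' : ∀ i j k, C' i j k = ∑ l, (L i l * C l j k + L j l * C i l k - C i j l * L l k) +
      dL i j k - dL j i k) :
    Complex.I • (Complex.I • structureTerm s C' - ∑ i, a' i • gammaHat s i) -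
        Complex.I • ∑ i, gammaHat s i * (db i • (1 : Mat) + rotationTerm s (fun j k => -dL i j k)) +
        ((b • (1 : Mat) + rotationTerm s (fun j k => -L j k)) *
            (Complex.I • structureTerm s C - ∑ i, a i • gammaHat s i - m • (1 : Mat)) -
          (Complex.I • structureTerm s C - ∑ i, a i • gammaHat s i - m • (1 : Mat)) *
            (b • (1 : Mat) + rotationTerm s (fun j k => -L j k))) -
        ((Complex.I / 3 * ∑ k, L k k) • (1 : Mat)) *
          (Complex.I • structureTerm s C - ∑ i, a i • gammaHat s i - m • (1 : Mat)) =
      (m * (Complex.I / 3 * ∑ k, L k k)) • (1 : Mat) +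
        ∑ i, (-Complex.I * db i + 1 / 3 * ∑ k, dL i k k - Complex.I * a' i +
          Complex.I * ∑ j, L i j * a j) • gammaHat s i := by
  -- The conformal condition leaves four independent entries, `K 0 0`, `K 0 1`, `K 0 2`, `K 1 2`. It
  -- applies to `L` and to each of its derivatives.
  have reduce : ∀ K : Fin 3 → Fin 3 → ℂ,
      (∀ i j, K i j * sgn i + K j i * sgn j = 2 / 3 * (∑ k, K k k) * (η i j : ℂ)) →
      K 1 1 = K 0 0 ∧ K 2 2 = K 0 0 ∧ K 1 0 = K 0 1 ∧ K 2 0 = K 0 2 ∧ K 2 1 = -K 1 2 := by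
    intro K hK
    have e00 := hK 0 0
    have e11 := hK 1 1
    have e01 := hK 0 1
    have e02 := hK 0 2
    have e12 := hK 1 2
    simp [η, sgn, Fin.sum_univ_three] at e00 e11 e01 e02 e12
    refine ⟨?_, ?_, ?_, ?_, ?_⟩
    · linear_combination -e00 / 2 - e11 / 2
    · linear_combination -3 / 2 * e00 - (-e00 / 2 - e11 / 2)
    · linear_combination -e01
    · linear_combination -e02
    · linear_combination -e12
  obtain ⟨l1, l2, l3, l4, l5⟩ := reduce L hL
  have c00 : ∀ i k, C i i k = 0 := fun i k => by
    linear_combination hC i i k / 2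
  have c10 : ∀ k, C 1 0 k = -C 0 1 k := fun k => hC 1 0 k
  have c20 : ∀ k, C 2 0 k = -C 0 2 k := fun k => hC 2 0 k
  have c21 : ∀ k, C 2 1 k = -C 1 2 k := fun k => hC 2 1 k
  have d1 : ∀ l, dL l 1 1 = dL l 0 0 := fun l => (reduce _ (hdL l)).1
  have d2 : ∀ l, dL l 2 2 = dL l 0 0 := fun l => (reduce _ (hdL l)).2.1
  have d3 : ∀ l, dL l 1 0 = dL l 0 1 := fun l => (reduce _ (hdL l)).2.2.1
  have d4 : ∀ l, dL l 2 0 = dL l 0 2 := fun l => (reduce _ (hdL l)).2.2.2.1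
  have d5 : ∀ l, dL l 2 1 = -dL l 1 2 := fun l => (reduce _ (hdL l)).2.2.2.2
  have h2 := sq_sign hs
  have hI := Complex.I_sq
  have h3 : (s : ℂ) ^ 3 = s := by rw [pow_succ, h2, one_mul]
  have h3I : (Complex.I : ℂ) ^ 3 = -Complex.I := by rw [pow_succ, hI]; ring
  have hone : ∀ c : ℂ, c • (1 : Mat) = !![c, 0; 0, c] := fun c => by
    apply mat_ext <;> simp
  simp only [hone, structureTerm, rotationTerm_eq_cliff, hC', cliff, Fin.sum_univ_three, gammaHat_zero,
    gammaHat_one, gammaHat_two, sgn_zero, sgn_one, sgn_two, c00, c10, c20, c21, l1, l2, l3, l4, l5,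
    d1, d2, d3, d4, d5]
  apply mat_ext <;> simp [ε] <;> ring_nf <;> simp only [h2, hI, h3, h3I] <;> ring

end CliffordAlgebra

/-! ### The triad, the metric and their inverses -/

theorem eta_apply_ne {a b : Fin 3} (h : a ≠ b) : η a b = 0 := by simp [η, h]

theorem eta_mul_self : η * η = 1 := by
  rw [η, Matrix.diagonal_mul_diagonal, ← Matrix.diagonal_one]
  congr 1
  funext i
  fin_cases i <;> simp

namespace Spacetime

variable (M : Spacetime)

/-- The matrix `e^a_μ(x)`. -/
def triadMat (x : Coord) : Matrix (Fin 3) (Fin 3) ℝ := Matrix.of fun a μ => M.triad a μ x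

/-- The matrix `e^μ_a(x)`. -/
def invTriadMat (x : Coord) : Matrix (Fin 3) (Fin 3) ℝ := Matrix.of fun μ a => M.invTriad μ a x

theorem g_eq (x : Coord) : M.g x = (M.triadMat x).transpose * η * M.triadMat x := by
  ext μ ν
  simp only [g, triadMat, Matrix.of_apply, Matrix.mul_apply, Matrix.transpose_apply,
    Finset.sum_mul]
  rw [Finset.sum_comm]
  exact Finset.sum_congr rfl fun a _ => Finset.sum_congr rfl fun b _ => by ring

theorem invTriadMat_eq (x : Coord) :
    M.invTriadMat x = M.gInv x * (M.triadMat x).transpose * η := by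
  ext μ a
  simp only [invTriadMat, invTriad, triadMat, Matrix.of_apply, Matrix.mul_apply,
    Matrix.transpose_apply, Finset.sum_mul]
  rw [Finset.sum_comm]
  refine Finset.sum_congr rfl fun b _ => Finset.sum_congr rfl fun c _ => ?_
  congr 1
  by_cases h : a = b
  · rw [h]
  · rw [eta_apply_ne h, eta_apply_ne (Ne.symm h)]

variable {M} {x : Coord}

theorem isUnit_det_g (hx : x ∈ M.U) : IsUnit (M.g x).det := by
  have h1 : (M.triadMat x).det ≠ 0 := M.det_triad_ne_zero x hx
  have h2 : η.det ≠ 0 := by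
    intro h
    have := congrArg Matrix.det eta_mul_self
    rw [Matrix.det_mul, h, Matrix.det_one] at this
    norm_num at this
  rw [g_eq, Matrix.det_mul, Matrix.det_mul, Matrix.det_transpose]
  exact (mul_ne_zero (mul_ne_zero h1 h2) h1).isUnit

theorem gInv_mul_g (hx : x ∈ M.U) : M.gInv x * M.g x = 1 :=
  Matrix.nonsing_inv_mul _ (isUnit_det_g hx)

theorem g_mul_gInv (hx : x ∈ M.U) : M.g x * M.gInv x = 1 :=
  Matrix.mul_nonsing_inv _ (isUnit_det_g hx)

theorem invTriadMat_mul_triadMat (hx : x ∈ M.U) : M.invTriadMat x * M.triadMat x = 1 := by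
  rw [invTriadMat_eq, ← gInv_mul_g hx, g_eq]
  simp only [Matrix.mul_assoc]

theorem triadMat_mul_invTriadMat (hx : x ∈ M.U) : M.triadMat x * M.invTriadMat x = 1 :=
  mul_eq_one_comm.1 (invTriadMat_mul_triadMat hx)

variable (M) in
theorem g_symm (x : Coord) (μ ν : Fin 3) : M.g x μ ν = M.g x ν μ := by
  simp only [g, Matrix.of_apply]
  rw [Finset.sum_comm]
  refine Finset.sum_congr rfl fun a _ => Finset.sum_congr rfl fun b _ => ?_
  by_cases h : a = b
  · subst h; ring
  · rw [eta_apply_ne h, eta_apply_ne (Ne.symm h)]; ring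

theorem gInv_eq (hx : x ∈ M.U) :
    M.gInv x = M.invTriadMat x * η * (M.invTriadMat x).transpose := by
  have h : (M.triadMat x).transpose * (M.invTriadMat x).transpose = 1 := by
    rw [← Matrix.transpose_mul, invTriadMat_mul_triadMat hx, Matrix.transpose_one]
  rw [invTriadMat_eq, Matrix.mul_assoc _ η η, eta_mul_self, Matrix.mul_one, ← invTriadMat_eq,
    Matrix.mul_assoc, h, Matrix.mul_one]

theorem sum_triad_invTriad (hx : x ∈ M.U) (a b : Fin 3) :
    ∑ μ, M.triad a μ x * M.invTriad μ b x = if a = b then 1 else 0 := by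
  have := congrFun (congrFun (triadMat_mul_invTriadMat hx) a) b
  rwa [Matrix.mul_apply, Matrix.one_apply] at this

theorem sum_invTriad_triad (hx : x ∈ M.U) (μ ν : Fin 3) :
    ∑ a, M.invTriad μ a x * M.triad a ν x = if μ = ν then 1 else 0 := by
  have := congrFun (congrFun (invTriadMat_mul_triadMat hx) μ) ν
  rwa [Matrix.mul_apply, Matrix.one_apply] at this

theorem gInv_apply (hx : x ∈ M.U) (μ ν : Fin 3) :
    M.gInv x μ ν = ∑ a, M.invTriad μ a x * η a a * M.invTriad ν a x := by
  rw [gInv_eq hx, Matrix.mul_apply]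
  refine Finset.sum_congr rfl fun a _ => ?_
  rw [Matrix.mul_apply, Finset.sum_eq_single a]
  · rfl
  · intro b _ hb; rw [eta_apply_ne hb, mul_zero]
  · simp

variable (M) in
theorem g_apply (x : Coord) (μ ν : Fin 3) :
    M.g x μ ν = ∑ a, M.triad a μ x * η a a * M.triad a ν x := by
  rw [g_eq, Matrix.mul_apply]
  refine Finset.sum_congr rfl fun a _ => ?_
  rw [Matrix.mul_apply, Finset.sum_eq_single a]
  · rfl
  · intro b _ hb; rw [eta_apply_ne hb, mul_zero]
  · simp

theorem sum_g_invTriad (hx : x ∈ M.U) (μ a : Fin 3) :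
    ∑ ν, M.g x μ ν * M.invTriad ν a x = η a a * M.triad a μ x := by
  simp only [g_apply, Finset.sum_mul]
  rw [Finset.sum_comm]
  have : ∀ b, ∑ ν, M.triad b μ x * η b b * M.triad b ν x * M.invTriad ν a x =
      M.triad b μ x * η b b * if b = a then 1 else 0 := fun b => by
    rw [← sum_triad_invTriad hx b a, Finset.mul_sum]
    exact Finset.sum_congr rfl fun ν _ => by ring
  simp only [this]
  simp [mul_comm]

/-! ### Smoothness of the geometric coefficients -/

section Smoothness

theorem _root_.DiracSymm.smoothOn_det {U : Set Coord} {B : Coord → Matrix (Fin 3) (Fin 3) ℝ}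
    (hB : ∀ i j, ContDiffOn ℝ ∞ (fun y => B y i j) U) :
    ContDiffOn ℝ ∞ (fun y => (B y).det) U := by
  simp only [Matrix.det_fin_three]
  have h3 : ∀ i j k l m n : Fin 3, ContDiffOn ℝ ∞ (fun y => B y i j * B y k l * B y m n) U :=
    fun i j k l m n => ((hB i j).mul (hB k l)).mul (hB m n)
  exact (((((h3 _ _ _ _ _ _).sub (h3 _ _ _ _ _ _)).sub (h3 _ _ _ _ _ _)).add
    (h3 _ _ _ _ _ _)).add (h3 _ _ _ _ _ _)).sub (h3 _ _ _ _ _ _)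

variable (M)

theorem smooth_g (μ ν : Fin 3) : ContDiffOn ℝ ∞ (fun y => M.g y μ ν) M.U := by
  simp only [g_apply]
  exact ContDiffOn.sum fun a _ =>
    ((M.smooth_triad a μ).mul contDiffOn_const).mul (M.smooth_triad a ν)

theorem smooth_gInv (μ ν : Fin 3) : ContDiffOn ℝ ∞ (fun y => M.gInv y μ ν) M.U := by
  have h : ∀ y ∈ M.U, M.gInv y μ ν = (M.g y).det⁻¹ * (M.g y).adjugate μ ν := fun y _ => by
    rw [gInv, Matrix.inv_def, Ring.inverse_eq_inv', Matrix.smul_apply, smul_eq_mul]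
  refine ContDiffOn.congr (ContDiffOn.mul (ContDiffOn.inv (smoothOn_det (M.smooth_g)) ?_) ?_) h
  · exact fun y hy => (isUnit_det_g hy).ne_zero
  · simp only [Matrix.adjugate_apply]
    refine smoothOn_det fun i j => ?_
    by_cases hi : i = ν
    · subst hi
      simp only [Matrix.updateRow_self]
      exact contDiffOn_const
    · simp only [Matrix.updateRow_ne hi]
      exact M.smooth_g i j

theorem smooth_invTriad (μ a : Fin 3) : ContDiffOn ℝ ∞ (M.invTriad μ a) M.U := by
  unfold invTriad
  exact ContDiffOn.sum fun ν _ => ContDiffOn.sum fun b _ =>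
    ((M.smooth_gInv μ ν).mul (M.smooth_triad b ν)).mul contDiffOn_const

theorem smooth_christoffel (μ ν α : Fin 3) : ContDiffOn ℝ ∞ (M.christoffel μ ν α) M.U := by
  have h := fun i j k => smoothOn_pd M.isOpen_U (M.smooth_g i j) k
  unfold christoffel
  exact contDiffOn_const.mul (ContDiffOn.sum fun β _ =>
    (M.smooth_gInv μ β).mul (((h _ _ _).add (h _ _ _)).sub (h _ _ _)))

end Smoothness

/-! ### Metric compatibility and the connection in the frame -/

section Connection

variable (M) in
theorem christoffel_symm (μ ν α : Fin 3) (x : Coord) :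
    M.christoffel μ ν α x = M.christoffel μ α ν x := by
  unfold christoffel
  congr 1
  refine Finset.sum_congr rfl fun β _ => ?_
  simp only [M.g_symm _ ν α]
  ring

theorem sum_g_christoffel (hx : x ∈ M.U) (ρ ν α : Fin 3) :
    ∑ μ, M.g x ρ μ * M.christoffel μ ν α x = 1 / 2 * (pd α (fun y => M.g y ρ ν) x +
      pd ν (fun y => M.g y ρ α) x - pd ρ (fun y => M.g y ν α) x) := by
  have h := fun β => congrFun (congrFun (g_mul_gInv hx) ρ) β
  simp only [Matrix.mul_apply, Matrix.one_apply] at h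
  unfold christoffel
  simp only [Finset.mul_sum]
  rw [Finset.sum_comm, Finset.sum_eq_single ρ]
  · simp only [← mul_assoc]
    rw [← Finset.sum_mul]
    have : ∑ i, M.g x ρ i * (1 / 2) * M.gInv x i ρ = 1 / 2 := by
      calc _ = 1 / 2 * ∑ i, M.g x ρ i * M.gInv x i ρ := by
            rw [Finset.mul_sum]
            exact Finset.sum_congr rfl fun i _ => by ring
        _ = 1 / 2 := by rw [h, if_pos rfl, mul_one]
    rw [this]
  · intro β _ hβ
    simp only [← mul_assoc]
    rw [← Finset.sum_mul]
    have : ∑ i, M.g x ρ i * (1 / 2) * M.gInv x i β = 0 := by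
      calc _ = 1 / 2 * ∑ i, M.g x ρ i * M.gInv x i β := by
            rw [Finset.mul_sum]
            exact Finset.sum_congr rfl fun i _ => by ring
        _ = 0 := by rw [h, if_neg (Ne.symm hβ), mul_zero]
    rw [this, zero_mul]
  · simp

/-- Metric compatibility `∇g = 0`: in the sum of two Christoffel symbols of the first kind the
derivatives of `g` along `α` and `β` cancel. -/
theorem pd_g (hx : x ∈ M.U) (ν α β : Fin 3) :
    pd ν (fun y => M.g y α β) x = ∑ μ, M.g x α μ * M.christoffel μ ν β x +
      ∑ μ, M.g x β μ * M.christoffel μ ν α x := by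
  rw [sum_g_christoffel hx, sum_g_christoffel hx]
  simp only [M.g_symm _ β α, M.g_symm _ ν β, M.g_symm _ ν α]
  ring

variable (M) in
/-- The connection coefficients of the frame, `∇_ν E_a = conn ν a b E_b`. -/
def conn (ν a b : Fin 3) (x : Coord) : ℝ :=
  ∑ α, M.triad b α x *
    (pd ν (M.invTriad α a) x + ∑ β, M.christoffel α ν β x * M.invTriad β a x)

theorem differentiableAt_g (hx : x ∈ M.U) (μ ν : Fin 3) :
    DifferentiableAt ℝ (fun y => M.g y μ ν) x :=
  differentiableAt_of_smoothOn M.isOpen_U (M.smooth_g μ ν) hx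

theorem differentiableAt_invTriad (hx : x ∈ M.U) (μ a : Fin 3) :
    DifferentiableAt ℝ (M.invTriad μ a) x :=
  differentiableAt_of_smoothOn M.isOpen_U (M.smooth_invTriad μ a) hx

/-- The derivative of the constant `g(E_a, E_b) = η_ab`, in which `∇g = 0` moves all derivatives
onto the frame. -/
theorem conn_antisymm (hx : x ∈ M.U) (ν a b : Fin 3) :
    M.conn ν a b x * η b b + M.conn ν b a x * η a a = 0 := by
  have key : ∀ y ∈ M.U, ∑ α, ∑ β, M.g y α β * (M.invTriad α a y * M.invTriad β b y) = η a b := by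
    intro y hy
    have : ∀ α, ∑ β, M.g y α β * (M.invTriad α a y * M.invTriad β b y) =
        η b b * (M.triad b α y * M.invTriad α a y) := fun α => by
      rw [← mul_assoc, ← sum_g_invTriad hy, Finset.sum_mul]
      exact Finset.sum_congr rfl fun β _ => by ring
    simp only [this, ← Finset.mul_sum, sum_triad_invTriad hy]
    by_cases h : a = b
    · subst h; simp
    · simp [eta_apply_ne h, Ne.symm h]
  have h0 := pd_congr M.isOpen_U key hx ν
  have dg := fun i j => differentiableAt_g hx (M := M) i j
  have dh := fun i j => differentiableAt_invTriad hx (M := M) i j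
  rw [pd_const, pd_sum (f := fun α y => ∑ β, M.g y α β * (M.invTriad α a y * M.invTriad β b y))
    (fun α _ => DifferentiableAt.fun_sum fun β _ =>
    (dg α β).mul ((dh α a).mul (dh β b)))] at h0
  have h1 : ∀ α, pd ν (fun y => ∑ β, M.g y α β * (M.invTriad α a y * M.invTriad β b y)) x =
      ∑ β, (pd ν (fun y => M.g y α β) x * (M.invTriad α a x * M.invTriad β b x) +
        M.g x α β * (pd ν (M.invTriad α a) x * M.invTriad β b x +
          M.invTriad α a x * pd ν (M.invTriad β b) x)) := fun α => by
    rw [pd_sum (f := fun β y => M.g y α β * (M.invTriad α a y * M.invTriad β b y))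
      (fun β _ => (dg α β).mul ((dh α a).mul (dh β b)))]
    refine Finset.sum_congr rfl fun β _ => ?_
    rw [pd_mul (g := fun y => M.invTriad α a y * M.invTriad β b y) (dg α β)
      ((dh α a).mul (dh β b)), pd_mul (dh α a) (dh β b)]
  simp only [h1, pd_g hx] at h0
  rw [← h0, conn, conn, Finset.sum_mul, Finset.sum_mul]
  have e1 : ∀ α, M.triad b α x * (pd ν (M.invTriad α a) x +
      ∑ β, M.christoffel α ν β x * M.invTriad β a x) * η b b =
      (∑ ρ, M.g x α ρ * M.invTriad ρ b x) * (pd ν (M.invTriad α a) x +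
      ∑ β, M.christoffel α ν β x * M.invTriad β a x) := fun α => by
    rw [sum_g_invTriad hx]; ring
  have e2 : ∀ α, M.triad a α x * (pd ν (M.invTriad α b) x +
      ∑ β, M.christoffel α ν β x * M.invTriad β b x) * η a a =
      (∑ ρ, M.g x α ρ * M.invTriad ρ a x) * (pd ν (M.invTriad α b) x +
      ∑ β, M.christoffel α ν β x * M.invTriad β b x) := fun α => by
    rw [sum_g_invTriad hx]; ring
  rw [Finset.sum_congr rfl fun α _ => e1 α, Finset.sum_congr rfl fun α _ => e2 α]
  simp only [Fin.sum_univ_three]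
  simp only [M.g_symm x 1 0, M.g_symm x 2 0, M.g_symm x 2 1]
  ring

end Connection

end Spacetime

/-! ### Lie brackets of complex vector fields -/

section VectorFields

/-- The derivative of a function along a vector field with complex components. -/
def dir (X : Fin 3 → Coord → ℂ) (f : Coord → ℂ) (x : Coord) : ℂ := ∑ ν, X ν x * pd ν f x

/-- The Lie bracket of vector fields with complex components. -/
def bracket (X Y : Fin 3 → Coord → ℂ) (μ : Fin 3) (x : Coord) : ℂ :=
  dir X (Y μ) x - dir Y (X μ) x

variable {U : Set Coord} {X Y Z : Fin 3 → Coord → ℂ} {x : Coord}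

theorem smooth_dir (hU : IsOpen U) (hX : ∀ μ, ContDiffOn ℝ ∞ (X μ) U) {f : Coord → ℂ}
    (hf : ContDiffOn ℝ ∞ f U) : ContDiffOn ℝ ∞ (dir X f) U :=
  ContDiffOn.sum fun ν _ => (hX ν).mul (smoothOn_pd hU hf ν)

theorem smooth_bracket (hU : IsOpen U) (hX : ∀ μ, ContDiffOn ℝ ∞ (X μ) U)
    (hY : ∀ μ, ContDiffOn ℝ ∞ (Y μ) U) (μ : Fin 3) : ContDiffOn ℝ ∞ (bracket X Y μ) U :=
  (smooth_dir hU hX (hY μ)).sub (smooth_dir hU hY (hX μ))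

theorem bracket_swap (X Y : Fin 3 → Coord → ℂ) (μ : Fin 3) (x : Coord) :
    bracket X Y μ x = -bracket Y X μ x := by
  simp [bracket]

theorem dir_congr (hU : IsOpen U) {f g : Coord → ℂ} (h : ∀ y ∈ U, f y = g y) (hx : x ∈ U) :
    dir X f x = dir X g x :=
  Finset.sum_congr rfl fun ν _ => by rw [pd_congr hU h hx]

theorem bracket_congr_right (hU : IsOpen U) {Y' : Fin 3 → Coord → ℂ}
    (h : ∀ μ, ∀ y ∈ U, Y μ y = Y' μ y) (hx : x ∈ U) (μ : Fin 3) :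
    bracket X Y μ x = bracket X Y' μ x := by
  rw [bracket, bracket, dir_congr hU (h μ) hx]
  simp only [dir, h _ x hx]

theorem dir_sub (hU : IsOpen U) {f g : Coord → ℂ} (hf : ContDiffOn ℝ ∞ f U)
    (hg : ContDiffOn ℝ ∞ g U) (hx : x ∈ U) :
    dir X (fun y => f y - g y) x = dir X f x - dir X g x := by
  simp only [dir, pd_sub (differentiableAt_of_smoothOn hU hf hx)
    (differentiableAt_of_smoothOn hU hg hx), mul_sub, Finset.sum_sub_distrib]

theorem dir_mul (hU : IsOpen U) {f g : Coord → ℂ} (hf : ContDiffOn ℝ ∞ f U)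
    (hg : ContDiffOn ℝ ∞ g U) (hx : x ∈ U) :
    dir X (fun y => f y * g y) x = dir X f x * g x + f x * dir X g x := by
  simp only [dir, pd_mul (differentiableAt_of_smoothOn hU hf hx)
    (differentiableAt_of_smoothOn hU hg hx), Finset.sum_mul, Finset.mul_sum,
    ← Finset.sum_add_distrib]
  exact Finset.sum_congr rfl fun ν _ => by ring

theorem dir_sum {ι : Type*} (u : Finset ι) (hU : IsOpen U) {f : ι → Coord → ℂ}
    (hf : ∀ i, ContDiffOn ℝ ∞ (f i) U) (hx : x ∈ U) :
    dir X (fun y => ∑ i ∈ u, f i y) x = ∑ i ∈ u, dir X (f i) x := by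
  simp only [dir, pd_sum (fun i _ => differentiableAt_of_smoothOn hU (hf i) hx), Finset.mul_sum]
  exact Finset.sum_comm

theorem dir_const_mul (hU : IsOpen U) (c : ℂ) {f : Coord → ℂ} (hf : ContDiffOn ℝ ∞ f U)
    (hx : x ∈ U) : dir X (fun y => c * f y) x = c * dir X f x := by
  rw [dir_mul hU contDiffOn_const hf hx]
  simp [dir, pd_const]

/-- The commutator of derivations is the derivation along the bracket. -/
theorem dir_dir_sub (hU : IsOpen U) (hX : ∀ μ, ContDiffOn ℝ ∞ (X μ) U)
    (hY : ∀ μ, ContDiffOn ℝ ∞ (Y μ) U) {f : Coord → ℂ} (hf : ContDiffOn ℝ ∞ f U) (hx : x ∈ U) :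
    dir X (dir Y f) x - dir Y (dir X f) x = dir (bracket X Y) f x := by
  have key : ∀ V W : Fin 3 → Coord → ℂ, (∀ μ, ContDiffOn ℝ ∞ (W μ) U) →
      dir V (dir W f) x = ∑ μ, (dir V (W μ) x * pd μ f x + W μ x * dir V (pd μ f) x) := by
    intro V W hW
    have h := fun μ => (hW μ).mul (smoothOn_pd hU hf μ)
    have e : dir W f = fun y => ∑ μ, W μ y * pd μ f y := rfl
    rw [e, dir_sum _ hU h hx]
    exact Finset.sum_congr rfl fun μ _ => dir_mul hU (hW μ) (smoothOn_pd hU hf μ) hx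
  rw [key X Y hY, key Y X hX]
  simp only [bracket, dir, Fin.sum_univ_three, pd_comm hU hf hx 1 0, pd_comm hU hf hx 2 0,
    pd_comm hU hf hx 2 1]
  ring

/-- The bracket acts on functions as the commutator of derivations. Three instances of this, applied
to the components of the fields, combine to the identity. -/
theorem bracket_jacobi (hU : IsOpen U) (hX : ∀ μ, ContDiffOn ℝ ∞ (X μ) U)
    (hY : ∀ μ, ContDiffOn ℝ ∞ (Y μ) U) (hZ : ∀ μ, ContDiffOn ℝ ∞ (Z μ) U) (hx : x ∈ U)
    (μ : Fin 3) :
    bracket X (bracket Y Z) μ x =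
      bracket (bracket X Y) Z μ x + bracket Y (bracket X Z) μ x := by
  have e : ∀ V W : Fin 3 → Coord → ℂ, bracket V W μ = fun y => dir V (W μ) y - dir W (V μ) y :=
    fun V W => rfl
  have h1 := dir_dir_sub hU hX hY (hZ μ) hx
  have h2 := dir_dir_sub hU hY hZ (hX μ) hx
  have h3 := dir_dir_sub hU hX hZ (hY μ) hx
  rw [bracket, bracket, bracket, e Y Z, e X Y, e X Z,
    dir_sub hU (smooth_dir hU hY (hZ μ)) (smooth_dir hU hZ (hY μ)) hx,
    dir_sub hU (smooth_dir hU hX (hY μ)) (smooth_dir hU hY (hX μ)) hx,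
    dir_sub hU (smooth_dir hU hX (hZ μ)) (smooth_dir hU hZ (hX μ)) hx]
  linear_combination h1 + h2 - h3

theorem bracket_sum_mul (hU : IsOpen U) {f : Fin 3 → Coord → ℂ} {E : Fin 3 → Fin 3 → Coord → ℂ}
    (hf : ∀ k, ContDiffOn ℝ ∞ (f k) U) (hE : ∀ k μ, ContDiffOn ℝ ∞ (E k μ) U) (hx : x ∈ U)
    (μ : Fin 3) :
    bracket X (fun ν y => ∑ k, f k y * E k ν y) μ x =
      ∑ k, (dir X (f k) x * E k μ x + f k x * bracket X (E k) μ x) := by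
  rw [bracket, dir_sum _ hU (fun k => (hf k).mul (hE k μ)) hx]
  simp only [dir_mul hU (hf _) (hE _ μ) hx, bracket]
  simp only [dir, Fin.sum_univ_three]
  ring

end VectorFields

/-! ### Frame components and structure coefficients -/

namespace Spacetime

section Frame

variable (M : Spacetime)

/-- The vector `E_a` of the frame, with components `e^μ_a`. -/
def frame (a μ : Fin 3) (x : Coord) : ℂ := (M.invTriad μ a x : ℂ)

/-- The components `Y^b = e^b_μ Y^μ` of a vector field in the frame. -/
def comp (Y : Fin 3 → Coord → ℂ) (b : Fin 3) (x : Coord) : ℂ :=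
  ∑ μ, Y μ x * (M.triad b μ x : ℂ)

/-- The structure coefficients `[E_a, E_b] = C_{ab}^c E_c`. -/
def structureCoeff (a b c : Fin 3) (x : Coord) : ℂ :=
  M.comp (bracket (M.frame a) (M.frame b)) c x

/-- The coefficients `[ξ, E_a] = L_a^b E_b`. -/
def lieCoeff (ξ : Fin 3 → Coord → ℂ) (a b : Fin 3) (x : Coord) : ℂ :=
  M.comp (bracket ξ (M.frame a)) b x

/-- The components `e_a^μ ξ^ν_{;μ} e^b_ν` of the covariant derivative in the frame. -/
def frameDeriv (ξ : Fin 3 → Coord → ℂ) (a b : Fin 3) (x : Coord) : ℂ :=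
  ∑ μ, M.frame a μ x * ∑ ν, M.covDeriv ξ ν μ x * (M.triad b ν x : ℂ)

theorem smooth_frame (a μ : Fin 3) : ContDiffOn ℝ ∞ (M.frame a μ) M.U :=
  smoothOn_ofReal (M.smooth_invTriad μ a)

theorem smooth_comp {Y : Fin 3 → Coord → ℂ} (hY : ∀ μ, ContDiffOn ℝ ∞ (Y μ) M.U) (b : Fin 3) :
    ContDiffOn ℝ ∞ (M.comp Y b) M.U :=
  ContDiffOn.sum fun μ _ => (hY μ).mul (smoothOn_ofReal (M.smooth_triad b μ))

theorem smooth_structureCoeff (a b c : Fin 3) : ContDiffOn ℝ ∞ (M.structureCoeff a b c) M.U :=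
  M.smooth_comp (smooth_bracket M.isOpen_U (M.smooth_frame a) (M.smooth_frame b)) c

theorem smooth_lieCoeff {ξ : Fin 3 → Coord → ℂ} (hξ : ∀ μ, ContDiffOn ℝ ∞ (ξ μ) M.U)
    (a b : Fin 3) : ContDiffOn ℝ ∞ (M.lieCoeff ξ a b) M.U :=
  M.smooth_comp (smooth_bracket M.isOpen_U hξ (M.smooth_frame a)) b

theorem smooth_covDeriv {ξ : Fin 3 → Coord → ℂ} (hξ : ∀ μ, ContDiffOn ℝ ∞ (ξ μ) M.U)
    (μ ν : Fin 3) : ContDiffOn ℝ ∞ (M.covDeriv ξ μ ν) M.U :=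
  (smoothOn_pd M.isOpen_U (hξ μ) ν).add (ContDiffOn.sum fun α _ =>
    (smoothOn_ofReal (M.smooth_christoffel μ ν α)).mul (hξ α))

variable {M} {x : Coord}

theorem sum_triad_frame (hx : x ∈ M.U) (a b : Fin 3) :
    ∑ μ, (M.triad a μ x : ℂ) * M.frame b μ x = if a = b then 1 else 0 := by
  have := congrArg (fun r : ℝ => (r : ℂ)) (sum_triad_invTriad hx a b)
  simpa [frame, apply_ite] using this

theorem sum_frame_triad (hx : x ∈ M.U) (μ ν : Fin 3) :
    ∑ a, M.frame a μ x * (M.triad a ν x : ℂ) = if μ = ν then 1 else 0 := by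
  have := congrArg (fun r : ℝ => (r : ℂ)) (sum_invTriad_triad hx μ ν)
  simpa [frame, apply_ite] using this

theorem eq_sum_comp (hx : x ∈ M.U) (Y : Fin 3 → Coord → ℂ) (μ : Fin 3) :
    Y μ x = ∑ b, M.comp Y b x * M.frame b μ x := by
  simp only [comp, Finset.sum_mul]
  rw [Finset.sum_comm]
  have : ∀ ν, ∑ b, Y ν x * (M.triad b ν x : ℂ) * M.frame b μ x =
      Y ν x * if μ = ν then 1 else 0 := fun ν => by
    rw [← sum_frame_triad hx, Finset.mul_sum]
    exact Finset.sum_congr rfl fun b _ => by ring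
  simp only [this]
  simp

theorem comp_sum_frame (hx : x ∈ M.U) (f : Fin 3 → ℂ) (b : Fin 3) :
    ∑ μ, (∑ k, f k * M.frame k μ x) * (M.triad b μ x : ℂ) = f b := by
  simp only [Finset.sum_mul]
  rw [Finset.sum_comm]
  have : ∀ k, ∑ μ, f k * M.frame k μ x * (M.triad b μ x : ℂ) =
      f k * if b = k then 1 else 0 := fun k => by
    rw [← sum_triad_frame hx, Finset.mul_sum]
    exact Finset.sum_congr rfl fun μ _ => by ring
  simp only [this]
  simp

theorem structureCoeff_antisymm (a b c : Fin 3) :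
    M.structureCoeff a b c x = -M.structureCoeff b a c x := by
  simp only [structureCoeff, comp, bracket_swap (M.frame a) (M.frame b), neg_mul,
    Finset.sum_neg_distrib]

/-- The structure coefficients along a vector field, by the Jacobi identity. -/
theorem dir_structureCoeff (hx : x ∈ M.U) {ξ : Fin 3 → Coord → ℂ}
    (hξ : ∀ μ, ContDiffOn ℝ ∞ (ξ μ) M.U) (i j k : Fin 3) :
    dir ξ (M.structureCoeff i j k) x =
      ∑ l, (M.lieCoeff ξ i l x * M.structureCoeff l j k x +
        M.lieCoeff ξ j l x * M.structureCoeff i l k x -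
        M.structureCoeff i j l x * M.lieCoeff ξ l k x) +
      dir (M.frame i) (M.lieCoeff ξ j k) x - dir (M.frame j) (M.lieCoeff ξ i k) x := by
  have hU := M.isOpen_U
  have hE := M.smooth_frame
  have b1 : ∀ i μ, ∀ y ∈ M.U, bracket ξ (M.frame i) μ y =
      ∑ l, M.lieCoeff ξ i l y * M.frame l μ y := fun i μ y hy => eq_sum_comp hy _ μ
  have b2 : ∀ i j μ, ∀ y ∈ M.U, bracket (M.frame i) (M.frame j) μ y =
      ∑ l, M.structureCoeff i j l y * M.frame l μ y := fun i j μ y hy => eq_sum_comp hy _ μ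
  -- The Jacobi identity for `ξ, E_i, E_j`, with every bracket expanded in the frame. The expansions
  -- of the inner brackets hold on all of `U` and may therefore be differentiated.
  have jac : ∀ μ, ∑ l, (dir ξ (M.structureCoeff i j l) x * M.frame l μ x +
      M.structureCoeff i j l x * ∑ n, M.lieCoeff ξ l n x * M.frame n μ x) =
      -∑ l, (dir (M.frame j) (M.lieCoeff ξ i l) x * M.frame l μ x +
        M.lieCoeff ξ i l x * ∑ n, M.structureCoeff j l n x * M.frame n μ x) +
      ∑ l, (dir (M.frame i) (M.lieCoeff ξ j l) x * M.frame l μ x +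
        M.lieCoeff ξ j l x * ∑ n, M.structureCoeff i l n x * M.frame n μ x) := by
    intro μ
    have h := bracket_jacobi hU hξ (hE i) (hE j) hx μ
    rw [bracket_swap (bracket ξ (M.frame i)), bracket_congr_right hU (b2 i j) hx,
      bracket_congr_right hU (b1 i) hx, bracket_congr_right hU (b1 j) hx,
      bracket_sum_mul hU (M.smooth_structureCoeff i j) hE hx,
      bracket_sum_mul hU (M.smooth_lieCoeff hξ i) hE hx,
      bracket_sum_mul hU (M.smooth_lieCoeff hξ j) hE hx] at h
    simpa only [b1 _ _ x hx, b2 _ _ _ x hx] using h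
  have jac' := fun μ => sub_eq_zero.2 (jac μ)
  -- Since the frame is a basis, the identity of vectors passes to the component along `E_k`.
  have hc := comp_sum_frame hx (fun n => dir ξ (M.structureCoeff i j n) x +
      ∑ l, M.structureCoeff i j l x * M.lieCoeff ξ l n x +
      (dir (M.frame j) (M.lieCoeff ξ i n) x +
        ∑ l, M.lieCoeff ξ i l x * M.structureCoeff j l n x) -
      (dir (M.frame i) (M.lieCoeff ξ j n) x +
        ∑ l, M.lieCoeff ξ j l x * M.structureCoeff i l n x)) k
  have h0 : ∀ μ, ∑ n, (dir ξ (M.structureCoeff i j n) x +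
      ∑ l, M.structureCoeff i j l x * M.lieCoeff ξ l n x +
      (dir (M.frame j) (M.lieCoeff ξ i n) x +
        ∑ l, M.lieCoeff ξ i l x * M.structureCoeff j l n x) -
      (dir (M.frame i) (M.lieCoeff ξ j n) x +
        ∑ l, M.lieCoeff ξ j l x * M.structureCoeff i l n x)) * M.frame n μ x = 0 := by
    intro μ
    rw [← jac' μ]
    simp only [Fin.sum_univ_three]
    ring
  simp only [h0, zero_mul, Finset.sum_const_zero] at hc
  simp only [structureCoeff_antisymm _ j] at hc ⊢
  simp only [Fin.sum_univ_three] at hc ⊢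
  linear_combination -hc

end Frame

end Spacetime

/-! ### The spin connection and the normal form in the frame -/

namespace Spacetime

section SpinGeometry

variable {M : Spacetime} {s : ℝ} {x : Coord}

theorem conn_eq (hx : x ∈ M.U) (ν a b : Fin 3) :
    (M.conn ν a b x : ℂ) = ∑ α, M.covDeriv (M.frame a) α ν x * (M.triad b α x : ℂ) := by
  simp only [conn, covDeriv, Complex.ofReal_sum, Complex.ofReal_mul, Complex.ofReal_add]
  refine Finset.sum_congr rfl fun α _ => ?_
  rw [mul_comm, ← pd_ofReal (differentiableAt_invTriad hx α a)]
  rfl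

theorem conn_antisymm_sgn (hx : x ∈ M.U) (ν a b : Fin 3) :
    (M.conn ν a b x : ℂ) * sgn b + (M.conn ν b a x : ℂ) * sgn a = 0 := by
  have := congrArg (fun r : ℝ => (r : ℂ)) (conn_antisymm hx ν a b)
  simpa [sgn] using this

variable (M) in
-- Absence of torsion: the Christoffel terms cancel by symmetry of the lower indices.
theorem bracket_eq_covDeriv (X Y : Fin 3 → Coord → ℂ) (μ : Fin 3) (x : Coord) :
    bracket X Y μ x = ∑ ν, (X ν x * M.covDeriv Y μ ν x - Y ν x * M.covDeriv X μ ν x) := by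
  simp only [bracket, dir, covDeriv, Fin.sum_univ_three, M.christoffel_symm μ 1 0,
    M.christoffel_symm μ 2 0, M.christoffel_symm μ 2 1]
  ring

theorem structureCoeff_eq (hx : x ∈ M.U) (a b c : Fin 3) :
    M.structureCoeff a b c x = ∑ ν, M.frame a ν x * (M.conn ν b c x : ℂ) -
      ∑ ν, M.frame b ν x * (M.conn ν a c x : ℂ) := by
  simp only [structureCoeff, comp, M.bracket_eq_covDeriv, conn_eq hx, Fin.sum_univ_three]
  ring

/-- This is `[ξ, E_a] = ∇_ξ E_a - ∇_{E_a} ξ`. The first term is an infinitesimal rotation of the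
frame, so `-L` and `∇ξ` have the same trace and the same symmetric part. -/
theorem lieCoeff_eq (hx : x ∈ M.U) (ξ : Fin 3 → Coord → ℂ) (a b : Fin 3) :
    M.lieCoeff ξ a b x = ∑ ν, ξ ν x * (M.conn ν a b x : ℂ) - M.frameDeriv ξ a b x := by
  simp only [lieCoeff, comp, M.bracket_eq_covDeriv, conn_eq hx, frameDeriv, Fin.sum_univ_three]
  ring

theorem covDeriv_eq (hx : x ∈ M.U) (ξ : Fin 3 → Coord → ℂ) (ν μ : Fin 3) :
    M.covDeriv ξ ν μ x = ∑ a, ∑ b, (M.triad a μ x : ℂ) * M.frameDeriv ξ a b x * M.frame b ν x := by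
  have h1 : ∀ ρ, M.covDeriv ξ ν ρ x =
      ∑ b, (∑ α, M.covDeriv ξ α ρ x * (M.triad b α x : ℂ)) * M.frame b ν x := fun ρ =>
    eq_sum_comp hx (fun α => M.covDeriv ξ α ρ) ν
  have h2 : M.covDeriv ξ ν μ x = ∑ ρ, (∑ a, M.frame a ρ x * (M.triad a μ x : ℂ)) *
      M.covDeriv ξ ν ρ x := by
    simp only [sum_frame_triad hx]
    simp
  rw [h2]
  simp only [h1]
  simp only [frameDeriv, Fin.sum_univ_three]
  ring

theorem divergence_eq (hx : x ∈ M.U) (ξ : Fin 3 → Coord → ℂ) :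
    M.divergence ξ x = ∑ a, M.frameDeriv ξ a a x := by
  have h : ∀ μ, M.covDeriv ξ μ μ x = ∑ ν, M.covDeriv ξ ν μ x * if μ = ν then 1 else 0 := by
    intro μ; simp
  simp only [divergence, h, ← sum_frame_triad hx, frameDeriv]
  simp only [Fin.sum_univ_three]
  ring

theorem divergence_eq_lieCoeff (hx : x ∈ M.U) (ξ : Fin 3 → Coord → ℂ) :
    M.divergence ξ x = -∑ a, M.lieCoeff ξ a a x := by
  rw [divergence_eq hx]
  simp only [lieCoeff_eq hx, Finset.sum_sub_distrib]
  have h : ∀ ν a, (M.conn ν a a x : ℂ) = 0 := by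
    intro ν a
    have h1 := conn_antisymm_sgn hx ν a a
    have h2 : sgn a * sgn a = 1 := by
      fin_cases a <;> simp [sgn, η]
    linear_combination sgn a / 2 * h1 - (M.conn ν a a x : ℂ) * h2
  simp [h]

theorem gInv_eq_frame (hx : x ∈ M.U) (μ ν : Fin 3) :
    (M.gInv x μ ν : ℂ) = ∑ a, M.frame a μ x * sgn a * M.frame a ν x := by
  simp [gInv_apply hx, frame, sgn]

theorem sum_frame_covDeriv (hx : x ∈ M.U) (ξ : Fin 3 → Coord → ℂ) (a μ : Fin 3) :
    ∑ l, M.frame a l x * M.covDeriv ξ μ l x = ∑ c, M.frameDeriv ξ a c x * M.frame c μ x := by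
  have h := eq_sum_comp hx (fun μ y => ∑ l, M.frame a l y * M.covDeriv ξ μ l y) μ
  rw [h]
  refine Finset.sum_congr rfl fun c _ => ?_
  simp only [comp, frameDeriv, Finset.sum_mul, Finset.mul_sum]
  rw [Finset.sum_comm]
  exact Finset.sum_congr rfl fun l _ => Finset.sum_congr rfl fun ν _ => by ring

theorem covDerivUp_eq (hx : x ∈ M.U) (ξ : Fin 3 → Coord → ℂ) (μ ν : Fin 3) :
    M.covDerivUp ξ μ ν x =
      ∑ a, ∑ c, M.frameDeriv ξ a c x * sgn a * M.frame a ν x * M.frame c μ x := by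
  have h : ∀ a, ∑ c, M.frameDeriv ξ a c x * sgn a * M.frame a ν x * M.frame c μ x =
      sgn a * M.frame a ν x * ∑ l, M.frame a l x * M.covDeriv ξ μ l x := fun a => by
    rw [sum_frame_covDeriv hx, Finset.mul_sum]
    exact Finset.sum_congr rfl fun c _ => by ring
  simp only [h, covDerivUp, gInv_eq_frame hx, Finset.sum_mul, Finset.mul_sum]
  rw [Finset.sum_comm]
  exact Finset.sum_congr rfl fun a _ => Finset.sum_congr rfl fun l _ => by ring

theorem eq_of_frame_contraction (hx : x ∈ M.U) {T T' : Fin 3 → Fin 3 → ℂ}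
    (h : ∀ μ ν, ∑ a, ∑ c, T a c * M.frame a ν x * M.frame c μ x =
      ∑ a, ∑ c, T' a c * M.frame a ν x * M.frame c μ x) (a c : Fin 3) : T a c = T' a c := by
  have key : ∀ S : Fin 3 → Fin 3 → ℂ, S a c = ∑ ν, (∑ μ, (∑ d, ∑ b, S d b * M.frame d ν x *
      M.frame b μ x) * (M.triad c μ x : ℂ)) * (M.triad a ν x : ℂ) := by
    intro S
    have h1 : ∀ ν, ∑ μ, (∑ d, ∑ b, S d b * M.frame d ν x * M.frame b μ x) *
        (M.triad c μ x : ℂ) = ∑ d, S d c * M.frame d ν x := by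
      intro ν
      have := comp_sum_frame hx (fun b => ∑ d, S d b * M.frame d ν x) c
      rw [← this]
      refine Finset.sum_congr rfl fun μ _ => ?_
      rw [Finset.sum_comm]
      simp only [Finset.sum_mul]
    simp only [h1]
    exact (comp_sum_frame hx (fun d => S d c) a).symm
  rw [key T, key T']
  simp only [h]

theorem isConformalKilling_iff (ξ : Fin 3 → Coord → ℂ) :
    M.IsConformalKilling ξ ↔ ∀ x ∈ M.U, ∀ a c,
      M.frameDeriv ξ a c x * sgn a + M.frameDeriv ξ c a x * sgn c =
        2 / 3 * (∑ b, M.frameDeriv ξ b b x) * (η a c : ℂ) := by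
  have e1 : ∀ x ∈ M.U, ∀ μ ν, M.covDerivUp ξ μ ν x + M.covDerivUp ξ ν μ x =
      ∑ a, ∑ c, (M.frameDeriv ξ a c x * sgn a + M.frameDeriv ξ c a x * sgn c) *
        M.frame a ν x * M.frame c μ x := by
    intro x hx μ ν
    rw [covDerivUp_eq hx, covDerivUp_eq hx, Finset.sum_comm (γ := Fin 3) (f := fun a c =>
      M.frameDeriv ξ a c x * sgn a * M.frame a μ x * M.frame c ν x)]
    simp only [← Finset.sum_add_distrib]
    exact Finset.sum_congr rfl fun a _ => Finset.sum_congr rfl fun c _ => by ring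
  have e2 : ∀ x ∈ M.U, ∀ μ ν, 2 / 3 * M.divergence ξ x * (M.gInv x μ ν : ℂ) =
      ∑ a, ∑ c, (2 / 3 * (∑ b, M.frameDeriv ξ b b x) * (η a c : ℂ)) *
        M.frame a ν x * M.frame c μ x := by
    intro x hx μ ν
    rw [divergence_eq hx, gInv_eq_frame hx, Finset.mul_sum]
    generalize ∑ b, M.frameDeriv ξ b b x = S
    refine Finset.sum_congr rfl fun a _ => ?_
    rw [Finset.sum_eq_single a]
    · rw [sgn]; ring
    · intro c _ hc
      rw [eta_apply_ne (Ne.symm hc)]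
      simp
    · simp
  constructor
  · intro h x hx
    refine eq_of_frame_contraction hx fun μ ν => ?_
    rw [← e1 x hx, ← e2 x hx]
    exact h x hx μ ν
  · intro h x hx μ ν
    rw [e1 x hx, e2 x hx]
    simp only [h x hx]

theorem gamma_eq (μ : Fin 3) (x : Coord) :
    M.gamma s μ x = ∑ a, M.frame a μ x • gammaHat s a := rfl

variable (M s) in
theorem smooth_gamma (μ : Fin 3) : SmoothMat M.U (M.gamma s μ) :=
  SmoothMat.sum fun a _ => SmoothMat.smul (M.smooth_frame a μ) (SmoothMat.const _)

theorem sum_triad_gamma (hx : x ∈ M.U) (a : Fin 3) :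
    ∑ μ, (M.triad a μ x : ℂ) • M.gamma s μ x = gammaHat s a := by
  simp only [gamma_eq, Finset.smul_sum, smul_smul]
  rw [Finset.sum_comm]
  simp only [← Finset.sum_smul, sum_triad_frame hx]
  simp

theorem pdMat_gamma (hx : x ∈ M.U) (ν μ : Fin 3) :
    pdMat ν (M.gamma s μ) x = ∑ a, pd ν (M.frame a μ) x • gammaHat s a :=
  pdMat_sum_smul_const _ M.isOpen_U (fun a => M.smooth_frame a μ) _ hx ν

theorem covDerivGamma_eq (hx : x ∈ M.U) (α ν : Fin 3) :
    M.covDerivGamma s α ν x = ∑ a, M.covDeriv (M.frame a) α ν x • gammaHat s a := by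
  rw [covDerivGamma, pdMat_gamma hx]
  simp only [gamma_eq, covDeriv, add_smul, Finset.sum_add_distrib, Finset.smul_sum, smul_smul,
    Finset.sum_smul]
  congr 1
  exact Finset.sum_comm

theorem gammaLower_eq (hx : x ∈ M.U) (α : Fin 3) :
    M.gammaLower s α x = ∑ b, (sgn b * (M.triad b α x : ℂ)) • gammaHat s b := by
  simp only [gammaLower, gamma_eq, Finset.smul_sum, smul_smul]
  rw [Finset.sum_comm]
  refine Finset.sum_congr rfl fun b _ => ?_
  rw [← Finset.sum_smul]
  congr 1
  have := congrArg (fun r : ℝ => (r : ℂ)) (sum_g_invTriad hx α b)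
  simpa [frame, sgn] using this

theorem spinConn_eq (hx : x ∈ M.U) (ν : Fin 3) :
    M.spinConn s ν x = frameConn s (fun a b => (M.conn ν a b x : ℂ)) := by
  simp only [spinConn, frameConn, covDerivGamma_eq hx, gammaLower_eq hx, conn_eq hx,
    Finset.sum_mul, Finset.mul_sum, Matrix.smul_mul, Matrix.mul_smul, smul_smul, Finset.sum_smul]
  congr 1
  refine Eq.trans ?_ Finset.sum_comm
  rw [Finset.sum_comm]
  refine Finset.sum_congr rfl fun b _ => ?_
  rw [Finset.sum_comm]
  refine Finset.sum_congr rfl fun a _ => Finset.sum_congr rfl fun α _ => ?_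
  congr 1
  ring

variable (M s) in
theorem smooth_spinConn (ν : Fin 3) : SmoothMat M.U (M.spinConn s ν) := by
  refine SmoothMat.smul (f := fun _ => (-(1 / 4) : ℂ)) contDiffOn_const
    (SmoothMat.sum fun α _ => SmoothMat.mul ?_ ?_)
  · exact (smoothMat_pdMat M.isOpen_U (M.smooth_gamma s α) ν).add (SmoothMat.sum fun β _ =>
      SmoothMat.smul (smoothOn_ofReal (M.smooth_christoffel α ν β)) (M.smooth_gamma s β))
  · exact SmoothMat.sum fun β _ =>
      SmoothMat.smul (smoothOn_ofReal (M.smooth_g α β)) (M.smooth_gamma s β)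

theorem trace_spinConn (hx : x ∈ M.U) (ν : Fin 3) : (M.spinConn s ν x).trace = 0 := by
  rw [spinConn_eq hx]
  exact trace_frameConn (conn_antisymm_sgn hx ν)

theorem spinConn_commutator (hs : s = 1 ∨ s = -1) (hx : x ∈ M.U) (ν d : Fin 3) :
    M.spinConn s ν x * gammaHat s d - gammaHat s d * M.spinConn s ν x =
      -∑ a, (M.conn ν a d x : ℂ) • gammaHat s a := by
  rw [spinConn_eq hx]
  exact frameConn_commutator hs (conn_antisymm_sgn hx ν) d

/-- Contracting `ν` with the frame gives connection coefficients whose antisymmetrization is the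
bracket of the frame, which is the situation of `sum_gammaHat_frameConn`. -/
theorem sum_gamma_spinConn (hs : s = 1 ∨ s = -1) (hx : x ∈ M.U) :
    ∑ ν, M.gamma s ν x * M.spinConn s ν x =
      structureTerm s (fun a b c => M.structureCoeff a b c x) := by
  rw [← sum_gammaHat_frameConn hs (w := fun d a b => ∑ ν, M.frame d ν x * (M.conn ν a b x : ℂ))
    ?_ (fun a b c => structureCoeff_eq hx a b c)]
  · simp only [gamma_eq, spinConn_eq hx, frameConn, Finset.sum_mul, Finset.mul_sum,
      Matrix.smul_mul, Matrix.mul_smul, smul_smul, Finset.sum_smul, Finset.smul_sum]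
    rw [Finset.sum_comm]
    refine Eq.trans ?_ Finset.sum_comm
    refine Finset.sum_congr rfl fun a _ => ?_
    rw [Finset.sum_comm]
    refine Eq.trans ?_ Finset.sum_comm
    refine Finset.sum_congr rfl fun b _ => ?_
    rw [Finset.sum_comm]
    refine Finset.sum_congr rfl fun d _ => Finset.sum_congr rfl fun ν _ => ?_
    congr 1
    ring
  · intro d a b
    simp only [Finset.sum_mul, ← Finset.sum_add_distrib]
    refine Finset.sum_eq_zero fun ν _ => ?_
    linear_combination M.frame d ν x * conn_antisymm_sgn hx ν a b

theorem _root_.DiracSymm.sum_comm_three_two (F : Fin 3 → Fin 3 → Fin 3 → Fin 3 → Fin 3 → ℂ) :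
    ∑ μ, ∑ ν, ∑ α, ∑ a, ∑ c, F μ ν α a c = ∑ a, ∑ c, ∑ μ, ∑ ν, ∑ α, F μ ν α a c := by
  have := Finset.sum_comm (s := (Finset.univ : Finset (Fin 3 × Fin 3 × Fin 3)))
    (t := (Finset.univ : Finset (Fin 3 × Fin 3))) (f := fun p q => F p.1 p.2.1 p.2.2 q.1 q.2)
  simpa only [Fintype.sum_prod_type] using this

/-- Contraction of `ε` with three frame vectors produces the determinant of the inverse triad, which
cancels the factor `det(e^a_μ)`. -/
theorem sum_leviCivita_frame (hx : x ∈ M.U) (c a d : Fin 3) :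
    ∑ μ, ∑ ν, ∑ α, (M.leviCivita μ ν α x : ℂ) * M.frame c μ x * M.frame a ν x * M.frame d α x =
      (ε c a d : ℂ) := by
  have hdet : (M.triadMat x).det * (M.invTriadMat x).det = 1 := by
    rw [← Matrix.det_mul, triadMat_mul_invTriadMat hx, Matrix.det_one]
  have key : ∑ μ, ∑ ν, ∑ α, ε μ ν α * M.invTriad μ c x * M.invTriad ν a x * M.invTriad α d x =
      (M.invTriadMat x).det * ε c a d := by
    rw [Matrix.det_fin_three]
    simp only [invTriadMat, Matrix.of_apply]
    fin_cases c <;> fin_cases a <;> fin_cases d <;> simp [Fin.sum_univ_three, ε] <;> ring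
  have h2 : ∑ μ, ∑ ν, ∑ α, M.leviCivita μ ν α x * M.invTriad μ c x * M.invTriad ν a x *
      M.invTriad α d x = ε c a d := by
    rw [← one_mul (ε c a d), ← hdet, mul_assoc, ← key]
    simp only [Finset.mul_sum]
    refine Finset.sum_congr rfl fun μ _ => Finset.sum_congr rfl fun ν _ =>
      Finset.sum_congr rfl fun α _ => ?_
    simp only [leviCivita, triadMat]
    ring
  rw [← h2]
  simp [frame]

/-- In the orthonormal frame `e_{μνα}` becomes `ε`. In `frameDeriv` the direction of differentiation
is the first index, while in `ξ^{μ;ν}` it is the second; this accounts for the order `ε c a d` in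
`rotationTerm`. -/
theorem normalForm_pot_eq (hx : x ∈ M.U) (ξ : Fin 3 → Coord → ℂ) (φ : Coord → ℂ) :
    (M.normalForm s ξ φ).pot x =
      φ x • (1 : Mat) + rotationTerm s (fun a b => M.frameDeriv ξ a b x) := by
  have h1 : ∀ d, ∑ μ, ∑ ν, ∑ α, M.covDerivUp ξ μ ν x * (M.leviCivita μ ν α x : ℂ) *
      M.frame d α x = ∑ c, ∑ a, (ε c a d : ℂ) * sgn a * M.frameDeriv ξ a c x := by
    intro d
    simp only [← sum_leviCivita_frame hx, covDerivUp_eq hx, Finset.sum_mul]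
    rw [sum_comm_three_two, Finset.sum_comm]
    refine Finset.sum_congr rfl fun c _ => Finset.sum_congr rfl fun a _ =>
      Finset.sum_congr rfl fun μ _ => Finset.sum_congr rfl fun ν _ =>
      Finset.sum_congr rfl fun α _ => ?_
    ring
  have h : ∑ μ, ∑ ν, ∑ α, (M.covDerivUp ξ μ ν x * (M.leviCivita μ ν α x : ℂ)) • M.gamma s α x =
      ∑ c, ∑ a, ∑ d, ((ε c a d : ℂ) * sgn a * M.frameDeriv ξ a c x) • gammaHat s d := by
    have h2 := Finset.sum_congr (rfl : (Finset.univ : Finset (Fin 3)) = Finset.univ) fun d _ =>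
      congrArg (fun c : ℂ => c • gammaHat s d) (h1 d)
    simp only [Fin.sum_univ_three, add_smul] at h2
    simp only [gamma_eq, Fin.sum_univ_three, smul_add, smul_smul]
    refine Eq.trans ?_ (h2.trans ?_) <;> abel
  rw [normalForm, rotationTerm]
  simp only
  rw [h, add_comm]

end SpinGeometry

end Spacetime

/-! ### Second-order operators and their coefficients -/

section SecondOrder

variable {U : Set Coord} {x : Coord}

/-- The value at `x` of a second-order differential operator with matrix coefficients. -/
def secondOrder (S : Fin 3 → Fin 3 → Mat) (T : Fin 3 → Mat) (W : Mat) (ψ : Coord → Spinor)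
    (x : Coord) : Spinor :=
  ∑ μ, ∑ ν, (S μ ν).mulVec (pd μ (pd ν ψ) x) + ∑ ν, (T ν).mulVec (pd ν ψ x) + W.mulVec (ψ x)

theorem eq_zero_of_mulVec {B : Mat} (h : ∀ v, B.mulVec v = 0) : B = 0 := by
  ext i j
  have := congrFun (h (Pi.single j 1)) i
  simpa [Matrix.mulVec_single_one] using this

theorem hasFDerivAt_coord (α : Fin 3) (c : ℝ) (x : Coord) :
    HasFDerivAt (fun y : Coord => ((y α - c : ℝ) : ℂ))
      (Complex.ofRealCLM.comp (ContinuousLinearMap.proj (R := ℝ) (φ := fun _ : Fin 3 => ℝ) α)) x :=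
  Complex.ofRealCLM.hasFDerivAt.comp x
    (((ContinuousLinearMap.proj (R := ℝ) (φ := fun _ : Fin 3 => ℝ) α).hasFDerivAt).sub_const c)

theorem pd_coord (α : Fin 3) (c : ℝ) (ν : Fin 3) (x : Coord) :
    pd ν (fun y => ((y α - c : ℝ) : ℂ)) x = if α = ν then 1 else 0 := by
  rw [pd, (hasFDerivAt_coord α c x).fderiv]
  by_cases h : α = ν <;> simp [h]

theorem smooth_coord (α : Fin 3) (c : ℝ) :
    ContDiff ℝ ∞ (fun y : Coord => ((y α - c : ℝ) : ℂ)) :=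
  Complex.ofRealCLM.contDiff.comp ((contDiff_apply ℝ ℝ α).sub contDiff_const)

/-- The test spinors are constants, linear functions and products of two linear functions, all
centred at `x`; each degree isolates one order. Second derivatives commute, hence only the
symmetrization of `S` is visible. -/
theorem coeff_eq_zero_of_secondOrder {S : Fin 3 → Fin 3 → Mat} {T : Fin 3 → Mat} {W : Mat}
    (h : ∀ ψ : Coord → Spinor, ContDiff ℝ ∞ ψ → secondOrder S T W ψ x = 0) :
    W = 0 ∧ (∀ ν, T ν = 0) ∧ ∀ μ ν, S μ ν + S ν μ = 0 := by
  have hW : W = 0 := by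
    refine eq_zero_of_mulVec fun v => ?_
    have h1 := h (fun _ => v) contDiff_const
    have h2 : ∀ ν, pd ν (fun _ : Coord => v) = fun _ => 0 := fun ν => funext fun y => pd_const v ν y
    simpa only [secondOrder, h2, pd_const, Matrix.mulVec_zero, Finset.sum_const_zero, zero_add]
      using h1
  have hT : ∀ α, T α = 0 := by
    intro α
    refine eq_zero_of_mulVec fun v => ?_
    have h1 := h (fun y => ((y α - x α : ℝ) : ℂ) • v) ((smooth_coord α _).smul contDiff_const)
    have h2 : ∀ ν, pd ν (fun y : Coord => ((y α - x α : ℝ) : ℂ) • v) =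
        fun _ => (if α = ν then (1 : ℂ) else 0) • v := fun ν => funext fun y => by
      rw [pd_smul_const (hasFDerivAt_coord α _ y).differentiableAt, pd_coord]
    simp only [secondOrder, h2, pd_const, Matrix.mulVec_zero, Finset.sum_const_zero, zero_add,
      sub_self, Complex.ofReal_zero, zero_smul, add_zero, Matrix.mulVec_smul] at h1
    simpa using h1
  refine ⟨hW, hT, fun α β => ?_⟩
  refine eq_zero_of_mulVec fun v => ?_
  have h1 := h (fun y => (((y α - x α : ℝ) : ℂ) * ((y β - x β : ℝ) : ℂ)) • v)
    (((smooth_coord α _).mul (smooth_coord β _)).smul contDiff_const)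
  have h2 : ∀ ν, pd ν (fun y : Coord => (((y α - x α : ℝ) : ℂ) * ((y β - x β : ℝ) : ℂ)) • v) =
      fun y => ((if α = ν then (1 : ℂ) else 0) * ((y β - x β : ℝ) : ℂ) +
        ((y α - x α : ℝ) : ℂ) * (if β = ν then (1 : ℂ) else 0)) • v := fun ν => funext fun y => by
    have dα := (hasFDerivAt_coord α (x α) y).differentiableAt
    have dβ := (hasFDerivAt_coord β (x β) y).differentiableAt
    rw [pd_smul_const (f := fun y => ((y α - x α : ℝ) : ℂ) * ((y β - x β : ℝ) : ℂ)) (dα.mul dβ),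
      pd_mul dα dβ, pd_coord, pd_coord]
  have h3 : ∀ μ ν, pd μ (pd ν (fun y : Coord =>
      (((y α - x α : ℝ) : ℂ) * ((y β - x β : ℝ) : ℂ)) • v)) x =
      ((if α = ν then (1 : ℂ) else 0) * (if β = μ then (1 : ℂ) else 0) +
        (if α = μ then (1 : ℂ) else 0) * (if β = ν then (1 : ℂ) else 0)) • v := fun μ ν => by
    have dα := (hasFDerivAt_coord α (x α) x).differentiableAt
    have dβ := (hasFDerivAt_coord β (x β) x).differentiableAt
    rw [h2, pd_smul_const (f := fun y => (if α = ν then (1 : ℂ) else 0) * ((y β - x β : ℝ) : ℂ) +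
        ((y α - x α : ℝ) : ℂ) * (if β = ν then (1 : ℂ) else 0))
        ((dβ.const_mul _).add (dα.mul_const _)),
      pd_add (dβ.const_mul _) (dα.mul_const _), pd_const_mul dβ, pd_coord,
      pd_mul dα (differentiableAt_const _), pd_coord, pd_const, mul_zero, add_zero]
  simp only [secondOrder, h3, hW, hT, Matrix.zero_mulVec, Finset.sum_const_zero, add_zero] at h1
  simp only [Matrix.mulVec_smul] at h1
  simp only [add_smul, Finset.sum_add_distrib, mul_smul, ite_smul, one_smul, zero_smul] at h1
  rw [Matrix.add_mulVec, add_comm]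
  simpa using h1

theorem secondOrder_eq_zero (hU : IsOpen U) {S : Fin 3 → Fin 3 → Mat} {T : Fin 3 → Mat} {W : Mat}
    (hS : ∀ μ ν, S μ ν + S ν μ = 0) (hT : ∀ ν, T ν = 0) (hW : W = 0) {ψ : Coord → Spinor}
    (hψ : ContDiffOn ℝ ∞ ψ U) (hx : x ∈ U) : secondOrder S T W ψ x = 0 := by
  have h : ∑ μ, ∑ ν, (S μ ν).mulVec (pd μ (pd ν ψ) x) = 0 := by
    have e : ∑ μ, ∑ ν, (S μ ν).mulVec (pd μ (pd ν ψ) x) =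
        -∑ μ, ∑ ν, (S μ ν).mulVec (pd μ (pd ν ψ) x) := by
      conv_lhs => rw [Finset.sum_comm]
      simp only [← Finset.sum_neg_distrib]
      refine Finset.sum_congr rfl fun μ _ => Finset.sum_congr rfl fun ν _ => ?_
      rw [pd_comm hU hψ hx, eq_neg_of_add_eq_zero_left (hS ν μ), Matrix.neg_mulVec]
    exact self_eq_neg.1 e
  simp only [secondOrder, h, hT, hW, Matrix.zero_mulVec, Finset.sum_const_zero, add_zero]

end SecondOrder

/-! ### Composition of first-order operators -/

namespace Spacetime

section Operators

variable (M : Spacetime) (s : ℝ) (A : Fin 3 → Coord → ℝ)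

/-- The part without derivatives of the operator `X^ν P_ν + χ = i X^ν ∂_ν + Z`. -/
def zeroPart (X : FirstOrderOp) (x : Coord) : Mat :=
  X.pot x + ∑ ν, X.vec ν x * (Complex.I • M.spinConn s ν x - (A ν x : ℂ) • (1 : Mat))

theorem act_eq (X : FirstOrderOp) (ψ : Coord → Spinor) (x : Coord) :
    M.act s A X ψ x = ∑ ν, (Complex.I • X.vec ν x).mulVec (pd ν ψ x) +
      (M.zeroPart s A X x).mulVec (ψ x) := by
  simp only [act, zeroPart, momentum, Matrix.add_mulVec, Matrix.sum_mulVec, ← Matrix.mulVec_mulVec,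
    Matrix.sub_mulVec, Matrix.smul_mulVec, Matrix.one_mulVec, Matrix.mulVec_sub,
    Matrix.mulVec_smul, smul_add, Matrix.mulVec_add, Finset.sum_add_distrib,
    Finset.sum_sub_distrib]
  abel

variable {M s A}

theorem smooth_zeroPart (hA : ∀ μ, ContDiffOn ℝ ∞ (A μ) M.U) {X : FirstOrderOp}
    (hX : X.Smooth M.U) : SmoothMat M.U (M.zeroPart s A X) := by
  refine hX.2.add (SmoothMat.sum fun ν _ => (hX.1 ν).mul ?_)
  exact (SmoothMat.smul contDiffOn_const (M.smooth_spinConn s ν)).sub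
    (SmoothMat.smul (smoothOn_ofReal (hA ν)) (SmoothMat.const _))

theorem smooth_dirac (m : ℝ) : (M.dirac s m).Smooth M.U :=
  ⟨M.smooth_gamma s, SmoothMat.const _⟩

theorem smooth_act (hA : ∀ μ, ContDiffOn ℝ ∞ (A μ) M.U) {X : FirstOrderOp}
    (hX : X.Smooth M.U) {ψ : Coord → Spinor} (hψ : ContDiffOn ℝ ∞ ψ M.U) :
    ContDiffOn ℝ ∞ (M.act s A X ψ) M.U := by
  rw [funext fun x => M.act_eq s A X ψ x]
  exact (ContDiffOn.sum fun ν _ => (SmoothMat.smul contDiffOn_const (hX.1 ν)).mulVec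
    (smoothOn_pd M.isOpen_U hψ ν)).add ((smooth_zeroPart hA hX).mulVec hψ)

variable (M s A) in
/-- The coefficients of first derivatives in a product of first-order operators. -/
def firstCoeff (X Y : FirstOrderOp) (ν : Fin 3) (x : Coord) : Mat :=
  -(∑ μ, X.vec μ x * pdMat μ (Y.vec ν) x) + Complex.I • (X.vec ν x * M.zeroPart s A Y x) +
    Complex.I • (M.zeroPart s A X x * Y.vec ν x)

variable (M s A) in
/-- The term without derivatives in a product of first-order operators. -/
def zeroCoeff (X Y : FirstOrderOp) (x : Coord) : Mat :=
  Complex.I • (∑ μ, X.vec μ x * pdMat μ (M.zeroPart s A Y) x) +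
    M.zeroPart s A X x * M.zeroPart s A Y x

/-- The Leibniz rule for `(i X^μ ∂_μ + Z)(i Y^ν ∂_ν + Z')`; the sign of the second-order coefficient
is `i² = -1`. In this plain form no commutators of the momenta are needed. -/
theorem act_act (hA : ∀ μ, ContDiffOn ℝ ∞ (A μ) M.U) (X : FirstOrderOp) {Y : FirstOrderOp}
    (hY : Y.Smooth M.U) {ψ : Coord → Spinor} (hψ : ContDiffOn ℝ ∞ ψ M.U) {x : Coord}
    (hx : x ∈ M.U) :
    M.act s A X (M.act s A Y ψ) x =
      secondOrder (fun μ ν => -(X.vec μ x * Y.vec ν x)) (fun ν => M.firstCoeff s A X Y ν x)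
        (M.zeroCoeff s A X Y x) ψ x := by
  have hU := M.isOpen_U
  have hp := fun ν => smoothOn_pd hU hψ ν
  have hYI : ∀ ν, SmoothMat M.U (fun y => Complex.I • Y.vec ν y) := fun ν =>
    SmoothMat.smul contDiffOn_const (hY.1 ν)
  have hZ := smooth_zeroPart (s := s) hA hY
  have hpI : ∀ μ ν, pdMat μ (fun y => Complex.I • Y.vec ν y) x =
      Complex.I • pdMat μ (Y.vec ν) x := fun μ ν => by
    ext i j
    exact pd_const_mul (differentiableAt_of_smoothOn hU (hY.1 ν i j) hx) _ _
  have key : ∀ μ, pd μ (M.act s A Y ψ) x =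
      ∑ ν, ((Complex.I • pdMat μ (Y.vec ν) x).mulVec (pd ν ψ x) +
        (Complex.I • Y.vec ν x).mulVec (pd μ (pd ν ψ) x)) +
      ((pdMat μ (M.zeroPart s A Y) x).mulVec (ψ x) +
        (M.zeroPart s A Y x).mulVec (pd μ ψ x)) := fun μ => by
    rw [funext fun x => M.act_eq s A Y ψ x,
      pd_add (f := fun y => ∑ ν, (Complex.I • Y.vec ν y).mulVec (pd ν ψ y))
        (differentiableAt_of_smoothOn hU (ContDiffOn.sum fun ν _ => (hYI ν).mulVec (hp ν)) hx)
        (differentiableAt_of_smoothOn hU (hZ.mulVec hψ) hx),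
      pd_sum (f := fun ν y => (Complex.I • Y.vec ν y).mulVec (pd ν ψ y))
        (fun ν _ => differentiableAt_of_smoothOn hU ((hYI ν).mulVec (hp ν)) hx),
      pd_mulVec hU hZ hψ hx]
    congr 1
    exact Finset.sum_congr rfl fun ν _ => by rw [pd_mulVec hU (hYI ν) (hp ν) hx, hpI]
  rw [act_eq, M.act_eq s A Y]
  simp only [key, secondOrder, firstCoeff, zeroCoeff]
  simp only [Fin.sum_univ_three, Matrix.add_mulVec, Matrix.neg_mulVec, Matrix.smul_mulVec,
    Matrix.mulVec_add, Matrix.mulVec_smul, ← Matrix.mulVec_mulVec, smul_add]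
  simp only [smul_smul, Complex.I_mul_I, neg_smul, one_smul]
  abel

end Operators

end Spacetime
-- Trivial operators and the coefficients of the commutator
namespace Spacetime

section SymmetryOperators

variable {M : Spacetime} {s : ℝ} {A : Fin 3 → Coord → ℝ} {x : Coord}

variable (M s A) in
/-- The operator `V^ν P_ν + χ` that acts as `i V^ν ∂_ν + W`. -/
def ofPlain (V : Fin 3 → Coord → Mat) (W : Coord → Mat) : FirstOrderOp where
  vec := V
  pot := fun x => W x -
    ∑ ν, V ν x * (Complex.I • M.spinConn s ν x - (A ν x : ℂ) • (1 : Mat))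

theorem smooth_ofPlain (hA : ∀ μ, ContDiffOn ℝ ∞ (A μ) M.U) {V : Fin 3 → Coord → Mat}
    {W : Coord → Mat} (hV : ∀ ν, SmoothMat M.U (V ν)) (hW : SmoothMat M.U W) :
    (M.ofPlain s A V W).Smooth M.U :=
  ⟨hV, hW.sub (SmoothMat.sum fun ν _ => (hV ν).mul
    ((SmoothMat.smul contDiffOn_const (M.smooth_spinConn s ν)).sub
      (SmoothMat.smul (smoothOn_ofReal (hA ν)) (SmoothMat.const _))))⟩

theorem act_ofPlain (V : Fin 3 → Coord → Mat) (W : Coord → Mat) (ψ : Coord → Spinor) (x : Coord) :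
    M.act s A (M.ofPlain s A V W) ψ x =
      ∑ ν, (Complex.I • V ν x).mulVec (pd ν ψ x) + (W x).mulVec (ψ x) := by
  rw [act_eq]
  simp [zeroPart, ofPlain]

theorem act_add_op (X Y : FirstOrderOp) (ψ : Coord → Spinor) (x : Coord) :
    M.act s A ⟨fun ν y => X.vec ν y + Y.vec ν y, fun y => X.pot y + Y.pot y⟩ ψ x =
      M.act s A X ψ x + M.act s A Y ψ x := by
  simp only [act, Matrix.add_mulVec, Finset.sum_add_distrib]
  abel

theorem act_congr {X : FirstOrderOp} {ψ χ : Coord → Spinor} (h : ∀ y ∈ M.U, ψ y = χ y)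
    (hx : x ∈ M.U) : M.act s A X ψ x = M.act s A X χ x := by
  simp only [act_eq, pd_congr M.isOpen_U h hx, h x hx]

theorem act_add {X : FirstOrderOp} {ψ χ : Coord → Spinor} (hψ : ContDiffOn ℝ ∞ ψ M.U)
    (hχ : ContDiffOn ℝ ∞ χ M.U) (hx : x ∈ M.U) :
    M.act s A X (fun y => ψ y + χ y) x = M.act s A X ψ x + M.act s A X χ x := by
  simp only [act_eq, pd_add (differentiableAt_of_smoothOn M.isOpen_U hψ hx)
    (differentiableAt_of_smoothOn M.isOpen_U hχ hx), Matrix.mulVec_add, Finset.sum_add_distrib]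
  abel

/-- The commutator of multiplication by `R` with a first-order operator is again of first order.
With `X = H` it supplies the operator `[R, H]` in `[R H, H] = [R, H] H`. -/
theorem mulVec_act_sub {R : Coord → Mat} (hR : SmoothMat M.U R) (X : FirstOrderOp)
    {ψ : Coord → Spinor} (hψ : ContDiffOn ℝ ∞ ψ M.U) (hx : x ∈ M.U) :
    (R x).mulVec (M.act s A X ψ x) - M.act s A X (fun y => (R y).mulVec (ψ y)) x =
      M.act s A (M.ofPlain s A (fun ν y => R y * X.vec ν y - X.vec ν y * R y)
        (fun y => R y * M.zeroPart s A X y - M.zeroPart s A X y * R y -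
          Complex.I • ∑ ν, X.vec ν y * pdMat ν R y)) ψ x := by
  simp only [act_ofPlain, M.act_eq s A X, pd_mulVec M.isOpen_U hR hψ hx]
  simp only [Fin.sum_univ_three, Matrix.mulVec_add, Matrix.mulVec_smul, Matrix.smul_mulVec,
    Matrix.sub_mulVec, Matrix.add_mulVec, ← Matrix.mulVec_mulVec, smul_add, smul_sub]
  abel

theorem DifferByTrivial.symm {m : ℝ} {R : Coord → Mat} {X Y : FirstOrderOp}
    (h : M.DifferByTrivial s A m R X Y) : M.DifferByTrivial s A m (fun x => -R x) Y X := by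
  intro ψ hψ x hx
  rw [h ψ hψ x hx, Matrix.neg_mulVec]
  abel

/-- Adding a trivial operator `R H` preserves symmetry operators. -/
theorem IsSymmetryOperator.of_differByTrivial (hA : ∀ μ, ContDiffOn ℝ ∞ (A μ) M.U) {m : ℝ}
    {R : Coord → Mat} (hR : SmoothMat M.U R) {X Y : FirstOrderOp} (hY : Y.Smooth M.U)
    (h : M.DifferByTrivial s A m R X Y) (hsymm : M.IsSymmetryOperator s A m Y) :
    M.IsSymmetryOperator s A m X := by
  obtain ⟨Ψ, hΨ, hcomm⟩ := hsymm
  have hH := smooth_dirac (M := M) (s := s) m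
  set H := M.dirac s m with hHdef
  -- `K = [R, H]`, so that `Ψ + K` is the multiplier for the operator with `R H` added.
  set K := M.ofPlain s A (fun ν y => R y * H.vec ν y - H.vec ν y * R y)
        (fun y => R y * M.zeroPart s A H y - M.zeroPart s A H y * R y -
          Complex.I • ∑ ν, H.vec ν y * pdMat ν R y) with hK
  have hKs : K.Smooth M.U := by
    have hZ := smooth_zeroPart (s := s) hA hH
    refine smooth_ofPlain hA (fun ν => (hR.mul (hH.1 ν)).sub ((hH.1 ν).mul hR))
      (((hR.mul hZ).sub (hZ.mul hR)).sub (SmoothMat.smul contDiffOn_const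
        (SmoothMat.sum fun ν _ => (hH.1 ν).mul (smoothMat_pdMat M.isOpen_U hR ν))))
  refine ⟨⟨fun ν y => Ψ.vec ν y + K.vec ν y, fun y => Ψ.pot y + K.pot y⟩,
    ⟨fun ν => (hΨ.1 ν).add (hKs.1 ν), hΨ.2.add hKs.2⟩, fun ψ hψ x hx => ?_⟩
  have hHψ := smooth_act (s := s) hA hH hψ
  have hYψ := smooth_act (s := s) hA hY hψ
  rw [act_add_op, ← hcomm ψ hψ x hx, ← mulVec_act_sub hR H hHψ hx, h _ hHψ x hx,
    act_congr (h ψ hψ) hx, act_add hYψ (hR.mulVec hHψ) hx]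
  abel

theorem secondOrder_sub (S S' : Fin 3 → Fin 3 → Mat) (T T' : Fin 3 → Mat) (W W' : Mat)
    (ψ : Coord → Spinor) (x : Coord) :
    secondOrder S T W ψ x - secondOrder S' T' W' ψ x =
      secondOrder (fun μ ν => S μ ν - S' μ ν) (fun ν => T ν - T' ν) (W - W') ψ x := by
  simp only [secondOrder, Matrix.sub_mulVec, Finset.sum_sub_distrib]
  abel

theorem commutator_eq_secondOrder (hA : ∀ μ, ContDiffOn ℝ ∞ (A μ) M.U) {X H : FirstOrderOp}
    (hX : X.Smooth M.U) (hH : H.Smooth M.U) (Ψ : FirstOrderOp) {ψ : Coord → Spinor}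
    (hψ : ContDiffOn ℝ ∞ ψ M.U) (hx : x ∈ M.U) :
    M.act s A X (M.act s A H ψ) x - M.act s A H (M.act s A X ψ) x -
        M.act s A Ψ (M.act s A H ψ) x =
      secondOrder (fun μ ν => -(X.vec μ x * H.vec ν x) - -(H.vec μ x * X.vec ν x) -
          -(Ψ.vec μ x * H.vec ν x))
        (fun ν => M.firstCoeff s A X H ν x - M.firstCoeff s A H X ν x - M.firstCoeff s A Ψ H ν x)
        (M.zeroCoeff s A X H x - M.zeroCoeff s A H X x - M.zeroCoeff s A Ψ H x) ψ x := by
  rw [act_act hA X hH hψ hx, act_act hA H hX hψ hx, act_act hA Ψ hH hψ hx, secondOrder_sub,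
    secondOrder_sub]

/-- The operator `ξ^ν P_ν + χ` with scalar coefficients of the momenta. -/
def _root_.DiracSymm.scalarOp (ξ : Fin 3 → Coord → ℂ) (χ : Coord → Mat) : FirstOrderOp where
  vec := fun μ x => ξ μ x • (1 : Mat)
  pot := χ

/-- The operator of multiplication by a matrix function. -/
def _root_.DiracSymm.matrixOp (q : Coord → Mat) : FirstOrderOp where
  vec := fun _ _ => 0
  pot := q

theorem smooth_scalarOp {ξ : Fin 3 → Coord → ℂ} {χ : Coord → Mat}
    (hξ : ∀ μ, ContDiffOn ℝ ∞ (ξ μ) M.U) (hχ : SmoothMat M.U χ) : (scalarOp ξ χ).Smooth M.U :=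
  ⟨fun μ => SmoothMat.smul (hξ μ) (SmoothMat.const _), hχ⟩

variable (M s A) in
/-- The coefficients of first derivatives in `[ξ^ν P_ν + χ, H] - q H`. -/
def scalarFirst (ξ : Fin 3 → Coord → ℂ) (χ : Coord → Mat) (q : Mat) (ν : Fin 3) (x : Coord) :
    Mat :=
  -(∑ μ, ξ μ x • pdMat μ (M.gamma s ν) x) + ∑ μ, pd μ (ξ ν) x • M.gamma s μ x +
    Complex.I • (M.zeroPart s A (scalarOp ξ χ) x * M.gamma s ν x -
      M.gamma s ν x * M.zeroPart s A (scalarOp ξ χ) x) - Complex.I • (q * M.gamma s ν x)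

variable (M s A) in
/-- The term without derivatives in `[ξ^ν P_ν + χ, H] - q H`. -/
def scalarZero (m : ℝ) (ξ : Fin 3 → Coord → ℂ) (χ : Coord → Mat) (q : Mat) (x : Coord) : Mat :=
  Complex.I • (∑ μ, ξ μ x • pdMat μ (M.zeroPart s A (M.dirac s m)) x) -
    Complex.I • (∑ μ, M.gamma s μ x * pdMat μ (M.zeroPart s A (scalarOp ξ χ)) x) +
    (M.zeroPart s A (scalarOp ξ χ) x * M.zeroPart s A (M.dirac s m) x -
      M.zeroPart s A (M.dirac s m) x * M.zeroPart s A (scalarOp ξ χ) x) -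
    q * M.zeroPart s A (M.dirac s m) x

theorem zeroPart_of_vec_eq_zero {Ψ : FirstOrderOp} (h : ∀ ν, Ψ.vec ν x = 0) :
    M.zeroPart s A Ψ x = Ψ.pot x := by
  simp [zeroPart, h]

theorem firstCoeff_sub_eq (m : ℝ) {ξ : Fin 3 → Coord → ℂ} (hξ : ∀ μ, ContDiffOn ℝ ∞ (ξ μ) M.U)
    (χ : Coord → Mat) {Ψ : FirstOrderOp} (hΨ : ∀ ν, Ψ.vec ν x = 0) (hx : x ∈ M.U) (ν : Fin 3) :
    M.firstCoeff s A (scalarOp ξ χ) (M.dirac s m) ν x -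
        M.firstCoeff s A (M.dirac s m) (scalarOp ξ χ) ν x - M.firstCoeff s A Ψ (M.dirac s m) ν x =
      M.scalarFirst s A ξ χ (Ψ.pot x) ν x := by
  have h1 : ∀ μ, pdMat μ ((scalarOp ξ χ).vec ν) x = pd μ (ξ ν) x • (1 : Mat) := fun μ =>
    pdMat_smul_const M.isOpen_U (hξ ν) 1 hx μ
  simp only [firstCoeff, scalarFirst, hΨ, h1, zeroPart_of_vec_eq_zero hΨ]
  simp only [scalarOp, dirac, Matrix.smul_mul, Matrix.one_mul, Matrix.mul_smul, Matrix.mul_one,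
    Matrix.zero_mul, Finset.sum_const_zero, neg_zero, smul_zero, smul_sub]
  abel

theorem zeroCoeff_sub_eq (m : ℝ) (ξ : Fin 3 → Coord → ℂ)
    (χ : Coord → Mat) {Ψ : FirstOrderOp} (hΨ : ∀ ν, Ψ.vec ν x = 0) :
    M.zeroCoeff s A (scalarOp ξ χ) (M.dirac s m) x -
        M.zeroCoeff s A (M.dirac s m) (scalarOp ξ χ) x - M.zeroCoeff s A Ψ (M.dirac s m) x =
      M.scalarZero s A m ξ χ (Ψ.pot x) x := by
  simp only [zeroCoeff, scalarZero, hΨ, zeroPart_of_vec_eq_zero hΨ]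
  simp only [scalarOp, dirac, Matrix.smul_mul, Matrix.one_mul,
    Matrix.zero_mul, Finset.sum_const_zero, smul_zero]
  abel

end SymmetryOperators

end Spacetime

/-! ### Differentiation of the structure and rotation terms -/

section LinearForms

/-- Exhibits linearity in `C` with constant matrix coefficients, so that derivatives and linear
combinations pass inside. -/
theorem structureTerm_eq_sum (s : ℝ) (C : Fin 3 → Fin 3 → Fin 3 → ℂ) :
    structureTerm s C = ∑ p : Fin 3 × Fin 3 × Fin 3, C p.1 p.2.1 p.2.2 •
      ((if p.2.2 = p.1 then (1 / 2 : ℂ) else 0) • gammaHat s p.2.1 +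
        (Complex.I * s / 8 * (ε p.1 p.2.1 p.2.2 : ℂ) * sgn p.2.2) • (1 : Mat)) := by
  simp only [structureTerm, Fintype.sum_prod_type, smul_add, Finset.sum_add_distrib, smul_smul]
  congr 1
  · simp only [Finset.smul_sum, Finset.sum_smul, mul_ite, mul_zero, ite_smul, zero_smul,
      Finset.sum_ite_eq', Finset.mem_univ, if_true, smul_smul]
    rw [Finset.sum_comm]
    exact Finset.sum_congr rfl fun b _ => Finset.sum_congr rfl fun a _ => by rw [mul_comm]
  · simp only [Finset.mul_sum, Finset.sum_smul]
    refine Finset.sum_congr rfl fun a _ => Finset.sum_congr rfl fun b _ =>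
      Finset.sum_congr rfl fun c _ => ?_
    congr 1
    ring

theorem rotationTerm_eq_sum (s : ℝ) (L : Fin 3 → Fin 3 → ℂ) :
    rotationTerm s L = ∑ p : Fin 3 × Fin 3, L p.1 p.2 •
      ((-(s / 4) : ℂ) • ∑ d, ((ε p.2 p.1 d : ℂ) * sgn p.1) • gammaHat s d) := by
  simp only [rotationTerm, Fintype.sum_prod_type, Finset.smul_sum, smul_smul]
  rw [Finset.sum_comm]
  refine Finset.sum_congr rfl fun a _ => Finset.sum_congr rfl fun c _ =>
    Finset.sum_congr rfl fun d _ => ?_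
  congr 1
  ring

variable {U : Set Coord} {x : Coord} {s : ℝ}

theorem pdMat_structureTerm (hU : IsOpen U) {C : Fin 3 → Fin 3 → Fin 3 → Coord → ℂ}
    (hC : ∀ a b c, ContDiffOn ℝ ∞ (C a b c) U) (hx : x ∈ U) (μ : Fin 3) :
    pdMat μ (fun y => structureTerm s (fun a b c => C a b c y)) x =
      structureTerm s (fun a b c => pd μ (C a b c) x) := by
  simp only [structureTerm_eq_sum]
  exact pdMat_sum_smul_const (f := fun p : Fin 3 × Fin 3 × Fin 3 => C p.1 p.2.1 p.2.2) _ hU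
    (fun p => hC _ _ _) _ hx μ

theorem pdMat_rotationTerm (hU : IsOpen U) {L : Fin 3 → Fin 3 → Coord → ℂ}
    (hL : ∀ a b, ContDiffOn ℝ ∞ (L a b) U) (hx : x ∈ U) (μ : Fin 3) :
    pdMat μ (fun y => rotationTerm s (fun a b => L a b y)) x =
      rotationTerm s (fun a b => pd μ (L a b) x) := by
  simp only [rotationTerm_eq_sum]
  exact pdMat_sum_smul_const (f := fun p : Fin 3 × Fin 3 => L p.1 p.2) _ hU
    (fun p => hL _ _) _ hx μ

theorem smoothMat_structureTerm {C : Fin 3 → Fin 3 → Fin 3 → Coord → ℂ}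
    (hC : ∀ a b c, ContDiffOn ℝ ∞ (C a b c) U) :
    SmoothMat U (fun y => structureTerm s (fun a b c => C a b c y)) := by
  simp only [structureTerm_eq_sum]
  exact SmoothMat.sum fun p _ => SmoothMat.smul (hC _ _ _) (SmoothMat.const _)

theorem smoothMat_rotationTerm {L : Fin 3 → Fin 3 → Coord → ℂ}
    (hL : ∀ a b, ContDiffOn ℝ ∞ (L a b) U) :
    SmoothMat U (fun y => rotationTerm s (fun a b => L a b y)) := by
  simp only [rotationTerm_eq_sum]
  exact SmoothMat.sum fun p _ => SmoothMat.smul (hL _ _) (SmoothMat.const _)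

theorem sum_smul_structureTerm (X : Fin 3 → ℂ) (C : Fin 3 → Fin 3 → Fin 3 → Fin 3 → ℂ) :
    ∑ μ, X μ • structureTerm s (C μ) =
      structureTerm s (fun a b c => ∑ μ, X μ * C μ a b c) := by
  simp only [structureTerm_eq_sum, Finset.smul_sum]
  rw [Finset.sum_comm]
  refine Finset.sum_congr rfl fun p _ => ?_
  rw [Finset.sum_smul]
  exact Finset.sum_congr rfl fun μ _ => smul_smul _ _ _

theorem sum_smul_rotationTerm (X : Fin 3 → ℂ) (L : Fin 3 → Fin 3 → Fin 3 → ℂ) :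
    ∑ μ, X μ • rotationTerm s (L μ) = rotationTerm s (fun a b => ∑ μ, X μ * L μ a b) := by
  simp only [rotationTerm_eq_sum, Finset.smul_sum (s := (Finset.univ : Finset (Fin 3 × Fin 3)))]
  rw [Finset.sum_comm]
  refine Finset.sum_congr rfl fun p _ => ?_
  rw [Finset.sum_smul]
  exact Finset.sum_congr rfl fun μ _ => smul_smul _ _ _

theorem add_sum_gammaHat_eq_zero_iff (hs : s = 1 ∨ s = -1) (c : ℂ) (v : Fin 3 → ℂ) :
    c • (1 : Mat) + ∑ i, v i • gammaHat s i = 0 ↔ c = 0 ∧ ∀ i, v i = 0 := by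
  have : c • (1 : Mat) + ∑ i, v i • gammaHat s i = cliff s c (v 0) (v 1) (v 2) := by
    simp only [Fin.sum_univ_three, gammaHat_zero, gammaHat_one, gammaHat_two, cliff]
    apply mat_ext <;> simp <;> ring
  rw [this, cliff_eq_zero_iff hs]
  simp [Fin.forall_fin_succ]

end LinearForms

/-! ### The first-order equations -/

namespace Spacetime

section FirstOrder

variable {M : Spacetime} {s : ℝ} {A : Fin 3 → Coord → ℝ} {x : Coord}
  {ξ : Fin 3 → Coord → ℂ} {χ : Coord → Mat}

theorem forall_eq_zero_iff_contraction {V : Type*} [AddCommGroup V] [Module ℂ V] (hx : x ∈ M.U)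
    (T : Fin 3 → V) :
    (∀ ν, T ν = 0) ↔ ∀ b, ∑ ν, (M.triad b ν x : ℂ) • T ν = 0 := by
  constructor
  · intro h b
    simp [h]
  · intro h ν
    have : T ν = ∑ b, M.frame b ν x • ∑ ρ, (M.triad b ρ x : ℂ) • T ρ := by
      simp only [Finset.smul_sum, smul_smul]
      rw [Finset.sum_comm]
      simp only [← Finset.sum_smul, sum_frame_triad hx]
      simp
    rw [this]
    simp only [h, smul_zero, Finset.sum_const_zero]

/-- The two derivative terms `-ξ^μ ∂_μ γ^ν + γ^μ ∂_μ ξ^ν` together are `-[ξ, E_a]^ν γ̂^a`. -/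
theorem scalarFirst_contraction (hx : x ∈ M.U) (q : Mat) (b : Fin 3) :
    ∑ ν, (M.triad b ν x : ℂ) • M.scalarFirst s A ξ χ q ν x =
      ∑ a, -M.lieCoeff ξ a b x • gammaHat s a +
        Complex.I • (M.zeroPart s A (scalarOp ξ χ) x * gammaHat s b -
          gammaHat s b * M.zeroPart s A (scalarOp ξ χ) x) - Complex.I • (q * gammaHat s b) := by
  rw [← sum_triad_gamma hx b]
  obtain ⟨P, hP⟩ : ∃ P : Fin 3 → Mat, P = fun ν => -(∑ μ, ξ μ x • pdMat μ (M.gamma s ν) x) +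
      ∑ μ, pd μ (ξ ν) x • M.gamma s μ x := ⟨_, rfl⟩
  have h1 : ∑ ν, (M.triad b ν x : ℂ) • P ν = ∑ a, -M.lieCoeff ξ a b x • gammaHat s a := by
    simp only [hP, pdMat_gamma hx, gamma_eq, lieCoeff, comp, bracket, dir, Fin.sum_univ_three]
    module
  have h2 : ∀ ν, M.scalarFirst s A ξ χ q ν x = P ν + Complex.I • (M.zeroPart s A (scalarOp ξ χ) x *
      M.gamma s ν x - M.gamma s ν x * M.zeroPart s A (scalarOp ξ χ) x) -
      Complex.I • (q * M.gamma s ν x) := by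
    intro ν
    rw [hP]
    rfl
  rw [← h1]
  simp only [h2, Finset.mul_sum, Finset.sum_mul, Finset.smul_sum,
    ← Finset.sum_sub_distrib, ← Finset.sum_add_distrib]
  refine Finset.sum_congr rfl fun ν _ => ?_
  simp only [Matrix.mul_smul, Matrix.smul_mul]
  module

theorem zeroPart_scalarOp : M.zeroPart s A (scalarOp ξ χ) x =
    χ x + Complex.I • ∑ ν, ξ ν x • M.spinConn s ν x - (∑ ν, ξ ν x * (A ν x : ℂ)) • (1 : Mat) := by
  simp only [zeroPart, scalarOp, Matrix.smul_mul, Matrix.one_mul, smul_sub,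
    Finset.sum_sub_distrib, Finset.smul_sum, smul_smul, Finset.sum_smul, mul_comm _ Complex.I]
  abel

theorem zeroPart_scalarOp_commutator (hs : s = 1 ∨ s = -1) (hx : x ∈ M.U) (b : Fin 3) :
    Complex.I • (M.zeroPart s A (scalarOp ξ χ) x * gammaHat s b -
          gammaHat s b * M.zeroPart s A (scalarOp ξ χ) x) =
      Complex.I • (χ x * gammaHat s b - gammaHat s b * χ x) +
        ∑ a, (∑ ν, ξ ν x * (M.conn ν a b x : ℂ)) • gammaHat s a := by
  have h : ∑ a, (∑ ν, ξ ν x * (M.conn ν a b x : ℂ)) • gammaHat s a =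
      -∑ ν, ξ ν x • (M.spinConn s ν x * gammaHat s b - gammaHat s b * M.spinConn s ν x) := by
    simp only [spinConn_commutator hs hx, smul_neg, Finset.sum_neg_distrib, neg_neg,
      Finset.smul_sum, smul_smul, Finset.sum_smul]
    exact Finset.sum_comm
  rw [zeroPart_scalarOp, h]
  simp only [Matrix.sub_mul, Matrix.add_mul, Matrix.mul_sub, Matrix.mul_add, Matrix.smul_mul,
    Matrix.mul_smul, Matrix.one_mul, Matrix.mul_one, Finset.sum_mul, Finset.mul_sum, smul_sub,
    smul_add, smul_smul, Complex.I_mul_I, Finset.sum_sub_distrib, neg_smul, one_smul]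
  abel

/-- The rotation `ξ^ν ∇_ν E_a` contained in the Lie coefficients is cancelled by the commutator with
the spin connection hidden in the derivative-free part. This replaces `-L` by `∇ξ` and that part by
`χ`. -/
theorem scalarFirst_contraction' (hs : s = 1 ∨ s = -1) (hx : x ∈ M.U) (q : Mat) (b : Fin 3) :
    ∑ ν, (M.triad b ν x : ℂ) • M.scalarFirst s A ξ χ q ν x =
      ∑ a, M.frameDeriv ξ a b x • gammaHat s a +
        Complex.I • (χ x * gammaHat s b - gammaHat s b * χ x) - Complex.I • (q * gammaHat s b) := by
  rw [scalarFirst_contraction hx, zeroPart_scalarOp_commutator hs hx]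
  simp only [lieCoeff_eq hx, neg_sub, sub_smul, Finset.sum_sub_distrib]
  abel

/-- The first-order part of `[ξ^ν P_ν + χ, H] = q H`, in terms of the frame components of the
covariant derivative of `ξ`. -/
theorem scalarFirst_eq_zero_iff (hs : s = 1 ∨ s = -1) (hx : x ∈ M.U) (q : Mat) :
    (∀ ν, M.scalarFirst s A ξ χ q ν x = 0) ↔
      (∀ a c, M.frameDeriv ξ a c x * sgn a + M.frameDeriv ξ c a x * sgn c =
        2 / 3 * (∑ b, M.frameDeriv ξ b b x) * (η a c : ℂ)) ∧
      q = (-(Complex.I / 3) * M.divergence ξ x) • (1 : Mat) ∧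
      χ x = ((χ x).trace / 2) • (1 : Mat) + rotationTerm s (fun a b => M.frameDeriv ξ a b x) := by
  rw [forall_eq_zero_iff_contraction hx, divergence_eq hx, ← gammaHat_condition_iff hs]
  simp only [scalarFirst_contraction' hs hx]

/-- The first-order part of `[ξ^ν P_ν + χ, H] = q H`, in terms of the Lie derivative of the
frame. -/
theorem scalarFirst_eq_zero_iff_lie (hs : s = 1 ∨ s = -1) (hx : x ∈ M.U) (q : Mat) :
    (∀ ν, M.scalarFirst s A ξ χ q ν x = 0) ↔
      (∀ a c, M.lieCoeff ξ a c x * sgn a + M.lieCoeff ξ c a x * sgn c =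
        2 / 3 * (∑ b, M.lieCoeff ξ b b x) * (η a c : ℂ)) ∧
      q = (Complex.I / 3 * ∑ b, M.lieCoeff ξ b b x) • (1 : Mat) ∧
      M.zeroPart s A (scalarOp ξ χ) x = ((M.zeroPart s A (scalarOp ξ χ) x).trace / 2) • (1 : Mat) +
        rotationTerm s (fun a b => -M.lieCoeff ξ a b x) := by
  rw [forall_eq_zero_iff_contraction hx]
  simp only [scalarFirst_contraction hx]
  rw [gammaHat_condition_iff hs (fun a b => -M.lieCoeff ξ a b x)]
  refine and_congr (forall_congr' fun a => forall_congr' fun c => ?_) (and_congr ?_ Iff.rfl)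
  · rw [Finset.sum_neg_distrib]
    constructor <;> intro h <;> linear_combination -h
  · rw [Finset.sum_neg_distrib, neg_mul_neg]

theorem trace_zeroPart_scalarOp (hx : x ∈ M.U) :
    (M.zeroPart s A (scalarOp ξ χ) x).trace / 2 =
      (χ x).trace / 2 - ∑ ν, ξ ν x * (A ν x : ℂ) := by
  rw [zeroPart_scalarOp, Matrix.trace_sub, Matrix.trace_add, Matrix.trace_smul, Matrix.trace_smul,
    Matrix.trace_sum]
  simp only [Matrix.trace_smul, trace_spinConn hx, Matrix.trace_one]
  simp
  ring

end FirstOrder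

end Spacetime
-- The zeroth-order equation
namespace Spacetime

section ZeroOrder

variable {M : Spacetime} {s : ℝ} {A : Fin 3 → Coord → ℝ} {x : Coord}
  {ξ : Fin 3 → Coord → ℂ} {χ : Coord → Mat}

variable (M A) in
/-- The frame components `A_i = e^ν_i A_ν` of the potential. -/
def framePotential (i : Fin 3) (x : Coord) : ℂ := ∑ ν, M.frame i ν x * (A ν x : ℂ)

theorem smooth_framePotential (hA : ∀ μ, ContDiffOn ℝ ∞ (A μ) M.U) (i : Fin 3) :
    ContDiffOn ℝ ∞ (M.framePotential A i) M.U :=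
  ContDiffOn.sum fun ν _ => (M.smooth_frame i ν).mul (smoothOn_ofReal (hA ν))

theorem zeroPart_dirac (hs : s = 1 ∨ s = -1) (m : ℝ) (hx : x ∈ M.U) :
    M.zeroPart s A (M.dirac s m) x =
      Complex.I • structureTerm s (fun a b c => M.structureCoeff a b c x) -
        ∑ i, M.framePotential A i x • gammaHat s i - (m : ℂ) • (1 : Mat) := by
  have h : ∑ ν, (A ν x : ℂ) • M.gamma s ν x =
      ∑ i, M.framePotential A i x • gammaHat s i := by
    simp only [gamma_eq, framePotential, Finset.smul_sum, Finset.sum_smul, smul_smul]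
    rw [Finset.sum_comm]
    exact Finset.sum_congr rfl fun i _ => Finset.sum_congr rfl fun ν _ => by rw [mul_comm]
  rw [← sum_gamma_spinConn hs hx, ← h]
  simp only [zeroPart, dirac, Matrix.mul_sub, Matrix.mul_smul, Matrix.mul_one,
    Finset.sum_sub_distrib, Finset.smul_sum]
  abel

theorem sum_smul_pdMat_zeroPart_dirac (hs : s = 1 ∨ s = -1) (hA : ∀ μ, ContDiffOn ℝ ∞ (A μ) M.U)
    (m : ℝ) (hx : x ∈ M.U) :
    ∑ μ, ξ μ x • pdMat μ (M.zeroPart s A (M.dirac s m)) x =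
      Complex.I • structureTerm s (fun a b c => dir ξ (M.structureCoeff a b c) x) -
        ∑ i, dir ξ (M.framePotential A i) x • gammaHat s i := by
  have hU := M.isOpen_U
  have hC := M.smooth_structureCoeff
  have hst := smoothMat_structureTerm (s := s) hC
  have ha := smooth_framePotential (M := M) hA
  have key : ∀ μ, pdMat μ (M.zeroPart s A (M.dirac s m)) x =
      Complex.I • structureTerm s (fun a b c => pd μ (M.structureCoeff a b c) x) -
        ∑ i, pd μ (M.framePotential A i) x • gammaHat s i := by
    intro μ
    rw [pdMat_congr hU (fun y hy => zeroPart_dirac hs m hy) hx, ← pdMat_structureTerm hU hC hx,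
      ← pdMat_sum_smul_const Finset.univ hU ha (gammaHat s) hx]
    have hg : SmoothMat M.U (fun y => ∑ i, M.framePotential A i y • gammaHat s i) :=
      SmoothMat.sum fun i _ => SmoothMat.smul (ha i) (SmoothMat.const _)
    ext i j
    have d1 := differentiableAt_of_smoothOn hU (hst i j) hx
    have d2 := differentiableAt_of_smoothOn hU (hg i j) hx
    have e := pd_sub ((d1.const_mul Complex.I).sub d2)
      (differentiableAt_const (((m : ℂ) • (1 : Mat)) i j)) μ
    rw [pd_const, sub_zero] at e
    refine e.trans ?_
    rw [show ((fun y => Complex.I * structureTerm s (fun a b c => M.structureCoeff a b c y) i j) -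
      fun y => (∑ k, M.framePotential A k y • gammaHat s k) i j) = fun y => Complex.I *
      structureTerm s (fun a b c => M.structureCoeff a b c y) i j -
      (∑ k, M.framePotential A k y • gammaHat s k) i j from rfl, pd_sub (d1.const_mul Complex.I) d2,
      pd_const_mul d1]
    rfl
  simp only [key, smul_sub, Finset.sum_sub_distrib]
  congr 1
  · have := sum_smul_structureTerm (s := s) (fun μ => ξ μ x)
      (fun μ a b c => pd μ (M.structureCoeff a b c) x)
    simp only [smul_comm _ Complex.I, ← Finset.smul_sum]
    rw [this]
    rfl
  · simp only [Finset.smul_sum, dir, Finset.sum_smul, smul_smul]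
    exact Finset.sum_comm

theorem pdMat_smul_one_add_rotationTerm {b : Coord → ℂ} {L : Fin 3 → Fin 3 → Coord → ℂ}
    (hb : ContDiffOn ℝ ∞ b M.U) (hL : ∀ i j, ContDiffOn ℝ ∞ (L i j) M.U) (hx : x ∈ M.U)
    (μ : Fin 3) :
    pdMat μ (fun y => b y • (1 : Mat) + rotationTerm s (fun i j => -L i j y)) x =
      pd μ b x • (1 : Mat) + rotationTerm s (fun i j => -pd μ (L i j) x) := by
  have hL' : ∀ i j, ContDiffOn ℝ ∞ (fun y => -L i j y) M.U := fun i j => (hL i j).neg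
  rw [pdMat_add M.isOpen_U (SmoothMat.smul hb (SmoothMat.const _)) (smoothMat_rotationTerm hL') hx,
    pdMat_smul_const M.isOpen_U hb _ hx,
    pdMat_rotationTerm (L := fun i j y => -L i j y) M.isOpen_U hL' hx]
  simp only [pd_neg]

/-- The covector whose vanishing is the equation for `φ_{,β}`. -/
def potentialDefect (M : Spacetime) (A : Fin 3 → Coord → ℝ) (ξ : Fin 3 → Coord → ℂ)
    (φ : Coord → ℂ) (β : Fin 3) (x : Coord) : ℂ :=
  pd β φ x - (Complex.I / 3 * pd β (M.divergence ξ) x +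
    ∑ μ, (fieldStrength A β μ x : ℂ) * ξ μ x)

theorem smooth_divergence (hξ : ∀ μ, ContDiffOn ℝ ∞ (ξ μ) M.U) :
    ContDiffOn ℝ ∞ (M.divergence ξ) M.U :=
  ContDiffOn.sum fun μ _ => M.smooth_covDeriv hξ μ μ

/-- Cartan's formula for the one-form `A`: the terms `ξ(A_i) - L_i^j A_j` are the frame components
of its Lie derivative, and subtracting the gradient of `ξ^ν A_ν` leaves the contraction of `ξ` with
`dA`, that is `-F_{βμ} ξ^μ`. The trace of `L` is minus the divergence. -/
theorem zero_order_coefficient (hA : ∀ μ, ContDiffOn ℝ ∞ (A μ) M.U)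
    (hξ : ∀ μ, ContDiffOn ℝ ∞ (ξ μ) M.U) {φ : Coord → ℂ} (hφ : ContDiffOn ℝ ∞ φ M.U)
    (hx : x ∈ M.U) (i : Fin 3) :
    -Complex.I * dir (M.frame i) (fun y => φ y - ∑ ν, ξ ν y * (A ν y : ℂ)) x +
        1 / 3 * ∑ k, dir (M.frame i) (M.lieCoeff ξ k k) x -
        Complex.I * dir ξ (M.framePotential A i) x +
        Complex.I * ∑ j, M.lieCoeff ξ i j x * M.framePotential A j x =
      -Complex.I * ∑ β, M.frame i β x * M.potentialDefect A ξ φ β x := by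
  have hU := M.isOpen_U
  have hA' := fun ν => smoothOn_ofReal (hA ν)
  have h1 : dir (M.frame i) (M.divergence ξ) x = -∑ k, dir (M.frame i) (M.lieCoeff ξ k k) x := by
    rw [dir_congr hU (fun y hy => divergence_eq_lieCoeff hy ξ) hx,
      ← dir_sum _ hU (fun k => M.smooth_lieCoeff hξ k k) hx]
    simp only [dir, pd_neg, mul_neg, Finset.sum_neg_distrib]
  have h2 : dir (M.frame i) (fun y => φ y - ∑ ν, ξ ν y * (A ν y : ℂ)) x =
      dir (M.frame i) φ x - ∑ ν, (dir (M.frame i) (ξ ν) x * (A ν x : ℂ) +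
        ξ ν x * dir (M.frame i) (fun y => (A ν y : ℂ)) x) := by
    rw [dir_sub hU hφ (ContDiffOn.sum fun ν _ => (hξ ν).mul (hA' ν)) hx,
      dir_sum _ hU (fun ν => (hξ ν).mul (hA' ν)) hx]
    simp only [dir_mul hU (hξ _) (hA' _) hx]
  have h3 : dir ξ (M.framePotential A i) x = ∑ ν, (dir ξ (M.frame i ν) x * (A ν x : ℂ) +
        M.frame i ν x * dir ξ (fun y => (A ν y : ℂ)) x) := by
    have e : M.framePotential A i = fun y => ∑ ν, M.frame i ν y * (A ν y : ℂ) := rfl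
    rw [e, dir_sum _ hU (fun ν => (M.smooth_frame i ν).mul (hA' ν)) hx]
    simp only [dir_mul hU (M.smooth_frame i _) (hA' _) hx]
  have h4 : ∑ j, M.lieCoeff ξ i j x * M.framePotential A j x =
      ∑ ν, bracket ξ (M.frame i) ν x * (A ν x : ℂ) := by
    simp only [eq_sum_comp hx (bracket ξ (M.frame i)), framePotential, Finset.mul_sum,
      Finset.sum_mul]
    rw [Finset.sum_comm]
    exact Finset.sum_congr rfl fun ν _ => Finset.sum_congr rfl fun j _ => by
      rw [lieCoeff]; ring
  have h5 : ∀ β μ, (fieldStrength A β μ x : ℂ) =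
      pd β (fun y => (A μ y : ℂ)) x - pd μ (fun y => (A β y : ℂ)) x := fun β μ => by
    rw [fieldStrength, pd_ofReal (differentiableAt_of_smoothOn hU (hA μ) hx),
      pd_ofReal (differentiableAt_of_smoothOn hU (hA β) hx), Complex.ofReal_sub]
  have h6 : ∑ β, M.frame i β x * M.potentialDefect A ξ φ β x = dir (M.frame i) φ x -
      (Complex.I / 3 * dir (M.frame i) (M.divergence ξ) x +
        ∑ β, ∑ μ, M.frame i β x * ((pd β (fun y => (A μ y : ℂ)) x -
          pd μ (fun y => (A β y : ℂ)) x) * ξ μ x)) := by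
    simp only [potentialDefect, h5, dir, Finset.mul_sum, mul_sub, mul_add, Finset.sum_sub_distrib,
      Finset.sum_add_distrib]
    congr 2
    exact Finset.sum_congr rfl fun β _ => by ring
  rw [h6, h1, h2, h3, h4]
  generalize ∑ k, dir (M.frame i) (M.lieCoeff ξ k k) x = S
  simp only [bracket, dir, Fin.sum_univ_three]
  linear_combination (S / 3) * Complex.I_sq

/-- The term without derivatives of `[ξ^ν P_ν + χ, H] - q H`, once the first-order part
vanishes. -/
theorem scalarZero_eq (hs : s = 1 ∨ s = -1) (hA : ∀ μ, ContDiffOn ℝ ∞ (A μ) M.U)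
    (hξ : ∀ μ, ContDiffOn ℝ ∞ (ξ μ) M.U) (hχ : SmoothMat M.U χ) (m : ℝ) {q : Coord → Mat}
    (hfirst : ∀ y ∈ M.U, ∀ ν, M.scalarFirst s A ξ χ (q y) ν y = 0) (hx : x ∈ M.U) :
    M.scalarZero s A m ξ χ (q x) x =
      (-(Complex.I / 3) * (m * M.divergence ξ x)) • (1 : Mat) + ∑ i, (-Complex.I *
        ∑ β, M.frame i β x * M.potentialDefect A ξ (fun y => (χ y).trace / 2) β x) •
          gammaHat s i := by
  have hU := M.isOpen_U
  have hφ : ContDiffOn ℝ ∞ (fun y => (χ y).trace / 2) M.U := by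
    simp only [Matrix.trace_fin_two]
    exact ((hχ 0 0).add (hχ 1 1)).div_const 2
  have hlie := fun y hy => (scalarFirst_eq_zero_iff_lie hs hy (q y)).1 (hfirst y hy)
  have hL := M.smooth_lieCoeff hξ
  -- Valid on all of `U` because the first-order equations are assumed there, and hence
  -- differentiable.
  have hB : ∀ y ∈ M.U, M.zeroPart s A (scalarOp ξ χ) y =
      ((χ y).trace / 2 - ∑ ν, ξ ν y * (A ν y : ℂ)) • (1 : Mat) +
        rotationTerm s (fun a b => -M.lieCoeff ξ a b y) := fun y hy => by
    rw [← trace_zeroPart_scalarOp hy]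
    exact (hlie y hy).2.2
  have hb : ContDiffOn ℝ ∞ (fun y => (χ y).trace / 2 - ∑ ν, ξ ν y * (A ν y : ℂ)) M.U :=
    hφ.sub (ContDiffOn.sum fun ν _ => (hξ ν).mul (smoothOn_ofReal (hA ν)))
  have hdB : ∀ μ, pdMat μ (M.zeroPart s A (scalarOp ξ χ)) x =
      pd μ (fun y => (χ y).trace / 2 - ∑ ν, ξ ν y * (A ν y : ℂ)) x • (1 : Mat) +
        rotationTerm s (fun a b => -pd μ (M.lieCoeff ξ a b) x) := fun μ => by
    rw [pdMat_congr hU hB hx]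
    exact pdMat_smul_one_add_rotationTerm hb hL hx μ
  have hsum : ∑ μ, M.gamma s μ x * pdMat μ (M.zeroPart s A (scalarOp ξ χ)) x =
      ∑ i, gammaHat s i * (dir (M.frame i) (fun y => (χ y).trace / 2 -
        ∑ ν, ξ ν y * (A ν y : ℂ)) x • (1 : Mat) +
        rotationTerm s (fun j k => -dir (M.frame i) (M.lieCoeff ξ j k) x)) := by
    have e : ∀ i, dir (M.frame i) (fun y => (χ y).trace / 2 -
        ∑ ν, ξ ν y * (A ν y : ℂ)) x • (1 : Mat) +
        rotationTerm s (fun j k => -dir (M.frame i) (M.lieCoeff ξ j k) x) =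
        ∑ μ, M.frame i μ x • pdMat μ (M.zeroPart s A (scalarOp ξ χ)) x := by
      intro i
      simp only [hdB, smul_add, Finset.sum_add_distrib]
      rw [sum_smul_rotationTerm (fun μ => M.frame i μ x)]
      simp only [dir, Finset.sum_smul, smul_smul, mul_neg, Finset.sum_neg_distrib]
    simp only [e, gamma_eq, Finset.mul_sum, Finset.sum_mul, Matrix.smul_mul, Matrix.mul_smul]
    exact Finset.sum_comm
  -- The conformal condition on `L`, differentiated along the frame.
  have hdL : ∀ l i j, dir (M.frame l) (M.lieCoeff ξ i j) x * sgn i +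
      dir (M.frame l) (M.lieCoeff ξ j i) x * sgn j =
      2 / 3 * (∑ k, dir (M.frame l) (M.lieCoeff ξ k k) x) * (η i j : ℂ) := by
    intro l i j
    have h := dir_congr (X := M.frame l) hU (fun y hy => (hlie y hy).1 i j) hx
    have e1 : dir (M.frame l) (fun y => M.lieCoeff ξ i j y * sgn i + M.lieCoeff ξ j i y * sgn j)
        x = dir (M.frame l) (M.lieCoeff ξ i j) x * sgn i +
          dir (M.frame l) (M.lieCoeff ξ j i) x * sgn j := by
      have h1 := dir_sum (X := M.frame l) Finset.univ hU (f := ![fun y => sgn i * M.lieCoeff ξ i j y,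
        fun y => sgn j * M.lieCoeff ξ j i y]) (fun k => by
          fin_cases k
          · exact contDiffOn_const.mul (hL i j)
          · exact contDiffOn_const.mul (hL j i)) hx
      simp only [Fin.sum_univ_two, Matrix.cons_val_zero, Matrix.cons_val_one,
        Matrix.cons_val_fin_one, dir_const_mul hU _ (hL _ _) hx] at h1
      simp only [mul_comm _ (sgn _)]
      exact h1
    have e2 : dir (M.frame l) (fun y => 2 / 3 * (∑ k, M.lieCoeff ξ k k y) * (η i j : ℂ)) x =
        2 / 3 * (∑ k, dir (M.frame l) (M.lieCoeff ξ k k) x) * (η i j : ℂ) := by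
      rw [← dir_sum Finset.univ hU (fun k => hL k k) hx, mul_right_comm,
        ← dir_const_mul hU _ (ContDiffOn.sum fun k _ => hL k k) hx]
      congr 1
      funext y
      ring
    rw [← e1, h, e2]
  have main := potential_commutator_eq (s := s) hs
    (C := fun i j k => M.structureCoeff i j k x)
    (C' := fun i j k => dir ξ (M.structureCoeff i j k) x)
    (dL := fun l i j => dir (M.frame l) (M.lieCoeff ξ i j) x)
    (L := fun i j => M.lieCoeff ξ i j x) (a := fun i => M.framePotential A i x)
    (a' := fun i => dir ξ (M.framePotential A i) x)
    (db := fun i => dir (M.frame i) (fun y => (χ y).trace / 2 - ∑ ν, ξ ν y * (A ν y : ℂ)) x)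
    (m := m) (b := (χ x).trace / 2 - ∑ ν, ξ ν x * (A ν x : ℂ))
    (fun i j k => structureCoeff_antisymm i j k) (hlie x hx).1 hdL
    (fun i j k => dir_structureCoeff hx hξ i j k)
  rw [scalarZero, hsum, sum_smul_pdMat_zeroPart_dirac hs hA m hx, hB x hx, (hlie x hx).2.1,
    zeroPart_dirac hs m hx, main]
  simp only [zero_order_coefficient hA hξ hφ hx]
  congr 2
  rw [divergence_eq_lieCoeff hx]
  ring

end ZeroOrder

end Spacetime
-- The converse and the massive case
namespace Spacetime

section NormalForm

variable {M : Spacetime} {s : ℝ} {A : Fin 3 → Coord → ℝ} {m : ℝ} {x : Coord}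
  {ξ : Fin 3 → Coord → ℂ}

theorem smooth_frameDeriv (hξ : ∀ μ, ContDiffOn ℝ ∞ (ξ μ) M.U) (a b : Fin 3) :
    ContDiffOn ℝ ∞ (M.frameDeriv ξ a b) M.U :=
  ContDiffOn.sum fun μ _ => (M.smooth_frame a μ).mul (ContDiffOn.sum fun ν _ =>
    (M.smooth_covDeriv hξ ν μ).mul (smoothOn_ofReal (M.smooth_triad b ν)))

theorem trace_rotationTerm (s : ℝ) (L : Fin 3 → Fin 3 → ℂ) : (rotationTerm s L).trace = 0 := by
  rw [rotationTerm_eq_cliff, Matrix.trace_fin_two]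
  simp [cliff]

theorem smooth_normalForm_pot (hξ : ∀ μ, ContDiffOn ℝ ∞ (ξ μ) M.U) {φ : Coord → ℂ}
    (hφ : ContDiffOn ℝ ∞ φ M.U) : SmoothMat M.U (M.normalForm s ξ φ).pot := by
  intro i j
  exact ((SmoothMat.smul hφ (SmoothMat.const (1 : Mat))).add
    (smoothMat_rotationTerm (smooth_frameDeriv hξ)) i j).congr fun x hx => by
      rw [normalForm_pot_eq hx]

theorem smooth_normalForm (hξ : ∀ μ, ContDiffOn ℝ ∞ (ξ μ) M.U) {φ : Coord → ℂ}
    (hφ : ContDiffOn ℝ ∞ φ M.U) : (M.normalForm s ξ φ).Smooth M.U :=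
  ⟨fun μ => SmoothMat.smul (hξ μ) (SmoothMat.const 1), smooth_normalForm_pot hξ hφ⟩

theorem trace_normalForm_pot (hx : x ∈ M.U) (ξ : Fin 3 → Coord → ℂ) (φ : Coord → ℂ) :
    ((M.normalForm s ξ φ).pot x).trace / 2 = φ x := by
  rw [normalForm_pot_eq hx, Matrix.trace_add, trace_rotationTerm, Matrix.trace_smul,
    Matrix.trace_one]
  simp

theorem potentialDefect_congr {φ φ' : Coord → ℂ} (h : ∀ y ∈ M.U, φ y = φ' y) (hx : x ∈ M.U)
    (β : Fin 3) : M.potentialDefect A ξ φ β x = M.potentialDefect A ξ φ' β x := by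
  rw [potentialDefect, potentialDefect, pd_congr M.isOpen_U h hx]

/-- The commutator of the normal form with `H`, for a solution of the determining system. -/
theorem normalForm_commutator (hs : s = 1 ∨ s = -1) (hA : ∀ μ, ContDiffOn ℝ ∞ (A μ) M.U)
    {φ : Coord → ℂ} (h : M.IsDetermining A m ξ φ) {ψ : Coord → Spinor}
    (hψ : ContDiffOn ℝ ∞ ψ M.U) (hx : x ∈ M.U) :
    M.act s A (M.normalForm s ξ φ) (M.act s A (M.dirac s m) ψ) x -
        M.act s A (M.dirac s m) (M.act s A (M.normalForm s ξ φ) ψ) x =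
      (-(Complex.I / 3) * M.divergence ξ x) • M.act s A (M.dirac s m) ψ x := by
  have hξ := h.smooth_vec
  have hpot := smooth_normalForm_pot (s := s) hξ h.smooth_fun
  have htr := fun y (hy : y ∈ M.U) => trace_normalForm_pot (s := s) hy ξ φ
  set q : Coord → Mat := fun y => (-(Complex.I / 3) * M.divergence ξ y) • (1 : Mat) with hq
  have hX : M.normalForm s ξ φ = scalarOp ξ (M.normalForm s ξ φ).pot := rfl
  have hfirst : ∀ y ∈ M.U, ∀ ν,
      M.scalarFirst s A ξ (M.normalForm s ξ φ).pot (q y) ν y = 0 := fun y hy =>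
    (scalarFirst_eq_zero_iff hs hy (q y)).2 ⟨(isConformalKilling_iff ξ).1 h.conformalKilling y hy,
      rfl, by rw [htr y hy, normalForm_pot_eq hy]⟩
  have hzero : M.scalarZero s A m ξ (M.normalForm s ξ φ).pot (q x) x = 0 := by
    rw [scalarZero_eq hs hA hξ hpot m hfirst hx, h.mass x hx]
    have hdef : ∀ β, M.potentialDefect A ξ
        (fun y => ((M.normalForm s ξ φ).pot y).trace / 2) β x = 0 := fun β => by
      rw [potentialDefect_congr htr hx, potentialDefect, h.potential x hx, sub_self]
    simp [hdef]
  have hact : M.act s A (matrixOp q) (M.act s A (M.dirac s m) ψ) x =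
      (-(Complex.I / 3) * M.divergence ξ x) • M.act s A (M.dirac s m) ψ x := by
    rw [act]
    simp only [matrixOp, hq, Matrix.zero_mulVec, Finset.sum_const_zero, zero_add,
      Matrix.smul_mulVec, Matrix.one_mulVec]
  have hvec : ∀ ν, (matrixOp q).vec ν x = 0 := fun ν => rfl
  rw [← hact, ← sub_eq_zero, hX, commutator_eq_secondOrder hA (smooth_scalarOp hξ hpot)
    (smooth_dirac m) _ hψ hx]
  refine secondOrder_eq_zero M.isOpen_U (fun μ ν => ?_) (fun ν => ?_) ?_ hψ hx
  -- Scalar `ξ^μ` commute with the `γ^ν`, so the second-order coefficients are antisymmetric and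
  -- their symmetrization vanishes.
  · simp only [hvec, scalarOp, Matrix.smul_mul, Matrix.mul_smul, Matrix.one_mul, Matrix.mul_one,
      Matrix.zero_mul]
    simp only [dirac]
    abel
  · rw [firstCoeff_sub_eq m hξ _ hvec hx]
    exact hfirst x hx ν
  · rw [zeroCoeff_sub_eq m ξ _ hvec]
    exact hzero

theorem isSymmetryOperator_normalForm (hs : s = 1 ∨ s = -1)
    (hA : ∀ μ, ContDiffOn ℝ ∞ (A μ) M.U) {φ : Coord → ℂ} (h : M.IsDetermining A m ξ φ) :
    M.IsSymmetryOperator s A m (M.normalForm s ξ φ) := by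
  refine ⟨matrixOp fun y => (-(Complex.I / 3) * M.divergence ξ y) • (1 : Mat),
    ⟨fun ν => SmoothMat.const 0, ?_⟩, fun ψ hψ x hx => ?_⟩
  · exact SmoothMat.smul (contDiffOn_const.mul (smooth_divergence h.smooth_vec)) (SmoothMat.const _)
  · rw [normalForm_commutator hs hA h hψ hx]
    conv_rhs => rw [act]
    simp only [matrixOp, Matrix.zero_mulVec, Finset.sum_const_zero, zero_add,
      Matrix.smul_mulVec, Matrix.one_mulVec]

/-- Lowering an index commutes with the covariant derivative because `∇g = 0`. -/
theorem covDerivLower_lower (hξ : ∀ μ, ContDiffOn ℝ ∞ (ξ μ) M.U) (hx : x ∈ M.U) (ν μ : Fin 3) :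
    M.covDerivLower (M.lower ξ) ν μ x = ∑ α, (M.g x ν α : ℂ) * M.covDeriv ξ α μ x := by
  have hg := fun i j => smoothOn_ofReal (M.smooth_g i j)
  have h1 : pd μ (M.lower ξ ν) x = ∑ α, (((pd μ (fun y => M.g y ν α) x : ℝ) : ℂ) * ξ α x +
      (M.g x ν α : ℂ) * pd μ (ξ α) x) := by
    have e : M.lower ξ ν = fun y => ∑ α, (M.g y ν α : ℂ) * ξ α y := rfl
    have dg := fun α => differentiableAt_of_smoothOn M.isOpen_U (hg ν α) hx
    have dξ := fun α => differentiableAt_of_smoothOn M.isOpen_U (hξ α) hx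
    rw [e, pd_sum (f := fun α y => (M.g y ν α : ℂ) * ξ α y) (fun α _ => (dg α).mul (dξ α))]
    refine Finset.sum_congr rfl fun α _ => ?_
    rw [pd_mul (dg α) (dξ α), pd_ofReal (differentiableAt_g hx ν α)]
  simp only [covDerivLower, h1, pd_g hx, lower, covDeriv, Fin.sum_univ_three, Complex.ofReal_add,
    Complex.ofReal_mul]
  simp only [M.g_symm x 1 0, M.g_symm x 2 0, M.g_symm x 2 1]
  ring

theorem isKilling_of_divergence_eq_zero (hξ : ∀ μ, ContDiffOn ℝ ∞ (ξ μ) M.U)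
    (h : M.IsConformalKilling ξ) (hdiv : ∀ x ∈ M.U, M.divergence ξ x = 0) : M.IsKilling ξ := by
  intro x hx μ ν
  have hD : ∀ a c, M.frameDeriv ξ a c x * sgn a + M.frameDeriv ξ c a x * sgn c = 0 := by
    intro a c
    rw [(isConformalKilling_iff ξ).1 h x hx a c, ← divergence_eq hx, hdiv x hx]
    ring
  have hsg : ∀ a, sgn a * sgn a = 1 := by
    intro a
    fin_cases a <;> simp [sgn, η]
  have hg : ∀ ν c, ∑ α, (M.g x ν α : ℂ) * M.frame c α x = sgn c * (M.triad c ν x : ℂ) := by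
    intro ν c
    have := congrArg (fun r : ℝ => (r : ℂ)) (sum_g_invTriad hx ν c)
    simpa [frame, sgn] using this
  have key : ∀ ν μ, M.covDerivLower (M.lower ξ) ν μ x = ∑ a, ∑ c,
      (M.triad a μ x : ℂ) * (M.triad c ν x : ℂ) * (sgn c * M.frameDeriv ξ a c x) := by
    intro ν μ
    have e : ∑ a, ∑ c, (M.triad a μ x : ℂ) * (M.triad c ν x : ℂ) *
        (sgn c * M.frameDeriv ξ a c x) = ∑ a, ∑ c, (M.triad a μ x : ℂ) * M.frameDeriv ξ a c x *
        ∑ α, (M.g x ν α : ℂ) * M.frame c α x := by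
      refine Finset.sum_congr rfl fun a _ => Finset.sum_congr rfl fun c _ => ?_
      rw [hg]
      ring
    rw [covDerivLower_lower hξ hx, e]
    simp only [covDeriv_eq hx, Fin.sum_univ_three]
    ring
  rw [key, key, Finset.sum_comm]
  simp only [← Finset.sum_add_distrib]
  refine Finset.sum_eq_zero fun a _ => Finset.sum_eq_zero fun c _ => ?_
  -- `hD` carries the sign of the differentiated index, the lowered derivative that of the other
  -- one; multiplication by `sgn a * sgn c` exchanges them.
  linear_combination (M.triad a ν x : ℂ) * (M.triad c μ x : ℂ) * sgn a * sgn c * hD a c -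
    (M.triad a ν x : ℂ) * (M.triad c μ x : ℂ) * (sgn c * M.frameDeriv ξ a c x * hsg a +
      sgn a * M.frameDeriv ξ c a x * hsg c)

end NormalForm

/-! ### Reduction of an arbitrary symmetry operator -/

section Reduction

variable {M : Spacetime} {s : ℝ} {A : Fin 3 → Coord → ℝ} {m : ℝ} {x : Coord}

variable (M) in
/-- The frame components `X^a = e^a_μ X^μ` of the matrix coefficients of an operator. -/
def frameVec (X : FirstOrderOp) (a : Fin 3) (x : Coord) : Mat :=
  ∑ μ, (M.triad a μ x : ℂ) • X.vec μ x

theorem vec_eq_sum_frameVec (hx : x ∈ M.U) (X : FirstOrderOp) (μ : Fin 3) :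
    X.vec μ x = ∑ a, M.frame a μ x • M.frameVec X a x := by
  simp only [frameVec, Finset.smul_sum, smul_smul]
  rw [Finset.sum_comm]
  simp only [← Finset.sum_smul, sum_frame_triad hx]
  simp

theorem smooth_frameVec {X : FirstOrderOp} (hX : X.Smooth M.U) (a : Fin 3) :
    SmoothMat M.U (M.frameVec X a) :=
  SmoothMat.sum fun μ _ => SmoothMat.smul (smoothOn_ofReal (M.smooth_triad a μ)) (hX.1 μ)

theorem frame_symbol {X Ψ : FirstOrderOp} (hx : x ∈ M.U)
    (h : ∀ μ ν, (-(X.vec μ x * M.gamma s ν x) - -(M.gamma s μ x * X.vec ν x) -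
        -(Ψ.vec μ x * M.gamma s ν x)) +
      (-(X.vec ν x * M.gamma s μ x) - -(M.gamma s ν x * X.vec μ x) -
        -(Ψ.vec ν x * M.gamma s μ x)) = 0) (a b : Fin 3) :
    M.frameVec X a x * gammaHat s b + M.frameVec X b x * gammaHat s a -
        gammaHat s b * M.frameVec X a x - gammaHat s a * M.frameVec X b x =
      M.frameVec Ψ a x * gammaHat s b + M.frameVec Ψ b x * gammaHat s a := by
  have e1 : ∀ (Y : FirstOrderOp) a b, M.frameVec Y a x * gammaHat s b = ∑ μ, ∑ ν,
      ((M.triad a μ x : ℂ) * (M.triad b ν x : ℂ)) • (Y.vec μ x * M.gamma s ν x) := by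
    intro Y a b
    rw [← sum_triad_gamma hx b]
    simp only [frameVec, Finset.sum_mul, Finset.mul_sum, Matrix.smul_mul, Matrix.mul_smul,
      smul_smul]
    rw [Finset.sum_comm]
    exact Finset.sum_congr rfl fun μ _ => Finset.sum_congr rfl fun ν _ => by rw [mul_comm]
  have e2 : ∀ (Y : FirstOrderOp) a b, gammaHat s a * M.frameVec Y b x = ∑ μ, ∑ ν,
      ((M.triad a μ x : ℂ) * (M.triad b ν x : ℂ)) • (M.gamma s μ x * Y.vec ν x) := by
    intro Y a b
    rw [← sum_triad_gamma hx a]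
    simp only [frameVec, Finset.sum_mul, Finset.mul_sum, Matrix.smul_mul, Matrix.mul_smul,
      smul_smul]
    rw [Finset.sum_comm]
    exact Finset.sum_congr rfl fun μ _ => Finset.sum_congr rfl fun ν _ => by rw [mul_comm]
  have swap : ∀ F : Fin 3 → Fin 3 → Mat,
      ∑ μ, ∑ ν, ((M.triad b μ x : ℂ) * (M.triad a ν x : ℂ)) • F μ ν =
      ∑ μ, ∑ ν, ((M.triad a μ x : ℂ) * (M.triad b ν x : ℂ)) • F ν μ := by
    intro F
    rw [Finset.sum_comm]
    exact Finset.sum_congr rfl fun μ _ => Finset.sum_congr rfl fun ν _ => by rw [mul_comm]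
  rw [← sub_eq_zero, e1 X a b, e1 X b a, e1 Ψ a b, e1 Ψ b a, e2 X b a, e2 X a b,
    swap fun μ ν => X.vec μ x * M.gamma s ν x, swap fun μ ν => Ψ.vec μ x * M.gamma s ν x,
    swap fun μ ν => M.gamma s μ x * X.vec ν x]
  simp only [← Finset.sum_sub_distrib, ← Finset.sum_add_distrib, ← smul_sub, ← smul_add]
  refine Finset.sum_eq_zero fun μ _ => Finset.sum_eq_zero fun ν _ => ?_
  have h0 := h μ ν
  rw [smul_eq_zero]
  right
  have : -(X.vec μ x * M.gamma s ν x + X.vec ν x * M.gamma s μ x - M.gamma s ν x * X.vec μ x -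
      M.gamma s μ x * X.vec ν x - (Ψ.vec μ x * M.gamma s ν x + Ψ.vec ν x * M.gamma s μ x)) = 0 := by
    rw [← h0]
    abel
  exact neg_eq_zero.1 this

theorem gammaHat_sq (hs : s = 1 ∨ s = -1) (a : Fin 3) :
    gammaHat s a * gammaHat s a = sgn a • (1 : Mat) := by
  have h := I_mul_sign_mul_self hs
  fin_cases a
  · simp only [Fin.zero_eta, gammaHat_zero, sgn_zero]
    apply mat_ext <;> simp
  · simp only [Fin.mk_one, gammaHat_one, sgn_one]
    apply mat_ext <;> simp [h]
  · simp only [Fin.reduceFinMk, gammaHat_two, sgn_two]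
    apply mat_ext <;> simp

/-- The case `a = b` suffices, since `γ̂^a` squares to `± 1` and is invertible. -/
theorem vec_eq_zero_of_symbol (hs : s = 1 ∨ s = -1) {Ψ : FirstOrderOp} (hx : x ∈ M.U)
    (h : ∀ a b, M.frameVec Ψ a x * gammaHat s b + M.frameVec Ψ b x * gammaHat s a = 0)
    (μ : Fin 3) : Ψ.vec μ x = 0 := by
  have h0 : ∀ a, M.frameVec Ψ a x = 0 := by
    intro a
    have h1 : M.frameVec Ψ a x * gammaHat s a = 0 := by
      have := h a a
      rw [← two_smul ℂ, smul_eq_zero] at this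
      exact this.resolve_left two_ne_zero
    have h2 : sgn a * sgn a = 1 := by
      fin_cases a <;> simp [sgn, η]
    calc M.frameVec Ψ a x = sgn a • (M.frameVec Ψ a x * (gammaHat s a * gammaHat s a)) := by
          rw [gammaHat_sq hs, Matrix.mul_smul, smul_smul, h2, one_smul, Matrix.mul_one]
      _ = 0 := by rw [← Matrix.mul_assoc, h1, Matrix.zero_mul, smul_zero]
  rw [vec_eq_sum_frameVec hx]
  simp [h0]

/-- The coefficients of the operator identity `[X, H] = Ψ H` at a point. -/
theorem coeff_eq_zero_of_commutator (hA : ∀ μ, ContDiffOn ℝ ∞ (A μ) M.U) {X Ψ : FirstOrderOp}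
    (hX : X.Smooth M.U) (h : ∀ ψ : Coord → Spinor, ContDiffOn ℝ ∞ ψ M.U → ∀ x ∈ M.U,
      M.act s A X (M.act s A (M.dirac s m) ψ) x - M.act s A (M.dirac s m) (M.act s A X ψ) x =
        M.act s A Ψ (M.act s A (M.dirac s m) ψ) x) (hx : x ∈ M.U) :
    M.zeroCoeff s A X (M.dirac s m) x - M.zeroCoeff s A (M.dirac s m) X x -
        M.zeroCoeff s A Ψ (M.dirac s m) x = 0 ∧
      (∀ ν, M.firstCoeff s A X (M.dirac s m) ν x - M.firstCoeff s A (M.dirac s m) X ν x -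
        M.firstCoeff s A Ψ (M.dirac s m) ν x = 0) ∧
      ∀ a b, M.frameVec X a x * gammaHat s b + M.frameVec X b x * gammaHat s a -
        gammaHat s b * M.frameVec X a x - gammaHat s a * M.frameVec X b x =
      M.frameVec Ψ a x * gammaHat s b + M.frameVec Ψ b x * gammaHat s a := by
  have h0 := coeff_eq_zero_of_secondOrder (x := x) fun ψ hψ => by
    rw [← commutator_eq_secondOrder hA hX (smooth_dirac m) Ψ hψ.contDiffOn hx,
      h ψ hψ.contDiffOn x hx, sub_self]
  exact ⟨h0.1, h0.2.1, frame_symbol hx h0.2.2⟩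

/-- Scalar coefficients commute with the Dirac matrices, so the symbol of the commutator is zero and
`Ψ` has no derivatives. The first-order equations then determine `χ` up to its trace, which becomes
`φ`; the components of the zeroth-order equation along `1` and along the `γ̂^i` are the mass
condition and the equation for `φ_{,β}`. -/
theorem isDetermining_of_scalarOp (hs : s = 1 ∨ s = -1) (hA : ∀ μ, ContDiffOn ℝ ∞ (A μ) M.U)
    {ξ : Fin 3 → Coord → ℂ} {χ : Coord → Mat} (hξ : ∀ μ, ContDiffOn ℝ ∞ (ξ μ) M.U)
    (hχ : SmoothMat M.U χ) (h : M.IsSymmetryOperator s A m (scalarOp ξ χ)) :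
    M.IsDetermining A m ξ (fun y => (χ y).trace / 2) ∧
      ∀ x ∈ M.U, χ x = (M.normalForm s ξ (fun y => (χ y).trace / 2)).pot x := by
  obtain ⟨Ψ, -, hcomm⟩ := h
  have hcoeff := fun x (hx : x ∈ M.U) =>
    coeff_eq_zero_of_commutator hA (smooth_scalarOp hξ hχ) hcomm hx
  have hvec : ∀ x ∈ M.U, ∀ ν, Ψ.vec ν x = 0 := by
    intro x hx
    refine vec_eq_zero_of_symbol hs hx fun a b => ?_
    rw [← (hcoeff x hx).2.2 a b]
    have : ∀ a, M.frameVec (scalarOp ξ χ) a x = M.comp ξ a x • (1 : Mat) := fun a => by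
      simp only [frameVec, scalarOp, comp, smul_smul, Finset.sum_smul, mul_comm]
    simp only [this, Matrix.smul_mul, Matrix.mul_smul, Matrix.one_mul, Matrix.mul_one]
    abel
  have hfirst : ∀ x ∈ M.U, ∀ ν, M.scalarFirst s A ξ χ (Ψ.pot x) ν x = 0 := by
    intro x hx ν
    rw [← firstCoeff_sub_eq m hξ χ (hvec x hx) hx]
    exact (hcoeff x hx).2.1 ν
  have hzero : ∀ x ∈ M.U, M.scalarZero s A m ξ χ (Ψ.pot x) x = 0 := by
    intro x hx
    rw [← zeroCoeff_sub_eq m ξ χ (hvec x hx)]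
    exact (hcoeff x hx).1
  have hiff := fun x hx => (scalarFirst_eq_zero_iff hs hx (Ψ.pot x)).1 (hfirst x hx)
  have hparts := fun x hx => (add_sum_gammaHat_eq_zero_iff hs _ _).1
    ((scalarZero_eq hs hA hξ hχ m hfirst hx).symm.trans (hzero x hx))
  refine ⟨⟨hξ, ?_, ?_, ?_, ?_⟩, ?_⟩
  · simp only [Matrix.trace_fin_two]
    exact ((hχ 0 0).add (hχ 1 1)).div_const 2
  · exact (isConformalKilling_iff ξ).2 fun x hx => (hiff x hx).1
  · intro x hx
    exact (mul_eq_zero.1 (hparts x hx).1).resolve_left (by simp)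
  · intro x hx β
    have h1 : ∀ i, ∑ β, M.frame i β x *
        M.potentialDefect A ξ (fun y => (χ y).trace / 2) β x = 0 := fun i =>
      (mul_eq_zero.1 ((hparts x hx).2 i)).resolve_left (by simp)
    have h2 : M.potentialDefect A ξ (fun y => (χ y).trace / 2) β x = ∑ ρ, (∑ a,
        M.frame a ρ x * (M.triad a β x : ℂ)) *
          M.potentialDefect A ξ (fun y => (χ y).trace / 2) ρ x := by
      simp only [sum_frame_triad hx]
      simp
    have h3 : ∑ ρ, (∑ a, M.frame a ρ x * (M.triad a β x : ℂ)) *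
        M.potentialDefect A ξ (fun y => (χ y).trace / 2) ρ x = ∑ a, (M.triad a β x : ℂ) *
          ∑ ρ, M.frame a ρ x * M.potentialDefect A ξ (fun y => (χ y).trace / 2) ρ x := by
      simp only [Finset.sum_mul, Finset.mul_sum]
      rw [Finset.sum_comm]
      exact Finset.sum_congr rfl fun a _ => Finset.sum_congr rfl fun ρ _ => by ring
    rw [h3] at h2
    simp only [h1, mul_zero, Finset.sum_const_zero] at h2
    exact sub_eq_zero.1 h2
  · intro x hx
    rw [normalForm_pot_eq hx]
    exact (hiff x hx).2.2

theorem smooth_leftFactor {X : Fin 3 → Coord → Mat} {U : Set Coord}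
    (hX : ∀ a, SmoothMat U (X a)) : SmoothMat U (fun x => leftFactor s (fun a => X a x)) := by
  intro i j
  fin_cases i <;> fin_cases j
  · exact contDiffOn_const.mul (hX 1 0 1)
  · exact (hX 0 0 1).neg
  · exact hX 0 1 0
  · exact contDiffOn_const.mul (hX 1 1 0)

/-- Every symmetry operator has scalar coefficients of the momenta modulo trivial operators. -/
theorem exists_scalarOp (hs : s = 1 ∨ s = -1) (hA : ∀ μ, ContDiffOn ℝ ∞ (A μ) M.U)
    {X : FirstOrderOp} (hX : X.Smooth M.U) (h : M.IsSymmetryOperator s A m X) :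
    ∃ (R : Coord → Mat) (ξ : Fin 3 → Coord → ℂ) (χ : Coord → Mat), SmoothMat M.U R ∧
      (∀ μ, ContDiffOn ℝ ∞ (ξ μ) M.U) ∧ SmoothMat M.U χ ∧
        M.DifferByTrivial s A m R X (scalarOp ξ χ) := by
  obtain ⟨Ψ, -, hcomm⟩ := h
  set R : Coord → Mat := fun x => leftFactor s (fun a => M.frameVec X a x) with hR
  set f : Fin 3 → Coord → ℂ := fun a x => M.frameVec X a x 0 0 - (R x * gammaHat s a) 0 0 with hf
  have hRs : SmoothMat M.U R := smooth_leftFactor (smooth_frameVec hX)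
  have hfs : ∀ a, ContDiffOn ℝ ∞ (f a) M.U := fun a =>
    ((smooth_frameVec hX a) 0 0).sub ((hRs.mul (SmoothMat.const (gammaHat s a))) 0 0)
  -- The term `m R` compensates the `-m R` contained in `R H`.
  refine ⟨R, fun μ x => ∑ a, f a x * M.frame a μ x, fun x => X.pot x + (m : ℂ) • R x, hRs,
    fun μ => ContDiffOn.sum fun a _ => (hfs a).mul (M.smooth_frame a μ),
    hX.2.add (SmoothMat.smul contDiffOn_const hRs), fun ψ hψ x hx => ?_⟩
  have hfv : ∀ a, M.frameVec X a x = R x * gammaHat s a + f a x • (1 : Mat) :=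
    eq_leftFactor_mul_add hs (coeff_eq_zero_of_commutator hA hX hcomm hx).2.2
  have hvec : ∀ μ, X.vec μ x =
      R x * M.gamma s μ x + (∑ a, f a x * M.frame a μ x) • (1 : Mat) := by
    intro μ
    rw [vec_eq_sum_frameVec hx]
    simp only [hfv, gamma_eq, smul_add, Finset.sum_add_distrib, Finset.mul_sum, Matrix.mul_smul,
      smul_smul, Finset.sum_smul, mul_comm]
  simp only [act, hvec, scalarOp, dirac, Matrix.add_mulVec, Matrix.mulVec_add, Matrix.mulVec_sum,
    Finset.sum_add_distrib, ← Matrix.mulVec_mulVec, Matrix.smul_mulVec, Matrix.mulVec_smul,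
    Matrix.neg_mulVec, Matrix.mulVec_neg, Matrix.one_mulVec]
  abel

end Reduction

end Spacetime
end DiracSymm
end
theorem theorem2 (M : DiracSymm.Spacetime) (A : Fin 3 → DiracSymm.Coord → ℝ)
    (hA : ∀ μ, ContDiffOn ℝ ∞ (A μ) M.U) (m s : ℝ) (hs : s = 1 ∨ s = -1) :
    -- every symmetry operator has the normal form modulo trivial operators
    (∀ X : DiracSymm.FirstOrderOp, X.Smooth M.U → M.IsSymmetryOperator s A m X →
      ∃ (R : DiracSymm.Coord → DiracSymm.Mat) (ξ : Fin 3 → DiracSymm.Coord → ℂ)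
        (φ : DiracSymm.Coord → ℂ),
        DiracSymm.SmoothMat M.U R ∧ M.IsDetermining A m ξ φ ∧
          M.DifferByTrivial s A m R X (M.normalForm s ξ φ)) ∧
    -- every solution of the system for `ξ` and `φ` gives symmetry operators
    (∀ (X : DiracSymm.FirstOrderOp) (R : DiracSymm.Coord → DiracSymm.Mat)
      (ξ : Fin 3 → DiracSymm.Coord → ℂ) (φ : DiracSymm.Coord → ℂ),
      X.Smooth M.U → DiracSymm.SmoothMat M.U R → M.IsDetermining A m ξ φ →
        M.DifferByTrivial s A m R X (M.normalForm s ξ φ) → M.IsSymmetryOperator s A m X) ∧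
    -- in the massive case `ξ` is a Killing field and the normal form commutes with `H`
    (m ≠ 0 → ∀ (ξ : Fin 3 → DiracSymm.Coord → ℂ) (φ : DiracSymm.Coord → ℂ),
      M.IsDetermining A m ξ φ →
        M.IsKilling ξ ∧ M.CommutesWithDirac s A m (M.normalForm s ξ φ)) := by
  open DiracSymm DiracSymm.Spacetime in
  refine ⟨fun X hX hsymm => ?_, fun X R ξ φ _ hR hdet hdiff => ?_, fun hm ξ φ hdet => ?_⟩
  · obtain ⟨R, ξ, χ, hR, hξ, hχ, hdiff⟩ := exists_scalarOp hs hA hX hsymm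
    -- The scalar operator is `X - R H`, obtained from the symmetry operator `X` by adding a trivial
    -- one.
    have hsc : M.IsSymmetryOperator s A m (scalarOp ξ χ) :=
      IsSymmetryOperator.of_differByTrivial hA hR.neg hX hdiff.symm hsymm
    obtain ⟨hdet, hpot⟩ := isDetermining_of_scalarOp hs hA hξ hχ hsc
    refine ⟨R, ξ, _, hR, hdet, fun ψ hψ x hx => ?_⟩
    rw [hdiff ψ hψ x hx]
    congr 1
    simp only [act, scalarOp, hpot x hx]
    rfl
  · exact IsSymmetryOperator.of_differByTrivial hA hR
      (smooth_normalForm hdet.smooth_vec hdet.smooth_fun) hdiff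
      (isSymmetryOperator_normalForm hs hA hdet)
  · have hdiv : ∀ x ∈ M.U, M.divergence ξ x = 0 := fun x hx =>
      (mul_eq_zero.1 (hdet.mass x hx)).resolve_left (by exact_mod_cast hm)
    refine ⟨isKilling_of_divergence_eq_zero hdet.smooth_vec hdet.conformalKilling hdiv,
      fun ψ hψ x hx => ?_⟩
    rw [← sub_eq_zero, normalForm_commutator hs hA hdet hψ hx, hdiv x hx, mul_zero, zero_smul]
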